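/- Let $n\ge 1$ and $1\le s\le n$, and let $f$ be a germ at the origin $O$ of a holomorphic diffeomorphism of $\mathbb C^n$ with $f(O)=O$. Assume that $O$ is a quasi-Brjuno fixed point of order $s$, that is, $df_O$ is diagonalizable and its eigenvalues, listed with multiplicity in a suitable order $\lambda=(\lambda_1,\dots,\lambda_n)$, satisfy the following two conditions, in which $k\in\mathbb N^n$, $|k|=k_1+\cdots+k_n$ and $\lambda^k=\lambda_1^{k_1}\cdots\lambda_n^{k_n}$. (i) $\lambda$ has only level $s$ resonances: for every $k$ with $|k|\ge 2$, one has $\lambda^k=\lambda_h$ for some $h\le s$ if and only if $k_1+\cdots+k_s=1$ and $\lambda_{s+1}^{k_{s+1}}\cdots\lambda_n^{k_n}=1$; and one has $\lambda^k=\lambda_j$ for some $j>s$ if and only if $k_1=\cdots=k_s=0$ and $\lambda_{s+1}^{k_{s+1}}\cdots\lambda_n^{k_n}=\lambda_j$ for some $j>s$. (ii) $\lambda$ satisfies the reduced Brjuno condition: there is a strictly increasing sequence of integers $(p_\nu)_{\nu\ge0}$ with $p_0=1$ such that $\sum_{\nu\ge 0}p_\nu^{-1}\log\tilde\omega(p_{\nu+1})^{-1}$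 converges, where $\tilde\omega(m)=\min\{|\lambda^k-\lambda_j| : 2\le|k|\le m,\ 1\le j\le n,\ \lambda^k\ne\lambda_j\}$. A germ at $O$ of a complex submanifold $M\ni O$ of $\mathbb C^n$ of codimension $s$ is called an osculating manifold of $f$ if it is $f$-invariant and its normal bundle $N_M=T\mathbb C^n|_M/TM$ admits, near $O$, a holomorphic flat $(1,0)$-connection $\nabla$ that commutes with $df|_{N_M}$, i.e. $\nabla_{f_*X}(f_*V)=f_*(\nabla_XV)$ for all germs of holomorphic vector fields $X$ on $M$ and of holomorphic sections $V$ of $N_M$. Then $f$ is holomorphically linearizable (conjugate to its differential at $O$ by a local holomorphic change of coordinates fixing $O$) if and only if $f$ admits an osculating manifold $M$ of codimension $s$ such that the eigenvalues of $d(f|_M)_O$, with multiplicity, are $\lambda_{s+1},\dots,\lambda_n$ (equivalently, $df_O$ acts on the fibre of $N_M$ at $O$ with eigenvalues $\lambda_1,\dots,\lambda_s$), and such that $f|_M$ is holomorphically linearizable. -/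

import Mathlib

open Filter Topology

/-- A germ at `0` of a holomorphic diffeomorphism of `ℂ^m` fixing `0`, given by a representative. -/
def IsHolDiffeoGerm {m : ℕ} (f : (Fin m → ℂ) → (Fin m → ℂ)) : Prop :=
  AnalyticAt ℂ f 0 ∧ f 0 = 0 ∧
    ∃ g : (Fin m → ℂ) → (Fin m → ℂ), AnalyticAt ℂ g 0 ∧ g 0 = 0 ∧
      (∀ᶠ z in 𝓝 0, g (f z) = z) ∧ (∀ᶠ z in 𝓝 0, f (g z) = z)

/-- `f` is holomorphically linearizable at the fixed point `0`: a local holomorphic change of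
coordinates `φ` conjugates `f` to its differential at `0`. -/
def IsHolLinearizable {m : ℕ} (f : (Fin m → ℂ) → (Fin m → ℂ)) : Prop :=
  ∃ φ : (Fin m → ℂ) → (Fin m → ℂ), IsHolDiffeoGerm φ ∧
    ∀ᶠ w in 𝓝 0, f (φ w) = φ (fderiv ℂ f 0 w)

/-- The monomial `lam^k = lam_1^{k_1} ⋯ lam_n^{k_n}`. -/
def eigMonomial {n : ℕ} (lam : Fin n → ℂ) (k : Fin n → ℕ) : ℂ := ∏ i, lam i ^ k i

/-- The part `lam_{s+1}^{k_{s+1}} ⋯ lam_n^{k_n}` of the monomial. -/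
def eigMonomialTail {n : ℕ} (s : ℕ) (lam : Fin n → ℂ) (k : Fin n → ℕ) : ℂ :=
  ∏ i with s ≤ i.val, lam i ^ k i

/-- Multi-indices with `k_1 + ⋯ + k_s = 1` and `lam_{s+1}^{k_{s+1}} ⋯ lam_n^{k_n} = 1`. -/
def levelSetOne {n : ℕ} (s : ℕ) (lam : Fin n → ℂ) : Set (Fin n → ℕ) :=
  {k | 2 ≤ ∑ i, k i ∧ ∑ i with i.val < s, k i = 1 ∧ eigMonomialTail s lam k = 1}

/-- Multi-indices with `k_1 = ⋯ = k_s = 0` and `lam_{s+1}^{k_{s+1}} ⋯ lam_n^{k_n} = lam_j`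
for some `j > s`. -/
def levelSetTwo {n : ℕ} (s : ℕ) (lam : Fin n → ℂ) : Set (Fin n → ℕ) :=
  {k | 2 ≤ ∑ i, k i ∧ (∀ i : Fin n, i.val < s → k i = 0) ∧
    ∃ j : Fin n, s ≤ j.val ∧ eigMonomialTail s lam k = lam j}

/-- `lam` has only level `s` resonances. Here the first `s` entries are the `λ_h`, the
remaining ones the `μ_j`. -/
def OnlyLevelResonances {n : ℕ} (s : ℕ) (lam : Fin n → ℂ) : Prop :=
  ∀ k : Fin n → ℕ, 2 ≤ ∑ i, k i →
    ((∃ h : Fin n, h.val < s ∧ eigMonomial lam k = lam h) ↔ k ∈ levelSetOne s lam) ∧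
    ((∃ j : Fin n, s ≤ j.val ∧ eigMonomial lam k = lam j) ↔ k ∈ levelSetTwo s lam)

/-- The minimum of `|lam^k - lam_j|` over all `2 ≤ |k| ≤ m` and `1 ≤ j ≤ n` such that `k` is not
resonant relative to `j` (the set is finite, so the infimum is a minimum when it is nonempty). -/
noncomputable def reducedOmega {n : ℕ} (lam : Fin n → ℂ) (m : ℕ) : ℝ :=
  sInf {x : ℝ | ∃ (k : Fin n → ℕ) (j : Fin n), 2 ≤ ∑ i, k i ∧ ∑ i, k i ≤ m ∧
    eigMonomial lam k ≠ lam j ∧ x = ‖eigMonomial lam k - lam j‖}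

/-- The reduced Brjuno condition. -/
def ReducedBrjuno {n : ℕ} (lam : Fin n → ℂ) : Prop :=
  ∃ p : ℕ → ℕ, StrictMono p ∧ p 0 = 1 ∧
    Summable fun ν : ℕ => (p ν : ℝ)⁻¹ * Real.log (reducedOmega lam (p (ν + 1)))⁻¹

/-- `0` is a quasi-Brjuno fixed point of order `s` of the germ of holomorphic diffeomorphism `f`,
where `lam` lists the spectrum of the (diagonalizable) differential with multiplicity,
in an order for which only level `s` resonances occur. -/
def IsQuasiBrjuno {n : ℕ} (s : ℕ) (f : (Fin n → ℂ) → (Fin n → ℂ)) (lam : Fin n → ℂ) : Prop :=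
  IsHolDiffeoGerm f ∧
  (∃ b : Module.Basis (Fin n) ℂ (Fin n → ℂ), ∀ i, fderiv ℂ f 0 (b i) = lam i • b i) ∧
  OnlyLevelResonances s lam ∧ ReducedBrjuno lam

/-- A germ at `0` of a complex submanifold of dimension `r` of `ℂ^n`, passing through `0`,
together with a holomorphic chart (the restriction of `chart` to `carrier`) centred at `0`,
and its holomorphic inverse `param`. -/
structure SubmanifoldGerm (n r : ℕ) where
  carrier : Set (Fin n → ℂ)
  param : (Fin r → ℂ) → (Fin n → ℂ)
  chart : (Fin n → ℂ) → (Fin r → ℂ)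
  analyticAt_param : AnalyticAt ℂ param 0
  analyticAt_chart : AnalyticAt ℂ chart 0
  zero_mem : (0 : Fin n → ℂ) ∈ carrier
  param_zero : param 0 = 0
  param_mem : ∀ᶠ y in 𝓝 0, param y ∈ carrier
  chart_param : ∀ᶠ y in 𝓝 0, chart (param y) = y
  param_chart : ∀ᶠ z in 𝓝[carrier] 0, param (chart z) = z

namespace SubmanifoldGerm

variable {n r : ℕ} (M : SubmanifoldGerm n r)

/-- `M` is `f`-invariant (as a germ). -/
def IsInvariant (f : (Fin n → ℂ) → (Fin n → ℂ)) : Prop :=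
  ∀ᶠ z in 𝓝[M.carrier] 0, f z ∈ M.carrier

/-- The germ `f|_M`, read in the chart of `M`. -/
def restrict (f : (Fin n → ℂ) → (Fin n → ℂ)) : (Fin r → ℂ) → (Fin r → ℂ) :=
  fun y => M.chart (f (M.param y))

/-- The tangent space of `M` at the point with coordinate `y`. -/
noncomputable def tangentSpace (y : Fin r → ℂ) : Submodule ℂ (Fin n → ℂ) :=
  LinearMap.range (fderiv ℂ M.param y).toLinearMap

/-- A holomorphic section of the normal bundle `N_M = Tℂ^n|_M / TM` near `0` is represented by a
map `V` into `ℂ^n`, holomorphic in the chart, the value at `y` being the class of `V y` modulo the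
tangent space at `y`. Two maps represent the same germ of section when they agree modulo the tangent
spaces near `0`. -/
def NormalEq (V W : (Fin r → ℂ) → (Fin n → ℂ)) : Prop :=
  ∀ᶠ y in 𝓝 0, V y - W y ∈ M.tangentSpace y

/-- A germ at `0` of a holomorphic `(1,0)`-connection on the normal bundle of `M`: to a germ of
holomorphic vector field `X` on `M` and a germ of holomorphic section `V` of the normal bundle, it
assigns a germ of holomorphic section `∇_X V`, linearly over holomorphic functions in `X`, additively
and with the Leibniz rule in `V`. Vector fields on `M` are written in the chart of `M`. -/
structure NormalConnection where
  cov : ((Fin r → ℂ) → (Fin r → ℂ)) → ((Fin r → ℂ) → (Fin n → ℂ)) → ((Fin r → ℂ) → (Fin n → ℂ))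
  analyticAt_cov : ∀ X V, AnalyticAt ℂ X 0 → AnalyticAt ℂ V 0 → AnalyticAt ℂ (cov X V) 0
  congr_field : ∀ X X' V, AnalyticAt ℂ X 0 → AnalyticAt ℂ X' 0 → AnalyticAt ℂ V 0 →
    X =ᶠ[𝓝 0] X' → M.NormalEq (cov X V) (cov X' V)
  congr_section : ∀ X V V', AnalyticAt ℂ X 0 → AnalyticAt ℂ V 0 → AnalyticAt ℂ V' 0 →
    M.NormalEq V V' → M.NormalEq (cov X V) (cov X V')
  add_field : ∀ X X' V, AnalyticAt ℂ X 0 → AnalyticAt ℂ X' 0 → AnalyticAt ℂ V 0 →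
    M.NormalEq (cov (fun y => X y + X' y) V) (fun y => cov X V y + cov X' V y)
  smul_field : ∀ (g : (Fin r → ℂ) → ℂ) X V,
    AnalyticAt ℂ g 0 → AnalyticAt ℂ X 0 → AnalyticAt ℂ V 0 →
    M.NormalEq (cov (fun y => g y • X y) V) (fun y => g y • cov X V y)
  add_section : ∀ X V V', AnalyticAt ℂ X 0 → AnalyticAt ℂ V 0 → AnalyticAt ℂ V' 0 →
    M.NormalEq (cov X (fun y => V y + V' y)) (fun y => cov X V y + cov X V' y)
  leibniz : ∀ (g : (Fin r → ℂ) → ℂ) X V,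
    AnalyticAt ℂ g 0 → AnalyticAt ℂ X 0 → AnalyticAt ℂ V 0 →
    M.NormalEq (cov X (fun y => g y • V y))
      (fun y => fderiv ℂ g y (X y) • V y + g y • cov X V y)

variable {M}

/-- The connection is flat: its curvature `[∇_X, ∇_X'] - ∇_[X, X']` vanishes. -/
def NormalConnection.IsFlat (D : M.NormalConnection) : Prop :=
  ∀ X X' V, AnalyticAt ℂ X 0 → AnalyticAt ℂ X' 0 → AnalyticAt ℂ V 0 →
    M.NormalEq (fun y => D.cov X (D.cov X' V) y - D.cov X' (D.cov X V) y)
      (D.cov (VectorField.lieBracket ℂ X X') V)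

variable (M)

/-- The vector field `X'` on `M` is the image of `X` under `d(f|_M)`. -/
def FieldPushforward (f : (Fin n → ℂ) → (Fin n → ℂ)) (X X' : (Fin r → ℂ) → (Fin r → ℂ)) : Prop :=
  ∀ᶠ y in 𝓝 0, X' (M.restrict f y) = fderiv ℂ (M.restrict f) y (X y)

/-- The section of `N_M` represented by `W` is the image under `df|_{N_M}` of the one represented
by `V`: at the image point, `W` is the class of `df (V)`. -/
def SectionPushforward (f : (Fin n → ℂ) → (Fin n → ℂ)) (V W : (Fin r → ℂ) → (Fin n → ℂ)) : Prop :=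
  ∀ᶠ y in 𝓝 0, W (M.restrict f y) - fderiv ℂ f (M.param y) (V y) ∈
    M.tangentSpace (M.restrict f y)

variable {M}

/-- The connection commutes with `df|_{N_M}`: `∇_{f_* X} (f_* V) = f_* (∇_X V)`. -/
def NormalConnection.CommutesWith (D : M.NormalConnection)
    (f : (Fin n → ℂ) → (Fin n → ℂ)) : Prop :=
  ∀ X X' V W, AnalyticAt ℂ X 0 → AnalyticAt ℂ X' 0 → AnalyticAt ℂ V 0 → AnalyticAt ℂ W 0 →
    M.FieldPushforward f X X' → M.SectionPushforward f V W →
    M.SectionPushforward f (D.cov X V) (D.cov X' W)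

variable (M)

/-- `M` is an osculating manifold of `f`. -/
def IsOsculating (f : (Fin n → ℂ) → (Fin n → ℂ)) : Prop :=
  M.IsInvariant f ∧ ∃ D : M.NormalConnection, D.IsFlat ∧ D.CommutesWith f

/-- The eigenvalues of `d(f|_M)` at `0`, with multiplicity, are `lam_{s+1}, …, lam_n`. -/
def HasTangentSpectrum (f : (Fin n → ℂ) → (Fin n → ℂ)) (s : ℕ) (lam : Fin n → ℂ) : Prop :=
  (fderiv ℂ (M.restrict f) 0).toLinearMap.charpoly =
    ∏ i with s ≤ i.val, (Polynomial.X - Polynomial.C (lam i))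

end SubmanifoldGerm

open scoped ENNReal NNReal

/-! ### Formal series defined by recursion, and their scalar majorants. -/

section RecursiveSeries

/-! If `f` is linear in some chart, split the chart by an eigenbasis of the differential and let `M`
be the subspace spanned by the last eigenvectors. In these coordinates `df` acts on the normal
bundle by a constant matrix, so it commutes with the flat connection for which constant normal
sections are parallel (`isOsculating_ofChart`).

Conversely, let `M` be an osculating manifold and `y` a coordinate on it in which `f|_M` is a linear
map `μ`. The Euler field of `y` is invariant under `μ`. Contracted with it, the commutation of the
connection with `df` becomes an equation for the normal derivative `A` of `f` along `M`: `dA(y) y =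
A(y) Γ(y) - Γ(μ y) A(y)`, with `Γ(0) = 0`. A frame `a` that is parallel along rays satisfies `da(y)
y = -Γ(y) a(y)`, `a(0) = id`. Then `A(y) a(y)` and `a(μ y) Λ`, where `Λ = A(0)`, solve the same
linear radial equation with the same initial value, so they coincide, and the gauge change `(x, y) ↦
(a(y) x, y)` makes the normal derivative constant (`exists_straightening`).

After this change `f` is a diagonal map plus a remainder `F` that vanishes on `x = 0` and whose
`x`-components vanish there to second order. Give weight one to the `x`-coordinates and weight zero
to the `y`-coordinates. Each monomial of `F` in a component has weight strictly above that of the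
component, whereas a level `s` resonance has weight exactly equal to it
(`OnlyLevelResonances.nonresonant`). Strict excess of weight survives substitution, so the formal
linearization meets only nonzero divisors.

Convergence is Brjuno's argument. A coefficient of the linearization is bounded by a geometrically
growing majorant times a product of inverse divisors along a tree of substitutions
(`exists_tree_linearizingSeries`). Two nested small divisors must have multi-indices far apart
(`exists_gap_constant`), so a tree of degree `|k|` has at most `2 |k| / m` divisors that are small
at scale `m` (`DivisorTree.count_mul_le`). Summing over scales, the reduced Brjuno condition bounds
the products geometrically (`DivisorTree.exists_prod_inv_le`). -/

theorem radius_pos_of_norm_le_geometric {𝕜 E F : Type*} [NontriviallyNormedField 𝕜]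
    [NormedAddCommGroup E] [NormedSpace 𝕜 E] [NormedAddCommGroup F] [NormedSpace 𝕜 F]
    {p : FormalMultilinearSeries 𝕜 E F} {A B : ℝ} (hB : 0 < B) (h : ∀ n, ‖p n‖ ≤ A * B ^ n) :
    0 < p.radius := by
  have h0 : 0 < B⁻¹ := by positivity
  refine lt_of_lt_of_le (ENNReal.coe_pos.2 h0)
    (p.le_radius_of_bound A (r := ⟨B⁻¹, h0.le⟩) fun n => ?_)
  have hp : (0 : ℝ) < B ^ n := by positivity
  calc ‖p n‖ * B⁻¹ ^ n ≤ A * B ^ n * B⁻¹ ^ n := by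
        gcongr; exact h n
    _ = A := by rw [inv_pow]; field_simp

/-- The scalar majorant of a fixed point series: coefficients obeying the recursion with all
divisors equal to one grow at most geometrically. -/
theorem exists_composition_majorant (C r : ℝ) (hC : 0 ≤ C) (hr : 0 ≤ r) :
    ∃ σ : ℕ → ℝ, (∀ n, 0 ≤ σ n) ∧ σ 1 = 1 ∧
      (∀ n, 2 ≤ n → σ n = ∑ c ∈ {c : Composition n | 1 < c.length}.toFinset,
        C * r ^ c.length * ∏ j, σ (c.blocksFun j)) ∧
      ∃ A B : ℝ, 0 < A ∧ 0 < B ∧ ∀ n, σ n ≤ A * B ^ n := by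
  -- This is the series `x - ∑ C (r x) ^ n` over `n ≠ 1`. The recursion for its formal right inverse
  -- is the required one (the constant term of `p` does not enter it), and the inverse of a
  -- convergent series converges.
  let p : FormalMultilinearSeries ℝ ℝ ℝ := fun n =>
    if n = 1 then ContinuousMultilinearMap.mkPiAlgebraFin ℝ n ℝ
    else -(C * r ^ n) • ContinuousMultilinearMap.mkPiAlgebraFin ℝ n ℝ
  have hnorm : ∀ n, ‖p n‖ ≤ (C + 1) * (r + 1) ^ n := by
    intro n
    have h1 : (1 : ℝ) ≤ (r + 1) ^ n := one_le_pow₀ (by linarith)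
    have h2 : r ^ n ≤ (r + 1) ^ n := pow_le_pow_left₀ hr (by linarith) n
    have h3 : ‖ContinuousMultilinearMap.mkPiAlgebraFin ℝ n ℝ‖ = 1 :=
      ContinuousMultilinearMap.norm_mkPiAlgebraFin
    have h4 : 0 ≤ C * r ^ n := by positivity
    simp only [p]
    split_ifs
    · rw [h3]; nlinarith
    · rw [norm_smul, h3, norm_neg, Real.norm_of_nonneg h4]; nlinarith
  have hrad : 0 < p.radius := radius_pos_of_norm_le_geometric (by linarith) hnorm
  let q := p.rightInv (ContinuousLinearEquiv.refl ℝ ℝ) 0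
  have hq : 0 < q.radius := FormalMultilinearSeries.radius_rightInv_pos_of_radius_pos hrad
  obtain ⟨A, B, hA, hB, hAB⟩ := q.le_mul_pow_of_radius_pos hq
  let σ : ℕ → ℝ := fun n => q n (fun _ => 1)
  have hσ1 : σ 1 = 1 := by
    change (p.rightInv (ContinuousLinearEquiv.refl ℝ ℝ) 0) 1 (fun _ => 1) = 1
    rw [FormalMultilinearSeries.rightInv_coeff_one]
    rfl
  have hrec : ∀ n, 2 ≤ n → σ n = ∑ c ∈ {c : Composition n | 1 < c.length}.toFinset,
        C * r ^ c.length * ∏ j, σ (c.blocksFun j) := by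
    intro n hn
    have hq' : q n = -((ContinuousLinearEquiv.refl ℝ ℝ).symm :
        ℝ →L[ℝ] ℝ).compContinuousMultilinearMap
          (∑ c ∈ ({c | 1 < Composition.length c}.toFinset : Finset (Composition n)),
            p.compAlongComposition q c) := FormalMultilinearSeries.rightInv_coeff _ _ _ _ hn
    change q n (fun _ => 1) = _
    rw [hq']
    change -((∑ c ∈ ({c | 1 < Composition.length c}.toFinset : Finset (Composition n)),
            p.compAlongComposition q c) (fun _ => (1 : ℝ))) = _
    rw [sum_apply, ← Finset.sum_neg_distrib]
    refine Finset.sum_congr rfl fun c hc => ?_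
    have hc' : c.length ≠ 1 := by
      have : 1 < c.length := by simpa using hc
      omega
    have hp : p c.length = -(C * r ^ c.length) • ContinuousMultilinearMap.mkPiAlgebraFin ℝ _ ℝ :=
      if_neg hc'
    rw [FormalMultilinearSeries.compAlongComposition_apply, hp, smul_apply,
      ContinuousMultilinearMap.mkPiAlgebraFin_apply, List.prod_ofFn, smul_eq_mul, neg_mul, neg_neg]
    rfl
  have hpos : ∀ n, 0 ≤ σ n := by
    intro n
    induction n using Nat.strong_induction_on with
    | _ n ih =>
      match n, ih with
      | 0, _ =>
        change 0 ≤ (p.rightInv (ContinuousLinearEquiv.refl ℝ ℝ) 0) 0 (fun _ => 1)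
        rw [FormalMultilinearSeries.rightInv_coeff_zero]
        exact le_rfl
      | 1, _ => rw [hσ1]; exact zero_le_one
      | n + 2, ih =>
        rw [hrec _ (by omega)]
        refine Finset.sum_nonneg fun c hc => ?_
        have hc' : 1 < c.length := by simpa using hc
        refine mul_nonneg (by positivity) (Finset.prod_nonneg fun j _ => ih _ ?_)
        have : c ≠ Composition.single (n + 2) (by omega) := by
          rw [Ne, Composition.eq_single_iff_length]; omega
        exact (Composition.ne_single_iff _).1 this j
  refine ⟨σ, hpos, hσ1, hrec, A, B, hA, hB, fun n => ?_⟩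
  calc σ n ≤ ‖σ n‖ := le_abs_self _
    _ ≤ ‖q n‖ * ∏ _i : Fin n, ‖(1 : ℝ)‖ := (q n).le_opNorm _
    _ ≤ A * B ^ n := by simpa using hAB n

variable {𝕜 : Type*} [NontriviallyNormedField 𝕜] {E : Type*} [NormedAddCommGroup E]
  [NormedSpace 𝕜 E]

/-- The formal power series `p = id + ∑ p_d` determined by `p_d = T_d ((Q ∘ p)_d)` for `d ≥ 2`,
when `Q` starts at order two. -/
noncomputable def fixedSeries
    (T : ∀ d, ContinuousMultilinearMap 𝕜 (fun _ : Fin d => E) E →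
      ContinuousMultilinearMap 𝕜 (fun _ : Fin d => E) E)
    (Q : FormalMultilinearSeries 𝕜 E E) : FormalMultilinearSeries 𝕜 E E
  | 0 => 0
  | 1 => (continuousMultilinearCurryFin1 𝕜 E E).symm (ContinuousLinearMap.id 𝕜 E)
  | n + 2 =>
    -- The truncation makes the recursion well founded. It changes nothing when `Q 1 = 0`, because a
    -- composition with at least two blocks has only smaller blocks.
    let q : FormalMultilinearSeries 𝕜 E E := fun k => if k < n + 2 then fixedSeries T Q k else 0
    T (n + 2) (Q.comp q (n + 2))

/-- The one-block composition contributes `Q 1 (p n v)`, the only term in which `p n` itself occurs.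
Once it is gone, order `n` is explicit in the lower orders. -/
theorem comp_apply_of_coeff_one_eq_zero {n : ℕ} (hn : 0 < n) {Q : FormalMultilinearSeries 𝕜 E E}
    (hQ : Q 1 = 0) (p : FormalMultilinearSeries 𝕜 E E) (v : Fin n → E) :
    Q.comp p n v = ∑ c ∈ {c : Composition n | 1 < c.length}.toFinset,
      Q c.length (p.applyComposition c v) := by
  rw [FormalMultilinearSeries.comp_rightInv_aux1 hn, hQ]; simp

theorem blocksFun_lt_of_one_lt_length {n : ℕ} {c : Composition n} (hc : 1 < c.length)
    (j : Fin c.length) : c.blocksFun j < n := by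
  have hn : 0 < n := by
    rcases Nat.eq_zero_or_pos n with rfl | h
    · have := c.length_le; omega
    · exact h
  have : c ≠ Composition.single n hn := by
    rw [Ne, Composition.eq_single_iff_length]; omega
  exact (Composition.ne_single_iff _).1 this j

theorem fixedSeries_zero (T) (Q : FormalMultilinearSeries 𝕜 E E) : fixedSeries T Q 0 = 0 := by
  rw [fixedSeries]

theorem fixedSeries_one (T) (Q : FormalMultilinearSeries 𝕜 E E) : fixedSeries T Q 1 =
    (continuousMultilinearCurryFin1 𝕜 E E).symm (ContinuousLinearMap.id 𝕜 E) := by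
  rw [fixedSeries]

theorem fixedSeries_of_two_le (T) {Q : FormalMultilinearSeries 𝕜 E E} (hQ : Q 1 = 0) {n : ℕ}
    (hn : 2 ≤ n) : fixedSeries T Q n = T n (Q.comp (fixedSeries T Q) n) := by
  match n, hn with
  | n + 2, _ =>
    rw [fixedSeries]
    congr 1
    ext v
    refine (comp_apply_of_coeff_one_eq_zero (by omega) hQ _ v).trans
      (Eq.trans ?_ (comp_apply_of_coeff_one_eq_zero (by omega) hQ _ v).symm)
    refine Finset.sum_congr rfl fun c hc => ?_
    have hc' : 1 < c.length := by simpa using hc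
    congr 1
    funext j
    simp [FormalMultilinearSeries.applyComposition, blocksFun_lt_of_one_lt_length hc']

end RecursiveSeries

/-! ### Trees of substitutions and Brjuno's counting lemma. -/

section Trees

variable {ι : Type*} [Fintype ι]

/-- Total degree of a multi-index. -/
def multiDegree (k : ι → ℕ) : ℕ := ∑ i, k i

/-- Degree of a multi-index weighted by `d`. -/
def weightedDegree (d : ι → ℕ) (k : ι → ℕ) : ℕ := ∑ i, d i * k i

theorem multiDegree_add (k l : ι → ℕ) : multiDegree (k + l) = multiDegree k + multiDegree l := by
  simp [multiDegree, Finset.sum_add_distrib]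

theorem weightedDegree_add (d : ι → ℕ) (k l : ι → ℕ) :
    weightedDegree d (k + l) = weightedDegree d k + weightedDegree d l := by
  simp [weightedDegree, Finset.sum_add_distrib, mul_add]

theorem multiDegree_sum {α : Type*} (s : Finset α) (k : α → ι → ℕ) :
    multiDegree (∑ a ∈ s, k a) = ∑ a ∈ s, multiDegree (k a) := by
  simp only [multiDegree, Finset.sum_apply]
  exact Finset.sum_comm

theorem weightedDegree_sum (d : ι → ℕ) {α : Type*} (s : Finset α) (k : α → ι → ℕ) :
    weightedDegree d (∑ a ∈ s, k a) = ∑ a ∈ s, weightedDegree d (k a) := by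
  simp only [weightedDegree, Finset.sum_apply, Finset.mul_sum]
  exact Finset.sum_comm

variable [DecidableEq ι]

/-- `DivisorTree d k i S`: the multiset `S` of (multi-index, component) pairs labels the inner
vertices of a tree of substitutions producing the monomial `k` in the component `i`. -/
inductive DivisorTree (d : ι → ℕ) : (ι → ℕ) → ι → Multiset ((ι → ℕ) × ι) → Prop
  | leaf (i : ι) : DivisorTree d (Pi.single i 1) i 0
  | node {ν : ℕ} (hν : 2 ≤ ν) (k : Fin ν → ι → ℕ) (j : Fin ν → ι)
      (S : Fin ν → Multiset ((ι → ℕ) × ι)) (i : ι)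
      -- The condition `hd` is the one met by a monomial of the perturbation, with letters `j a`, in
      -- the component `i`: its weight exceeds that of the component.
      (h : ∀ a, DivisorTree d (k a) (j a) (S a)) (hd : d i + 1 ≤ ∑ a, d (j a)) :
      DivisorTree d (∑ a, k a) i ((∑ a, k a, i) ::ₘ ∑ a, S a)

namespace DivisorTree

variable {d : ι → ℕ}

theorem le_weightedDegree {k i S} (h : DivisorTree d k i S) : d i ≤ weightedDegree d k := by
  induction h with
  | leaf i => simp [weightedDegree, Pi.single_apply]
  | node hν k j S i h hd ih =>
    rw [weightedDegree_sum]
    have := Finset.sum_le_sum fun a (_ : a ∈ Finset.univ) => ih a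
    omega

/-- Every inner vertex has at least two children, so there are fewer inner vertices than leaves, and
the degree of `k` counts the leaves. -/
theorem card_add_one_le {k i S} (h : DivisorTree d k i S) :
    S.card + 1 ≤ multiDegree k := by
  induction h with
  | leaf i => simp [multiDegree]
  | @node ν hν k j S i h hd ih =>
    rw [multiDegree_sum]
    have := Finset.sum_le_sum fun a (_ : a ∈ Finset.univ) => ih a
    simp only [Finset.sum_add_distrib, Finset.sum_const, Finset.card_univ, Fintype.card_fin,
      smul_eq_mul, mul_one] at this
    simp only [Multiset.card_cons, Multiset.card_sum]
    omega

/-- Each vertex has a pair to which the non-resonance hypothesis applies, so the divisors along a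
tree do not vanish. The weight of a subtree is at least that of its component, hence the strict
inequality at a node passes to the full multi-index. -/
theorem two_le_of_mem {k i S} (h : DivisorTree d k i S) :
    ∀ q ∈ S, 2 ≤ multiDegree q.1 ∧ d q.2 + 1 ≤ weightedDegree d q.1 := by
  induction h with
  | leaf i => simp
  | @node ν hν k j S i h hd ih =>
    intro q hq
    rw [Multiset.mem_cons, Multiset.mem_sum] at hq
    rcases hq with rfl | ⟨a, _, ha⟩
    · constructor
      · rw [multiDegree_sum]
        have := Finset.sum_le_sum fun a (_ : a ∈ Finset.univ) =>
          (Nat.le_add_left 1 _).trans (h a).card_add_one_le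
        simp only [Finset.sum_const, Finset.card_univ, Fintype.card_fin,
          smul_eq_mul, mul_one] at this
        omega
      · rw [weightedDegree_sum]
        have := Finset.sum_le_sum fun a (_ : a ∈ Finset.univ) => (h a).le_weightedDegree
        simp only
        omega
    · exact ih a q ha

/-- Brjuno's counting lemma, in inductive form. -/
theorem count_trichotomy {k i S} (h : DivisorTree d k i S) (sm : (ι → ℕ) × ι → Prop)
    [DecidablePred sm] (m : ℕ) (hsize : ∀ k i, sm (k, i) → m ≤ multiDegree k)
    (hgap : ∀ l e i j, e ≠ 0 → sm (l + e, i) → sm (l, j) →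
      d i + 1 ≤ weightedDegree d e + d j → m ≤ multiDegree e) :
    S.countP sm = 0 ∨ m * (S.countP sm + 2) ≤ 2 * multiDegree k ∨
      ∃ l e j, k = l + e ∧ sm (l, j) ∧ m * (S.countP sm + 1) ≤ 2 * multiDegree l ∧
        d i ≤ weightedDegree d e + d j := by
  -- The alternatives carry different surpluses over the count. In the second it is two. In the
  -- third all small vertices lie at or below one small vertex `(l, j)`, the surplus is one, and `e`
  -- collects what has been grafted above that vertex; the next small vertex above it then regains
  -- the missing `m` through the gap hypothesis.
  induction h with
  | leaf i => simp
  | @node ν hν k j S i h hd ih =>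
    set N : Fin ν → ℕ := fun a => (S a).countP sm with hN
    have hcount : (((∑ a, k a, i) ::ₘ ∑ a, S a) : Multiset _).countP sm
        = (∑ a, N a) + if sm (∑ a, k a, i) then 1 else 0 := by
      rw [Multiset.countP_cons, ← Multiset.coe_countPAddMonoidHom, map_sum]
      rfl
    rw [hcount]
    have hone : ∀ a, 1 ≤ multiDegree (k a) := fun a =>
      (Nat.le_add_left 1 _).trans (h a).card_add_one_le
    have hbd : ∀ a, N a ≠ 0 → m * (N a + 1) ≤ 2 * multiDegree (k a) := by
      intro a ha
      rcases ih a with h0 | h1 | ⟨l, e, j', hk, _, hl, _⟩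
      · exact absurd h0 ha
      · refine le_trans ?_ h1
        gcongr
        omega
      · have hl' : m * (N a + 1) ≤ 2 * multiDegree l := hl
        rw [hk, multiDegree_add]
        omega
    have htop : sm (∑ a, k a, i) → m * ((∑ a, N a) + 1 + 1) ≤ 2 * multiDegree (∑ a, k a) →
        ∃ l e j, ∑ a, k a = l + e ∧ sm (l, j) ∧ m * ((∑ a, N a) + 1 + 1) ≤ 2 * multiDegree l ∧
        d i ≤ weightedDegree d e + d j := fun hs hle =>
      ⟨_, 0, i, (add_zero _).symm, hs, hle, by simp⟩
    by_cases hall : ∀ a, N a = 0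
    · have h0 : ∑ a, N a = 0 := Finset.sum_eq_zero fun a _ => hall a
      by_cases hs : sm (∑ a, k a, i)
      · simp only [if_pos hs]
        refine Or.inr (Or.inr (htop hs ?_))
        have := hsize _ _ hs
        rw [h0]; omega
      · simp [h0, hs]
    push Not at hall
    obtain ⟨a, ha⟩ := hall
    have hdeg : multiDegree (∑ a, k a) = multiDegree (k a) +
        ∑ b ∈ Finset.univ.erase a, multiDegree (k b) := by
      rw [multiDegree_sum, Finset.add_sum_erase _ (fun b => multiDegree (k b)) (Finset.mem_univ a)]
    have hNsum : ∑ b, N b = N a + ∑ b ∈ Finset.univ.erase a, N b := by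
      rw [Finset.add_sum_erase _ _ (Finset.mem_univ a)]
    -- When two different subtrees contain small vertices, their surpluses of one add up to two.
    by_cases hother : ∃ b, b ≠ a ∧ N b ≠ 0
    · obtain ⟨b, hba, hb⟩ := hother
      have hb' : b ∈ Finset.univ.erase a := by simp [hba]
      have hle : m * ((∑ a, N a) + 2) ≤ 2 * multiDegree (∑ a, k a) := by
        rw [hdeg, hNsum, ← Finset.add_sum_erase _ _ hb',
          ← Finset.add_sum_erase _ (fun b => multiDegree (k b)) hb']
        have h1 := hbd a ha
        have h2 := hbd b hb
        have h3 : m * ∑ c ∈ (Finset.univ.erase a).erase b, N c ≤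
            2 * ∑ c ∈ (Finset.univ.erase a).erase b, multiDegree (k c) := by
          rw [Finset.mul_sum, Finset.mul_sum]
          refine Finset.sum_le_sum fun c _ => ?_
          by_cases hc : N c = 0
          · simp [hc]
          · refine le_trans ?_ (hbd c hc)
            gcongr
            omega
        nlinarith
      by_cases hs : sm (∑ a, k a, i)
      · simp only [if_pos hs]
        exact Or.inr (Or.inr (htop hs hle))
      · simp only [if_neg hs, add_zero]
        exact Or.inr (Or.inl hle)
    · push Not at hother
      have hN' : ∑ b, N b = N a := by
        rw [hNsum, Finset.sum_eq_zero, add_zero]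
        intro b hb
        exact hother b (Finset.ne_of_mem_erase hb)
      set e' : ι → ℕ := ∑ b ∈ Finset.univ.erase a, k b with he'
      have hk : ∑ b, k b = k a + e' := by
        rw [Finset.add_sum_erase _ _ (Finset.mem_univ a)]
      have hmd' : multiDegree e' ≠ 0 := by
        have : ∑ b ∈ Finset.univ.erase a, 1 ≤ multiDegree e' := by
          rw [he', multiDegree_sum]
          exact Finset.sum_le_sum fun b _ => hone b
        simp only [Finset.sum_const, smul_eq_mul, mul_one, Finset.card_erase_of_mem
          (Finset.mem_univ a), Finset.card_univ, Fintype.card_fin] at this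
        omega
      have hwd : d i + 1 ≤ weightedDegree d e' + d (j a) := by
        have : ∑ b ∈ Finset.univ.erase a, d (j b) ≤ weightedDegree d e' := by
          rw [he', weightedDegree_sum]
          exact Finset.sum_le_sum fun b _ => (h b).le_weightedDegree
        rw [← Finset.add_sum_erase _ _ (Finset.mem_univ a)] at hd
        omega
      rcases ih a with h0 | h1 | ⟨l, e, j', hka, hsl, hl, hdl⟩
      · exact absurd h0 ha
      · have hle : m * ((∑ a, N a) + 2) ≤ 2 * multiDegree (∑ a, k a) := by
          rw [hN', hdeg]
          exact h1.trans (by omega)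
        by_cases hs : sm (∑ a, k a, i)
        · simp only [if_pos hs]
          exact Or.inr (Or.inr (htop hs hle))
        · simp only [if_neg hs, add_zero]
          exact Or.inr (Or.inl hle)
      -- Only one subtree contributes and it has a topmost small vertex `(l, j')`. The siblings
      -- enlarge `e`, and the weight inequality becomes strict on passing through this node, which
      -- is what `hgap` asks for.
      · have hke : ∑ b, k b = l + (e + e') := by rw [hk, hka, add_assoc]
        have hdi : d i + 1 ≤ weightedDegree d (e + e') + d j' := by
          rw [weightedDegree_add]; omega
        by_cases hs : sm (∑ a, k a, i)
        · simp only [if_pos hs]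
          refine Or.inr (Or.inr (htop hs ?_))
          have hgap' := hgap l (e + e') i j' (by
            intro h0
            apply hmd'
            have : multiDegree (e + e') = 0 := by rw [h0]; simp [multiDegree]
            rw [multiDegree_add] at this
            omega) (hke ▸ hs) hsl hdi
          rw [hke, multiDegree_add, hN']
          have : m * (N a + 1) ≤ 2 * multiDegree l := hl
          nlinarith
        · simp only [if_neg hs, add_zero]
          refine Or.inr (Or.inr ⟨l, e + e', j', hke, hsl, ?_, by omega⟩)
          rw [hN']
          exact hl

/-- Brjuno's counting lemma. -/
theorem count_mul_le {k i S} (h : DivisorTree d k i S) (sm : (ι → ℕ) × ι → Prop)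
    [DecidablePred sm] (m : ℕ) (hsize : ∀ k i, sm (k, i) → m ≤ multiDegree k)
    (hgap : ∀ l e i j, e ≠ 0 → sm (l + e, i) → sm (l, j) →
      d i + 1 ≤ weightedDegree d e + d j → m ≤ multiDegree e) :
    m * S.countP sm ≤ 2 * multiDegree k := by
  rcases h.count_trichotomy sm m hsize hgap with h0 | h1 | ⟨l, e, j', hk, _, hl, _⟩
  · simp [h0]
  · refine le_trans ?_ h1
    gcongr
    omega
  · rw [hk, multiDegree_add]
    have : m * S.countP sm ≤ m * (S.countP sm + 1) := by gcongr; omega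
    omega

end DivisorTree

end Trees

/-! ### Brjuno's estimate for products of divisors along trees. -/

section SmallDivisors

variable {n : ℕ}

theorem reducedOmega_set_finite (lam : Fin n → ℂ) (m : ℕ) :
    {x : ℝ | ∃ (k : Fin n → ℕ) (j : Fin n), 2 ≤ ∑ i, k i ∧ ∑ i, k i ≤ m ∧
      eigMonomial lam k ≠ lam j ∧ x = ‖eigMonomial lam k - lam j‖}.Finite := by
  have hfin : (Set.Iic (fun _ : Fin n => m)).Finite := Set.finite_Iic _
  refine ((hfin.prod (Set.finite_univ (α := Fin n))).image
    fun q => ‖eigMonomial lam q.1 - lam q.2‖).subset ?_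
  rintro x ⟨k, j, _, hk, _, rfl⟩
  refine ⟨(k, j), ⟨fun i => ?_, Set.mem_univ _⟩, rfl⟩
  exact (Finset.single_le_sum (fun i _ => Nat.zero_le (k i)) (Finset.mem_univ i)).trans hk

theorem reducedOmega_le {lam : Fin n → ℂ} {m : ℕ} {k : Fin n → ℕ} {j : Fin n}
    (h2 : 2 ≤ multiDegree k) (hm : multiDegree k ≤ m) (h : eigMonomial lam k ≠ lam j) :
    reducedOmega lam m ≤ ‖eigMonomial lam k - lam j‖ := by
  refine csInf_le ⟨0, ?_⟩ ⟨k, j, h2, hm, h, rfl⟩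
  rintro x ⟨k, j, _, _, _, rfl⟩
  exact norm_nonneg _

/-- There is a non-resonant pair of degree two. -/
def HasNonresonantSquare (lam : Fin n → ℂ) : Prop :=
  ∃ (k : Fin n → ℕ) (j : Fin n), multiDegree k = 2 ∧ eigMonomial lam k ≠ lam j

/-- The non-resonant pair of degree two makes the set of divisors nonempty, so the infimum is
attained at a nonzero divisor. On an empty set `sInf` would return `0`. -/
theorem reducedOmega_pos {lam : Fin n → ℂ} (h : HasNonresonantSquare lam) {m : ℕ} (hm : 2 ≤ m) :
    0 < reducedOmega lam m := by
  obtain ⟨k, j, hk, hkj⟩ := h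
  have hne : {x : ℝ | ∃ (k : Fin n → ℕ) (j : Fin n), 2 ≤ ∑ i, k i ∧ ∑ i, k i ≤ m ∧
      eigMonomial lam k ≠ lam j ∧ x = ‖eigMonomial lam k - lam j‖}.Nonempty :=
    ⟨_, k, j, hk.ge, hk.le.trans hm, hkj, rfl⟩
  obtain ⟨k, j, _, _, hkj, hx⟩ := hne.csInf_mem (reducedOmega_set_finite lam m)
  rw [reducedOmega, hx]
  exact norm_pos_iff.2 (sub_ne_zero.2 hkj)

theorem reducedOmega_anti {lam : Fin n → ℂ} (h : HasNonresonantSquare lam) {m m' : ℕ}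
    (hm : 2 ≤ m) (hmm : m ≤ m') : reducedOmega lam m' ≤ reducedOmega lam m := by
  obtain ⟨k, j, hk, hkj⟩ := h
  refine csInf_le_csInf ⟨0, ?_⟩ ⟨_, k, j, hk.ge, hk.le.trans hm, hkj, rfl⟩ ?_
  · rintro x ⟨k, j, _, _, _, rfl⟩
    exact norm_nonneg _
  · rintro x ⟨k, j, h2, hk, h⟩
    exact ⟨k, j, h2, hk.trans hmm, h⟩

theorem eigMonomial_add (lam : Fin n → ℂ) (k l : Fin n → ℕ) :
    eigMonomial lam (k + l) = eigMonomial lam k * eigMonomial lam l := by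
  simp [eigMonomial, pow_add, Finset.prod_mul_distrib]

theorem eigMonomial_single (lam : Fin n → ℂ) (i : Fin n) :
    eigMonomial lam (Pi.single i 1) = lam i := by
  rw [eigMonomial, Finset.prod_eq_single i]
  · simp
  · intro j _ hj; simp [hj]
  · simp

/-- The pairs `(k, i)` whose divisor is smaller than `θ ω(m)`. -/
def IsSmallDivisor (lam : Fin n → ℂ) (d : Fin n → ℕ) (θ : ℝ) (m : ℕ)
    (q : (Fin n → ℕ) × Fin n) : Prop :=
  2 ≤ multiDegree q.1 ∧ d q.2 + 1 ≤ weightedDegree d q.1 ∧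
    ‖eigMonomial lam q.1 - lam q.2‖ < θ * reducedOmega lam m

/-- Two nested small divisors have multi-indices far apart. -/
theorem exists_gap_constant {lam : Fin n → ℂ} (hlam : ∀ i, lam i ≠ 0) {d : Fin n → ℕ}
    (hnr : HasNonresonantSquare lam)
    (hres : ∀ k j, 2 ≤ multiDegree k → d j + 1 ≤ weightedDegree d k →
      eigMonomial lam k ≠ lam j) :
    ∃ θ : ℝ, 0 < θ ∧ θ ≤ 1 ∧ ∀ m, 2 ≤ m → ∀ l e i j, e ≠ 0 →
      IsSmallDivisor lam d θ m (l + e, i) → IsSmallDivisor lam d θ m (l, j) →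
      d i + 1 ≤ weightedDegree d e + d j → m ≤ multiDegree e := by
  have hW := reducedOmega_pos hnr le_rfl
  set W := reducedOmega lam 2 with hWdef
  obtain ⟨c, hc, hclam⟩ : ∃ c : ℝ, 0 < c ∧ ∀ i, c ≤ ‖lam i‖ := by
    obtain ⟨k, j, _, _⟩ := hnr
    have : Nonempty (Fin n) := ⟨j⟩
    obtain ⟨i0, hi0⟩ := Finite.exists_min fun i => ‖lam i‖
    exact ⟨‖lam i0‖, norm_pos_iff.2 (hlam i0), hi0⟩
  obtain ⟨D, hD, hDlam⟩ : ∃ D : ℝ, 0 < D ∧ ∀ i, ‖lam i‖ ≤ D := by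
    refine ⟨∑ i, ‖lam i‖ + 1, by positivity, fun i => ?_⟩
    have := Finset.single_le_sum (fun i _ => norm_nonneg (lam i)) (Finset.mem_univ i)
    linarith
  -- `K` bounds `|λ^e|`: if both divisors are below `c / 2`, then `|λ^l| ≥ c / 2` and `|λ^(l+e)| ≤ D
  -- + c`. The first entry of `θ` forces these bounds, the second gives `θ (1 + K) ≤ 1` for the
  -- final contradiction.
  set K : ℝ := (D + c) / (c / 2) with hK
  have hKpos : 0 < K := by positivity
  set θ : ℝ := min (c / (2 * W)) (1 / (1 + K)) with hθ
  have hθpos : 0 < θ := by positivity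
  have hθW : θ * W ≤ c / 2 := by
    have : θ ≤ c / (2 * W) := min_le_left _ _
    calc θ * W ≤ c / (2 * W) * W := by gcongr
      _ = c / 2 := by field_simp
  have hθK : θ * (1 + K) ≤ 1 := by
    have : θ ≤ 1 / (1 + K) := min_le_right _ _
    calc θ * (1 + K) ≤ 1 / (1 + K) * (1 + K) := by gcongr
      _ = 1 := by field_simp
  refine ⟨θ, hθpos, by nlinarith, fun m hm l e i j he h1 h2 hde => ?_⟩
  by_contra hlt
  push Not at hlt
  obtain ⟨_, _, h1⟩ := h1
  obtain ⟨_, _, h2⟩ := h2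
  simp only at h1 h2
  have hωm : 0 < reducedOmega lam m := reducedOmega_pos hnr hm
  have hωW : reducedOmega lam m ≤ W := reducedOmega_anti hnr le_rfl hm
  have hθω : θ * reducedOmega lam m ≤ c / 2 := le_trans (by gcongr) hθW
  have hepos : 1 ≤ multiDegree e := by
    by_contra h0
    apply he
    funext a
    have : multiDegree e = 0 := by omega
    simpa using (Finset.sum_eq_zero_iff.1 this) a (Finset.mem_univ a)
  have hl : c / 2 ≤ ‖eigMonomial lam l‖ := by
    have := norm_sub_norm_le (lam j) (eigMonomial lam l)
    rw [norm_sub_rev] at this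
    linarith [hclam j]
  have hle : ‖eigMonomial lam l‖ * ‖eigMonomial lam e‖ ≤ D + c := by
    rw [← norm_mul, ← eigMonomial_add]
    have := norm_sub_norm_le (eigMonomial lam (l + e)) (lam i)
    linarith [hDlam i]
  have heK : ‖eigMonomial lam e‖ ≤ K := by
    rw [hK, le_div_iff₀ (by positivity)]
    nlinarith [norm_nonneg (eigMonomial lam e)]
  have hdeg : multiDegree (e + Pi.single j 1) = multiDegree e + 1 := by
    rw [multiDegree_add]; simp [multiDegree]
  have hwdeg : weightedDegree d (e + Pi.single j 1) = weightedDegree d e + d j := by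
    rw [weightedDegree_add]; simp [weightedDegree, Pi.single_apply]
  have hge := reducedOmega_le (lam := lam) (m := m) (k := e + Pi.single j 1) (j := i)
    (by omega) (by omega) (hres _ _ (by omega) (by omega))
  -- If `|e| < m`, the multi-index `e + e_j` has degree at most `m` and is non-resonant for `i` by
  -- its weight, so its divisor is at least `ω(m)`. This identity writes that divisor through the
  -- two small ones and makes it smaller than `ω(m)`.
  have hid : eigMonomial lam (e + Pi.single j 1) - lam i =
      (eigMonomial lam (l + e) - lam i) - eigMonomial lam e * (eigMonomial lam l - lam j) := by
    rw [eigMonomial_add, eigMonomial_add, eigMonomial_single]; ring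
  have hlt2 : ‖eigMonomial lam (e + Pi.single j 1) - lam i‖ < reducedOmega lam m := by
    rw [hid]
    calc _ ≤ ‖eigMonomial lam (l + e) - lam i‖ +
          ‖eigMonomial lam e * (eigMonomial lam l - lam j)‖ := norm_sub_le _ _
      _ ≤ ‖eigMonomial lam (l + e) - lam i‖ + K * (θ * reducedOmega lam m) := by
          rw [norm_mul]; gcongr
      _ < θ * reducedOmega lam m + K * (θ * reducedOmega lam m) := by gcongr
      _ = θ * (1 + K) * reducedOmega lam m := by ring
      _ ≤ 1 * reducedOmega lam m := by gcongr
      _ = _ := one_mul _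
  linarith

/-- In a tree, small divisors occur with frequency at most `2 / m`. -/
theorem DivisorTree.count_small_le {lam : Fin n → ℂ} {d : Fin n → ℕ}
    (hres : ∀ k j, 2 ≤ multiDegree k → d j + 1 ≤ weightedDegree d k →
      eigMonomial lam k ≠ lam j) {θ : ℝ} (hθ1 : θ ≤ 1) {m : ℕ}
    (hω : 0 < reducedOmega lam m)
    (hgap : ∀ l e i j, e ≠ 0 →
      IsSmallDivisor lam d θ m (l + e, i) → IsSmallDivisor lam d θ m (l, j) →
      d i + 1 ≤ weightedDegree d e + d j → m ≤ multiDegree e)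
    [DecidablePred (IsSmallDivisor lam d θ m)] {k i S} (h : DivisorTree d k i S) :
    m * S.countP (IsSmallDivisor lam d θ m) ≤ 2 * multiDegree k := by
  refine h.count_mul_le _ m (fun k i hk => ?_) hgap
  obtain ⟨h2, hd, hlt⟩ := hk
  by_contra hm
  have := reducedOmega_le (lam := lam) (m := m) (j := i) h2 (by simp only; omega) (hres _ _ h2 hd)
  simp only at this hlt
  nlinarith

theorem multiset_sum_weights {α : Type*} (S : Multiset α) (g0 : ℝ) (V : Finset ℕ) (g : ℕ → ℝ)
    (P : ℕ → α → Prop) [∀ ν, DecidablePred (P ν)] :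
    (S.map fun q => g0 + ∑ ν ∈ V, if P ν q then g ν else 0).sum =
      S.card * g0 + ∑ ν ∈ V, S.countP (P ν) * g ν := by
  induction S using Multiset.induction with
  | empty => simp
  | cons a S ih =>
    rw [Multiset.map_cons, Multiset.sum_cons, ih, Multiset.card_cons]
    have : ∑ ν ∈ V, (((a ::ₘ S).countP (P ν) : ℕ) : ℝ) * g ν =
        (∑ ν ∈ V, if P ν a then g ν else 0) + ∑ ν ∈ V, S.countP (P ν) * g ν := by
      rw [← Finset.sum_add_distrib]
      refine Finset.sum_congr rfl fun ν _ => ?_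
      rw [Multiset.countP_cons]
      split_ifs <;> push_cast <;> ring
    rw [this]
    push_cast
    ring

theorem multiset_prod_le_exp {α : Type*} (S : Multiset α) (f h : α → ℝ)
    (hf : ∀ q ∈ S, 0 ≤ f q ∧ f q ≤ Real.exp (h q)) :
    (S.map f).prod ≤ Real.exp (S.map h).sum := by
  induction S using Multiset.induction with
  | empty => simp
  | cons a S ih =>
    rw [Multiset.map_cons, Multiset.prod_cons, Multiset.map_cons, Multiset.sum_cons, Real.exp_add]
    have h1 := hf a (Multiset.mem_cons_self a S)
    have h2 := ih fun q hq => hf q (Multiset.mem_cons_of_mem hq)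
    have h3 : 0 ≤ (S.map f).prod := Multiset.prod_nonneg fun x hx => by
      obtain ⟨q, hq, rfl⟩ := Multiset.mem_map.1 hx
      exact (hf q (Multiset.mem_cons_of_mem hq)).1
    exact mul_le_mul h1.2 h2 h3 (Real.exp_pos _).le

/-- The factor `θ` in the definition of a small divisor adds a multiple of `∑ 1 / p ν` to the Brjuno
sum. As soon as `ω` drops below `exp (-1)`, the logarithms are at least one and the Brjuno series
dominates `∑ 1 / p ν`. If it never drops, the divisors are bounded below and no counting is needed.
-/
theorem reducedBrjuno_dichotomy {lam : Fin n → ℂ} (hnr : HasNonresonantSquare lam)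
    {p : ℕ → ℕ} (hp : StrictMono p) (hp0 : p 0 = 1)
    (hsum : Summable fun ν : ℕ => (p ν : ℝ)⁻¹ * Real.log (reducedOmega lam (p (ν + 1)))⁻¹) :
    (∃ c : ℝ, 0 < c ∧ ∀ m, 2 ≤ m → c ≤ reducedOmega lam m) ∨
      Summable fun ν : ℕ => (p ν : ℝ)⁻¹ := by
  have hp2 : ∀ ν, 2 ≤ p (ν + 1) := fun ν => by
    have := hp (Nat.succ_pos ν); rw [hp0] at this; exact this
  by_cases hc : ∀ m, 2 ≤ m → Real.exp (-1) ≤ reducedOmega lam m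
  · exact Or.inl ⟨_, Real.exp_pos _, hc⟩
  push Not at hc
  obtain ⟨m, hm, hlt⟩ := hc
  refine Or.inr ?_
  rw [← summable_nat_add_iff m]
  refine Summable.of_nonneg_of_le (fun ν => by positivity) (fun ν => ?_)
    ((summable_nat_add_iff m).2 hsum)
  have hmp : m ≤ p (ν + m + 1) := le_trans (by simp only [id]; omega) (hp.id_le (ν + m + 1))
  have hω := reducedOmega_anti hnr hm hmp
  have hωpos := reducedOmega_pos hnr (hp2 (ν + m))
  have h1 : 1 ≤ Real.log (reducedOmega lam (p (ν + m + 1)))⁻¹ := by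
    rw [Real.log_inv]
    have := Real.log_le_log hωpos (hω.trans hlt.le)
    rw [Real.log_exp] at this
    linarith
  exact le_mul_of_one_le_right (by positivity) h1

theorem reducedOmega_le_of_mem_tree {lam : Fin n → ℂ} {d : Fin n → ℕ}
    (hres : ∀ k j, 2 ≤ multiDegree k → d j + 1 ≤ weightedDegree d k →
      eigMonomial lam k ≠ lam j) {k i S} (h : DivisorTree d k i S) {q} (hq : q ∈ S) :
    reducedOmega lam (multiDegree q.1) ≤ ‖eigMonomial lam q.1 - lam q.2‖ :=
  reducedOmega_le (h.two_le_of_mem q hq).1 le_rfl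
    (hres _ _ (h.two_le_of_mem q hq).1 (h.two_le_of_mem q hq).2)

/-- Brjuno's estimate: the products of divisors along trees grow at most geometrically. -/
theorem DivisorTree.exists_prod_inv_le {lam : Fin n → ℂ} (hlam : ∀ i, lam i ≠ 0) {d : Fin n → ℕ}
    (hnr : HasNonresonantSquare lam)
    (hres : ∀ k j, 2 ≤ multiDegree k → d j + 1 ≤ weightedDegree d k →
      eigMonomial lam k ≠ lam j) (hB : ReducedBrjuno lam) :
    ∃ C : ℝ, 1 ≤ C ∧ ∀ k i S, DivisorTree d k i S →
      (S.map fun q => ‖eigMonomial lam q.1 - lam q.2‖⁻¹).prod ≤ C ^ multiDegree k := by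
  classical
  obtain ⟨p, hp, hp0, hsum⟩ := hB
  have hp2 : ∀ ν, 2 ≤ p (ν + 1) := fun ν => by
    have := hp (Nat.succ_pos ν); rw [hp0] at this; exact this
  have hppos : ∀ ν, 0 < p ν := fun ν => by
    rcases ν with _ | ν
    · omega
    · have := hp2 ν; omega
  rcases reducedBrjuno_dichotomy hnr hp hp0 hsum with ⟨c, hc, hcω⟩ | hsum'
  · refine ⟨max 1 c⁻¹, le_max_left _ _, fun k i S h => ?_⟩
    calc (S.map fun q => ‖eigMonomial lam q.1 - lam q.2‖⁻¹).prod
        ≤ Real.exp (S.map fun _ => Real.log (max 1 c⁻¹)).sum := by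
          refine multiset_prod_le_exp _ _ _ fun q hq => ⟨by positivity, ?_⟩
          rw [Real.exp_log (by positivity)]
          refine le_trans ?_ (le_max_right _ _)
          gcongr
          exact (hcω _ (h.two_le_of_mem q hq).1).trans (reducedOmega_le_of_mem_tree hres h hq)
      _ = (max 1 c⁻¹) ^ S.card := by
          rw [Multiset.map_const', Multiset.sum_replicate, nsmul_eq_mul, mul_comm, Real.exp_mul,
            Real.exp_log (by positivity), Real.rpow_natCast]
      _ ≤ _ := pow_le_pow_right₀ (le_max_left _ _) (by have := h.card_add_one_le; omega)
  obtain ⟨θ, hθ, hθ1, hgap⟩ := exists_gap_constant hlam hnr hres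
  have hω : ∀ ν, 0 < reducedOmega lam (p (ν + 1)) := fun ν => reducedOmega_pos hnr (hp2 ν)
  -- `g ν` bounds the logarithm of an inverse divisor that is not small at scale `p (ν + 1)`. The
  -- absolute value is there because `ω` may exceed one.
  set g : ℕ → ℝ := fun ν => |Real.log (reducedOmega lam (p (ν + 1)))⁻¹| + Real.log θ⁻¹ with hg
  have hlogθ : 0 ≤ Real.log θ⁻¹ := Real.log_nonneg ((one_le_inv₀ hθ).2 hθ1)
  have hgnn : ∀ ν, 0 ≤ g ν := fun ν => by positivity
  have hgle : ∀ ν, (θ * reducedOmega lam (p (ν + 1)))⁻¹ ≤ Real.exp (g ν) := by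
    intro ν
    have h1 := hω ν
    rw [← Real.log_le_iff_le_exp (by positivity), mul_inv,
      Real.log_mul (by positivity) (by positivity)]
    simp only [hg]
    linarith [le_abs_self (Real.log (reducedOmega lam (p (ν + 1)))⁻¹)]
  have hgsum : Summable fun ν => (p ν : ℝ)⁻¹ * g ν := by
    have h1 := hsum.abs
    have h2 := hsum'.mul_right (Real.log θ⁻¹)
    refine (h1.add h2).congr fun ν => ?_
    simp only [hg]
    rw [abs_mul, abs_of_nonneg (by positivity : (0 : ℝ) ≤ (p ν : ℝ)⁻¹)]
    ring
  set G := ∑' ν, (p ν : ℝ)⁻¹ * g ν with hG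
  have hGnn : 0 ≤ G := tsum_nonneg fun ν => mul_nonneg (by positivity) (hgnn ν)
  -- Each of the fewer than `|k|` vertices pays `g 0`, and at scale `ν ≥ 1` at most `2 |k| / p ν`
  -- vertices pay `g ν`.
  refine ⟨Real.exp (g 0 + 2 * G), Real.one_le_exp (by linarith [hgnn 0]), fun k i S h => ?_⟩
  set P : ℕ → (Fin n → ℕ) × Fin n → Prop := fun ν => IsSmallDivisor lam d θ (p ν) with hP
  set V : Finset ℕ := Finset.Ico 1 (multiDegree k + S.toFinset.sup (fun q => multiDegree q.1) + 1)
  have hpt : ∀ q ∈ S, 0 ≤ ‖eigMonomial lam q.1 - lam q.2‖⁻¹ ∧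
      ‖eigMonomial lam q.1 - lam q.2‖⁻¹ ≤
        Real.exp (g 0 + ∑ ν ∈ V, if P ν q then g ν else 0) := by
    intro q hq
    refine ⟨by positivity, ?_⟩
    obtain ⟨hq2, hqd⟩ := h.two_le_of_mem q hq
    have hdeg : ¬ P (multiDegree q.1 + 1) q := fun hs => by
      have h1 := hs.2.2
      have h2 : reducedOmega lam (p (multiDegree q.1 + 1)) ≤ reducedOmega lam (multiDegree q.1) :=
        reducedOmega_anti hnr hq2 (le_trans (Nat.le_succ _) (hp.id_le (multiDegree q.1 + 1)))
      have h3 := reducedOmega_le_of_mem_tree hres h hq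
      have h4 := hω (multiDegree q.1)
      nlinarith
    -- Take the first `ν` for which `q` is not small at scale `p (ν + 1)`. Its inverse divisor is at
    -- most `exp (g ν)`. If `ν ≥ 1`, minimality makes `q` small at scale `p ν`, so `g ν` is among
    -- the summands.
    have hnot : ∃ ν, ¬ P (ν + 1) q := ⟨_, hdeg⟩
    have hνle : Nat.find hnot ≤ multiDegree q.1 := Nat.find_min' hnot hdeg
    have hspec := Nat.find_spec hnot
    have hmin := fun m => Nat.find_min hnot (m := m)
    set ν := Nat.find hnot
    have hge : θ * reducedOmega lam (p (ν + 1)) ≤ ‖eigMonomial lam q.1 - lam q.2‖ := by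
      by_contra hlt
      exact hspec ⟨hq2, hqd, not_le.1 hlt⟩
    have hle : ‖eigMonomial lam q.1 - lam q.2‖⁻¹ ≤ Real.exp (g ν) := by
      refine le_trans ?_ (hgle ν)
      have := hω ν
      gcongr
    refine hle.trans (Real.exp_le_exp.2 ?_)
    have hterm : ∀ μ ∈ V, 0 ≤ if P μ q then g μ else 0 := fun μ _ => by
      split_ifs
      · exact hgnn μ
      · exact le_rfl
    rcases Nat.eq_zero_or_pos ν with h0 | hpos
    · rw [h0]
      linarith [Finset.sum_nonneg hterm]
    · have hPν : P ν q := by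
        have := hmin (ν - 1) (by omega)
        rw [not_not, Nat.sub_add_cancel hpos] at this
        exact this
      have hsup : multiDegree q.1 ≤ S.toFinset.sup (fun q => multiDegree q.1) :=
        Finset.le_sup (f := fun q : (Fin n → ℕ) × Fin n => multiDegree q.1)
          (Multiset.mem_toFinset.2 hq)
      have hνV : ν ∈ V := Finset.mem_Ico.2 ⟨hpos, by omega⟩
      have := Finset.single_le_sum hterm hνV
      rw [if_pos hPν] at this
      linarith [hgnn 0]
  refine (multiset_prod_le_exp S _ _ hpt).trans ?_
  rw [multiset_sum_weights, ← Real.exp_nat_mul]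
  refine Real.exp_le_exp.2 ?_
  have hcard : (S.card : ℝ) ≤ multiDegree k := by
    exact_mod_cast (Nat.le_succ _).trans h.card_add_one_le
  have hcount : ∀ ν ∈ V, (S.countP (P ν) : ℝ) * g ν ≤
      2 * multiDegree k * ((p ν : ℝ)⁻¹ * g ν) := by
    intro ν hν
    obtain ⟨hν1, _⟩ := Finset.mem_Ico.1 hν
    obtain ⟨μ, rfl⟩ := Nat.exists_eq_add_of_le' hν1
    have h1 : p (μ + 1) * S.countP (P (μ + 1)) ≤ 2 * multiDegree k :=
      h.count_small_le hres hθ1 (hω μ) (hgap _ (hp2 μ))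
    have h2 : (p (μ + 1) : ℝ) * S.countP (P (μ + 1)) ≤ 2 * multiDegree k := by exact_mod_cast h1
    have h3 : (0 : ℝ) < p (μ + 1) := by exact_mod_cast hppos _
    have h4 : (S.countP (P (μ + 1)) : ℝ) ≤ 2 * multiDegree k * (p (μ + 1) : ℝ)⁻¹ := by
      rw [← div_eq_mul_inv, le_div_iff₀ h3, mul_comm]
      exact h2
    calc _ ≤ 2 * multiDegree k * (p (μ + 1) : ℝ)⁻¹ * g (μ + 1) := by
          gcongr
      _ = _ := by ring
  have hsumle : ∑ ν ∈ V, (p ν : ℝ)⁻¹ * g ν ≤ G :=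
    hgsum.sum_le_tsum V fun ν _ => mul_nonneg (by positivity) (hgnn ν)
  calc (S.card : ℝ) * g 0 + ∑ ν ∈ V, (S.countP (P ν) : ℝ) * g ν
      ≤ multiDegree k * g 0 + ∑ ν ∈ V, 2 * multiDegree k * ((p ν : ℝ)⁻¹ * g ν) := by
        exact add_le_add (mul_le_mul_of_nonneg_right hcard (hgnn 0)) (Finset.sum_le_sum hcount)
    _ = multiDegree k * g 0 + 2 * multiDegree k * ∑ ν ∈ V, (p ν : ℝ)⁻¹ * g ν := by
        rw [Finset.mul_sum]
    _ ≤ multiDegree k * g 0 + 2 * multiDegree k * G := by gcongr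
    _ = _ := by ring

end SmallDivisors

/-! ### Coefficients of multilinear maps on words of basis vectors. -/

section WordCoefficients

variable {n : ℕ}

/-- The value of a multilinear map on the word `w` in the standard basis vectors. -/
noncomputable def wordCoeff {d : ℕ}
    (m : ContinuousMultilinearMap ℂ (fun _ : Fin d => (Fin n → ℂ)) (Fin n → ℂ))
    (w : Fin d → Fin n) : Fin n → ℂ := m fun a => Pi.single (w a) 1

/-- The commutative multi-index of a word. -/
def wordIndex {d : ℕ} (w : Fin d → Fin n) : Fin n → ℕ := ∑ a, Pi.single (w a) 1

theorem multiDegree_wordIndex {d : ℕ} (w : Fin d → Fin n) : multiDegree (wordIndex w) = d := by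
  rw [wordIndex, multiDegree_sum]
  simp [multiDegree]

theorem eigMonomial_wordIndex (lam : Fin n → ℂ) {d : ℕ} (w : Fin d → Fin n) :
    eigMonomial lam (wordIndex w) = ∏ a, lam (w a) := by
  have : ∀ s : Finset (Fin d), eigMonomial lam (∑ a ∈ s, Pi.single (w a) 1) =
      ∏ a ∈ s, lam (w a) := by
    intro s
    induction s using Finset.induction with
    | empty => simp [eigMonomial]
    | insert a s ha ih =>
      rw [Finset.sum_insert ha, eigMonomial_add, ih, eigMonomial_single, Finset.prod_insert ha]
  exact this _

theorem sum_wordIndex_embedding {d : ℕ} (w : Fin d → Fin n) (c : Composition d) :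
    ∑ a : Fin c.length, wordIndex (w ∘ c.embedding a) = wordIndex w := by
  simp only [wordIndex]
  rw [← c.blocksFinEquiv.sum_comp, ← Finset.univ_sigma_univ, Finset.sum_sigma]
  rfl

theorem multilinear_apply_eq_sum_words {d : ℕ} {G : Type*} [NormedAddCommGroup G] [NormedSpace ℂ G]
    (m : ContinuousMultilinearMap ℂ (fun _ : Fin d => (Fin n → ℂ)) G) (v : Fin d → Fin n → ℂ) :
    m v = ∑ w : Fin d → Fin n, (∏ a, v a (w a)) • m fun a => Pi.single (w a) 1 := by
  conv_lhs => rw [show v = fun a => ∑ i, v a i • Pi.single (M := fun _ => ℂ) i 1 from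
    funext fun a => pi_eq_sum_univ' (v a)]
  rw [m.map_sum]
  refine Finset.sum_congr rfl fun w _ => ?_
  rw [m.map_smul_univ]

/-- Passing from coefficients to the norm costs the number `n ^ d` of words, which a geometric bound
absorbs. -/
theorem norm_le_of_wordCoeff_le {d : ℕ}
    (m : ContinuousMultilinearMap ℂ (fun _ : Fin d => (Fin n → ℂ)) (Fin n → ℂ)) {B : ℝ}
    (hB : 0 ≤ B) (h : ∀ w i, ‖wordCoeff m w i‖ ≤ B) : ‖m‖ ≤ (n : ℝ) ^ d * B := by
  refine m.opNorm_le_bound (by positivity) fun v => ?_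
  rw [multilinear_apply_eq_sum_words m v]
  calc _ ≤ ∑ w : Fin d → Fin n, ‖(∏ a, v a (w a)) • m fun a => Pi.single (w a) 1‖ :=
        norm_sum_le _ _
    _ ≤ ∑ w : Fin d → Fin n, (∏ a, ‖v a‖) * B := by
        refine Finset.sum_le_sum fun w _ => ?_
        rw [norm_smul, norm_prod]
        gcongr with a
        · exact norm_le_pi_norm (v a) (w a)
        · exact (pi_norm_le_iff_of_nonneg hB).2 (h w)
    _ = _ := by simp; ring

theorem eq_of_wordCoeff_eq {d : ℕ}
    {m m' : ContinuousMultilinearMap ℂ (fun _ : Fin d => (Fin n → ℂ)) (Fin n → ℂ)}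
    (h : ∀ w, wordCoeff m w = wordCoeff m' w) : m = m' := by
  ext1 v
  rw [multilinear_apply_eq_sum_words m, multilinear_apply_eq_sum_words m']
  exact Finset.sum_congr rfl fun w _ => congrArg _ (h w)

/-- Multiply the coefficients of a multilinear map by the factors `τ w i`. -/
noncomputable def wordMultiplier {d : ℕ} (τ : (Fin d → Fin n) → Fin n → ℂ)
    (m : ContinuousMultilinearMap ℂ (fun _ : Fin d => (Fin n → ℂ)) (Fin n → ℂ)) :
    ContinuousMultilinearMap ℂ (fun _ : Fin d => (Fin n → ℂ)) (Fin n → ℂ) :=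
  ∑ w : Fin d → Fin n, (ContinuousMultilinearMap.mkPiRing ℂ (Fin d)
    (fun i => τ w i * wordCoeff m w i)).compContinuousLinearMap
      fun a => ContinuousLinearMap.proj (w a)

theorem wordCoeff_wordMultiplier {d : ℕ} (τ : (Fin d → Fin n) → Fin n → ℂ)
    (m : ContinuousMultilinearMap ℂ (fun _ : Fin d => (Fin n → ℂ)) (Fin n → ℂ))
    (w : Fin d → Fin n) (i : Fin n) :
    wordCoeff (wordMultiplier τ m) w i = τ w i * wordCoeff m w i := by
  rw [wordCoeff, wordMultiplier, sum_apply, Finset.sum_apply, Finset.sum_eq_single w]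
  · simp [ContinuousMultilinearMap.mkPiRing_apply]
  · intro w' _ hw'
    obtain ⟨a, ha⟩ := Function.ne_iff.1 hw'
    have : ∏ a, (Pi.single (w a) (1 : ℂ) : Fin n → ℂ) (w' a) = 0 :=
      Finset.prod_eq_zero (Finset.mem_univ a) (by simp [ha])
    simp [ContinuousMultilinearMap.mkPiRing_apply, this]
  · simp

/-- Each summand is one node of a substitution tree: the block `a` of `w` is consumed in producing
the letter `j a` of an outer word of `Q`. -/
theorem wordCoeff_comp {d : ℕ} (hd : 0 < d)
    {Q : FormalMultilinearSeries ℂ (Fin n → ℂ) (Fin n → ℂ)} (hQ : Q 1 = 0)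
    (p : FormalMultilinearSeries ℂ (Fin n → ℂ) (Fin n → ℂ)) (w : Fin d → Fin n) (i : Fin n) :
    wordCoeff (Q.comp p d) w i = ∑ c ∈ {c : Composition d | 1 < c.length}.toFinset,
      ∑ j : Fin c.length → Fin n,
        (∏ a, wordCoeff (p (c.blocksFun a)) (w ∘ c.embedding a) (j a)) *
          wordCoeff (Q c.length) j i := by
  rw [wordCoeff, comp_apply_of_coeff_one_eq_zero hd hQ, Finset.sum_apply]
  refine Finset.sum_congr rfl fun c _ => ?_
  rw [multilinear_apply_eq_sum_words, Finset.sum_apply]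
  rfl

end WordCoefficients

/-! ### The formal linearization and its coefficients as sums over trees. -/

section FormalLinearization

variable {n : ℕ}

/-- The reciprocals of the non-vanishing divisors. -/
noncomputable def divisorInv (lam : Fin n → ℂ) {d : ℕ} (w : Fin d → Fin n) (i : Fin n) : ℂ :=
  (eigMonomial lam (wordIndex w) - lam i)⁻¹

/-- The formal linearization of `Λ + Q`. -/
noncomputable def linearizingSeries (lam : Fin n → ℂ)
    (Q : FormalMultilinearSeries ℂ (Fin n → ℂ) (Fin n → ℂ)) :
    FormalMultilinearSeries ℂ (Fin n → ℂ) (Fin n → ℂ) :=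
  fixedSeries (fun _ => wordMultiplier (divisorInv lam)) Q

/-- Every monomial of `Q` in the component `i` has weighted degree larger than `d i`. -/
def HasWeightedOrder (d : Fin n → ℕ)
    (Q : FormalMultilinearSeries ℂ (Fin n → ℂ) (Fin n → ℂ)) : Prop :=
  ∀ (ν : ℕ) (j : Fin ν → Fin n) (i : Fin n), wordCoeff (Q ν) j i ≠ 0 → d i + 1 ≤ ∑ a, d (j a)

theorem wordCoeff_linearizingSeries_one (lam : Fin n → ℂ)
    (Q : FormalMultilinearSeries ℂ (Fin n → ℂ) (Fin n → ℂ)) (w : Fin 1 → Fin n) :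
    wordCoeff (linearizingSeries lam Q 1) w = Pi.single (w 0) 1 := by
  rw [linearizingSeries, fixedSeries_one]
  rfl

theorem wordCoeff_linearizingSeries (lam : Fin n → ℂ)
    {Q : FormalMultilinearSeries ℂ (Fin n → ℂ) (Fin n → ℂ)} (hQ : Q 1 = 0) {d : ℕ} (hd : 2 ≤ d)
    (w : Fin d → Fin n) (i : Fin n) :
    wordCoeff (linearizingSeries lam Q d) w i = (eigMonomial lam (wordIndex w) - lam i)⁻¹ *
      wordCoeff (Q.comp (linearizingSeries lam Q) d) w i := by
  conv_lhs => rw [linearizingSeries, fixedSeries_of_two_le _ hQ hd, wordCoeff_wordMultiplier]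
  rfl

variable {lam : Fin n → ℂ} {d : Fin n → ℕ}
  {Q : FormalMultilinearSeries ℂ (Fin n → ℂ) (Fin n → ℂ)} {C r : ℝ} {σ : ℕ → ℝ}

/-- The product of inverse divisors along the vertices `S`. -/
noncomputable def divisorProd (lam : Fin n → ℂ) (S : Multiset ((Fin n → ℕ) × Fin n)) : ℝ :=
  (S.map fun q => ‖eigMonomial lam q.1 - lam q.2‖⁻¹).prod

theorem divisorProd_nonneg (lam : Fin n → ℂ) (S : Multiset ((Fin n → ℕ) × Fin n)) :
    0 ≤ divisorProd lam S := by
  refine Multiset.prod_nonneg fun x hx => ?_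
  obtain ⟨q, _, rfl⟩ := Multiset.mem_map.1 hx
  positivity

theorem divisorProd_sum (lam : Fin n → ℂ) {α : Type*} (s : Finset α)
    (S : α → Multiset ((Fin n → ℕ) × Fin n)) :
    divisorProd lam (∑ a ∈ s, S a) = ∏ a ∈ s, divisorProd lam (S a) := by
  classical
  induction s using Finset.induction with
  | empty => simp [divisorProd]
  | insert a s ha ih =>
    rw [Finset.sum_insert ha, Finset.prod_insert ha, ← ih, divisorProd, Multiset.map_add,
      Multiset.prod_add]
    rfl

/-- If the lower order coefficients are bounded by divisor products of trees, so are the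
coefficients of the composition. -/
theorem exists_tree_comp (hC : 0 ≤ C) (hr : 0 ≤ r) (hQ1 : Q 1 = 0)
    (hQb : ∀ ν, ‖Q ν‖ ≤ C * r ^ ν) (hQd : HasWeightedOrder d Q)
    (p : FormalMultilinearSeries ℂ (Fin n → ℂ) (Fin n → ℂ)) (hσ : ∀ m, 0 ≤ σ m)
    {N : ℕ} (hN : 2 ≤ N)
    (hσN : σ N = ∑ c ∈ {c : Composition N | 1 < c.length}.toFinset,
        C * (n * r) ^ c.length * ∏ j, σ (c.blocksFun j))
    (ih : ∀ m, 1 ≤ m → m < N → ∀ (w : Fin m → Fin n) i, wordCoeff (p m) w i ≠ 0 →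
      ∃ S, DivisorTree d (wordIndex w) i S ∧ ‖wordCoeff (p m) w i‖ ≤ σ m * divisorProd lam S)
    (w : Fin N → Fin n) (i : Fin n) (hne : wordCoeff (Q.comp p N) w i ≠ 0) :
    ∃ S, DivisorTree d (wordIndex w) i ((wordIndex w, i) ::ₘ S) ∧
      ‖wordCoeff (Q.comp p N) w i‖ ≤ σ N * divisorProd lam S := by
  classical
  rw [wordCoeff_comp (by omega) hQ1, Finset.sum_sigma'] at hne ⊢
  set term : (Σ c : Composition N, Fin c.length → Fin n) → ℂ := fun x =>
    (∏ a, wordCoeff (p (x.1.blocksFun a)) (w ∘ x.1.embedding a) (x.2 a)) *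
      wordCoeff (Q x.1.length) x.2 i with hterm
  set I : Finset (Σ c : Composition N, Fin c.length → Fin n) :=
    ({c : Composition N | 1 < c.length}.toFinset).sigma fun _ => Finset.univ with hI
  have hlen : ∀ x ∈ I, 1 < x.1.length := fun x hx => by
    simpa using (Finset.mem_sigma.1 hx).1
  -- A vanishing term need not come from a tree, because trees for the blocks and the weight
  -- condition on `Q` are available only for nonzero coefficients.
  set J := I.filter fun x => term x ≠ 0 with hJ
  have hJne : J.Nonempty := by
    by_contra h
    rw [Finset.not_nonempty_iff_eq_empty] at h
    apply hne
    refine Finset.sum_eq_zero fun x hx => ?_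
    by_contra hx0
    have : x ∈ J := Finset.mem_filter.2 ⟨hx, hx0⟩
    rw [h] at this
    simp at this
  have htree : ∀ x : (Σ c : Composition N, Fin c.length → Fin n), ∃ S, x ∈ J →
      DivisorTree d (wordIndex w) i ((wordIndex w, i) ::ₘ S) ∧
      ∏ a, ‖wordCoeff (p (x.1.blocksFun a)) (w ∘ x.1.embedding a) (x.2 a)‖ ≤
        (∏ a, σ (x.1.blocksFun a)) * divisorProd lam S := by
    intro x
    by_cases hx : x ∈ J
    swap
    · exact ⟨0, fun h => absurd h hx⟩
    obtain ⟨hxI, hx0⟩ := Finset.mem_filter.1 hx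
    have hx1 := hlen x hxI
    have hfac : ∀ a, wordCoeff (p (x.1.blocksFun a)) (w ∘ x.1.embedding a) (x.2 a) ≠ 0 :=
      fun a h0 => hx0 (by
        simp only [hterm]
        rw [Finset.prod_eq_zero (Finset.mem_univ a) h0, zero_mul])
    choose S hS using fun a => ih (x.1.blocksFun a) (x.1.one_le_blocksFun a)
      (blocksFun_lt_of_one_lt_length hx1 a) (w ∘ x.1.embedding a) (x.2 a) (hfac a)
    refine ⟨∑ a, S a, fun _ => ⟨?_, ?_⟩⟩
    · have := DivisorTree.node (d := d) hx1 (fun a => wordIndex (w ∘ x.1.embedding a)) x.2 S i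
        (fun a => (hS a).1) (hQd _ _ _ fun h0 => hx0 (by simp only [hterm]; rw [h0, mul_zero]))
      rwa [sum_wordIndex_embedding] at this
    · rw [divisorProd_sum, ← Finset.prod_mul_distrib]
      exact Finset.prod_le_prod (fun a _ => norm_nonneg _) fun a _ => (hS a).2
  choose S hS using htree
  -- One tree serves for the whole sum: the one with the largest divisor product. The remaining
  -- factors then add up to the majorant `σ N`.
  obtain ⟨x0, hx0, hmax⟩ := J.exists_max_image (fun x => divisorProd lam (S x)) hJne
  refine ⟨S x0, (hS x0 hx0).1, ?_⟩
  have hQw : ∀ (ν : ℕ) (j : Fin ν → Fin n), ‖wordCoeff (Q ν) j i‖ ≤ C * r ^ ν := by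
    intro ν j
    refine (norm_le_pi_norm (wordCoeff (Q ν) j) i).trans (((Q ν).le_opNorm _).trans ?_)
    have : ∏ a : Fin ν, ‖(Pi.single (j a) (1 : ℂ) : Fin n → ℂ)‖ = 1 :=
      Finset.prod_eq_one fun a _ => by rw [Pi.norm_single]; simp
    rw [this, mul_one]
    exact hQb ν
  have hP := divisorProd_nonneg lam (S x0)
  calc ‖∑ x ∈ I, term x‖ ≤ ∑ x ∈ I, ‖term x‖ := norm_sum_le _ _
    _ ≤ ∑ x ∈ I, C * r ^ x.1.length * (∏ a, σ (x.1.blocksFun a)) * divisorProd lam (S x0) := by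
        refine Finset.sum_le_sum fun x hx => ?_
        have hσx : 0 ≤ ∏ a, σ (x.1.blocksFun a) := Finset.prod_nonneg fun a _ => hσ _
        by_cases hx0 : term x = 0
        · rw [hx0, norm_zero]; positivity
        have hxJ : x ∈ J := Finset.mem_filter.2 ⟨hx, hx0⟩
        simp only [hterm]
        rw [norm_mul, norm_prod]
        have h1 := mul_le_mul (hS x hxJ).2 (hQw _ x.2) (norm_nonneg _)
          (mul_nonneg hσx (divisorProd_nonneg lam (S x)))
        have h2 := mul_le_mul_of_nonneg_right (mul_le_mul_of_nonneg_left (hmax x hxJ) hσx)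
          (mul_nonneg hC (pow_nonneg hr x.1.length))
        refine (h1.trans h2).trans_eq ?_
        generalize (∏ a, σ (x.1.blocksFun a)) = A
        ring
    _ = σ N * divisorProd lam (S x0) := by
        rw [hσN, Finset.sum_mul, Finset.sum_sigma]
        refine Finset.sum_congr rfl fun c _ => ?_
        -- There are `n ^ c.length` outer words, whence `n * r` in place of `r` in the recursion for
        -- `σ`.
        have hcard : ∀ K : ℝ, ∑ _x : Fin c.length → Fin n, K = (n : ℝ) ^ c.length * K := by
          intro K; simp
        refine (hcard (C * r ^ c.length * (∏ a, σ (c.blocksFun a)) * divisorProd lam (S x0))).trans ?_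
        rw [mul_pow]
        ring

/-- By induction on the order: the composition supplies the subtrees, and the recursion multiplies
by the inverse divisor of the new root. A leaf stands for the identity part of the series. -/
theorem exists_tree_linearizingSeries (hC : 0 ≤ C) (hr : 0 ≤ r) (hQ1 : Q 1 = 0)
    (hQb : ∀ ν, ‖Q ν‖ ≤ C * r ^ ν) (hQd : HasWeightedOrder d Q) (hσ : ∀ m, 0 ≤ σ m)
    (hσ1 : σ 1 = 1)
    (hσN : ∀ N, 2 ≤ N → σ N = ∑ c ∈ {c : Composition N | 1 < c.length}.toFinset,
        C * (n * r) ^ c.length * ∏ j, σ (c.blocksFun j)) :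
    ∀ m, 1 ≤ m → ∀ (w : Fin m → Fin n) i, wordCoeff (linearizingSeries lam Q m) w i ≠ 0 →
      ∃ S, DivisorTree d (wordIndex w) i S ∧
        ‖wordCoeff (linearizingSeries lam Q m) w i‖ ≤ σ m * divisorProd lam S := by
  intro m
  induction m using Nat.strong_induction_on with
  | _ m ih =>
    intro hm w i hne
    rcases Nat.lt_or_ge m 2 with h2 | h2
    · obtain rfl : m = 1 := by omega
      rw [wordCoeff_linearizingSeries_one] at hne ⊢
      have hi : i = w 0 := by
        by_contra h
        exact hne (by simp [h])
      subst hi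
      refine ⟨0, ?_, by simp [divisorProd, hσ1]⟩
      have := DivisorTree.leaf (d := d) (w 0)
      rwa [show wordIndex w = Pi.single (w 0) 1 by simp [wordIndex]]
    · rw [wordCoeff_linearizingSeries lam hQ1 h2] at hne ⊢
      obtain ⟨S, hS, hle⟩ := exists_tree_comp (lam := lam) hC hr hQ1 hQb hQd
        (linearizingSeries lam Q) hσ h2 (hσN m h2)
        (fun m' h1 hlt => ih m' hlt h1) w i (right_ne_zero_of_mul hne)
      refine ⟨_, hS, ?_⟩
      rw [norm_mul, norm_inv, divisorProd, Multiset.map_cons, Multiset.prod_cons]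
      calc _ ≤ ‖eigMonomial lam (wordIndex w) - lam i‖⁻¹ * (σ m * divisorProd lam S) := by gcongr
        _ = _ := by rw [divisorProd]; ring

end FormalLinearization

/-! ### Convergence of the linearization under the reduced Brjuno condition. -/

section ConvergentLinearization

variable {n : ℕ} {lam : Fin n → ℂ} {d : Fin n → ℕ}
  {Q : FormalMultilinearSeries ℂ (Fin n → ℂ) (Fin n → ℂ)}

/-- The diagonal linear map with eigenvalues `lam`. -/
noncomputable def diagMap (lam : Fin n → ℂ) : (Fin n → ℂ) →L[ℂ] (Fin n → ℂ) :=
  ContinuousLinearMap.pi fun i => lam i • ContinuousLinearMap.proj i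

@[simp] theorem diagMap_apply (lam : Fin n → ℂ) (z : Fin n → ℂ) (i : Fin n) :
    diagMap lam z i = lam i * z i := by simp [diagMap]

/-- Three geometric factors multiply: `A * B ^ N` from the majorant, `D ^ N` from the divisors along
a tree, and `n ^ N` from the number of words. -/
theorem radius_linearizingSeries_pos (hlam : ∀ i, lam i ≠ 0) (hnr : HasNonresonantSquare lam)
    (hres : ∀ k j, 2 ≤ multiDegree k → d j + 1 ≤ weightedDegree d k →
      eigMonomial lam k ≠ lam j) (hB : ReducedBrjuno lam)
    (hQ1 : Q 1 = 0) (hQr : 0 < Q.radius) (hQd : HasWeightedOrder d Q) :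
    0 < (linearizingSeries lam Q).radius := by
  obtain ⟨C, r, hC, hr, hQb⟩ := Q.le_mul_pow_of_radius_pos hQr
  obtain ⟨σ, hσ, hσ1, hσN, A, B, hA, hB', hσAB⟩ :=
    exists_composition_majorant C (n * r) hC.le (by positivity)
  obtain ⟨D, hD, hDle⟩ := DivisorTree.exists_prod_inv_le hlam hnr hres hB
  have htree := exists_tree_linearizingSeries (lam := lam) hC.le hr.le hQ1 hQb hQd hσ hσ1 hσN
  refine radius_pos_of_norm_le_geometric (A := A) (B := (n + 1) * (B * D)) (by positivity)
    fun N => ?_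
  have hb : ‖linearizingSeries lam Q N‖ ≤ (n : ℝ) ^ N * (A * (B * D) ^ N) := by
    refine norm_le_of_wordCoeff_le _ (by positivity) fun w i => ?_
    by_cases h0 : wordCoeff (linearizingSeries lam Q N) w i = 0
    · rw [h0, norm_zero]; positivity
    have hN : 1 ≤ N := by
      by_contra hN
      obtain rfl : N = 0 := by omega
      apply h0
      rw [linearizingSeries, fixedSeries_zero]
      rfl
    obtain ⟨S, hS, hle⟩ := htree N hN w i h0
    have h1 := hDle _ _ _ hS
    rw [multiDegree_wordIndex] at h1
    calc _ ≤ σ N * divisorProd lam S := hle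
      _ ≤ (A * B ^ N) * D ^ N := by
          refine mul_le_mul (hσAB N) h1 (divisorProd_nonneg _ _) (by positivity)
      _ = _ := by ring
  calc _ ≤ (n : ℝ) ^ N * (A * (B * D) ^ N) := hb
    _ ≤ ((n : ℝ) + 1) ^ N * (A * (B * D) ^ N) := by gcongr; linarith
    _ = _ := by rw [mul_pow (_ + _)]; ring

/-- Terms of resonant type do not occur in the composition with the linearizing series. -/
theorem linearizingSeries_conjugates
    (hres : ∀ k j, 2 ≤ multiDegree k → d j + 1 ≤ weightedDegree d k →
      eigMonomial lam k ≠ lam j)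
    (hQ0 : Q 0 = 0) (hQ1 : Q 1 = 0) (hQr : 0 < Q.radius) (hQd : HasWeightedOrder d Q) :
    (linearizingSeries lam Q).compContinuousLinearMap (diagMap lam) =
      (diagMap lam).compFormalMultilinearSeries (linearizingSeries lam Q) +
        Q.comp (linearizingSeries lam Q) := by
  ext1 N
  refine eq_of_wordCoeff_eq fun w => ?_
  have hL : wordCoeff ((linearizingSeries lam Q).compContinuousLinearMap (diagMap lam) N) w =
      (∏ a, lam (w a)) • wordCoeff (linearizingSeries lam Q N) w := by
    rw [wordCoeff, FormalMultilinearSeries.compContinuousLinearMap_apply]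
    have : (diagMap lam ∘ fun a => (Pi.single (w a) (1 : ℂ) : Fin n → ℂ)) =
        fun a => lam (w a) • (Pi.single (w a) (1 : ℂ) : Fin n → ℂ) := by
      funext a i
      by_cases h : i = w a
      · subst h; simp
      · simp [h]
    rw [this, ContinuousMultilinearMap.map_smul_univ]
    rfl
  rw [hL]
  change _ = diagMap lam (wordCoeff (linearizingSeries lam Q N) w) +
    wordCoeff (Q.comp (linearizingSeries lam Q) N) w
  rcases Nat.lt_or_ge N 2 with hN | hN
  · interval_cases N
    · have h1 : linearizingSeries lam Q 0 = 0 := fixedSeries_zero _ _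
      have h2 : Q.comp (linearizingSeries lam Q) 0 = 0 := by
        ext1 v
        rw [FormalMultilinearSeries.comp_coeff_zero, hQ0]
      rw [h1, h2]
      simp [wordCoeff]
    · have h2 : Q.comp (linearizingSeries lam Q) 1 = 0 := by
        ext1 v
        rw [FormalMultilinearSeries.comp_coeff_one, hQ1]
        rfl
      rw [h2, wordCoeff_linearizingSeries_one]
      funext i
      by_cases h : i = w 0
      · subst h; simp [wordCoeff]
      · simp [wordCoeff, h]
  · funext i
    have hrec := wordCoeff_linearizingSeries lam hQ1 hN w i
    rw [← eigMonomial_wordIndex]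
    simp only [Pi.smul_apply, smul_eq_mul, Pi.add_apply, diagMap_apply]
    by_cases h0 : eigMonomial lam (wordIndex w) = lam i
    -- At a resonant word the inverse divisor is `0⁻¹ = 0`, so the equation can hold only if the
    -- composition has no coefficient there. A nonzero one would give a tree whose root is resonant,
    -- against `hres`.
    · rw [h0, left_eq_add]
      by_contra hne
      obtain ⟨C, r, hC, hr, hQb⟩ := Q.le_mul_pow_of_radius_pos hQr
      obtain ⟨σ, hσ, hσ1, hσN, -⟩ :=
        exists_composition_majorant C (n * r) hC.le (by positivity)
      have htree := exists_tree_linearizingSeries (lam := lam) hC.le hr.le hQ1 hQb hQd hσ hσ1 hσN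
      obtain ⟨S, hS, -⟩ := exists_tree_comp (lam := lam) hC.le hr.le hQ1 hQb hQd _ hσ hN
        (hσN N hN) (fun m h1 _ => htree m h1) w i hne
      obtain ⟨h1, h2⟩ := hS.two_le_of_mem _ (Multiset.mem_cons_self _ _)
      exact hres _ _ h1 h2 h0
    · have h1 : eigMonomial lam (wordIndex w) - lam i ≠ 0 := sub_ne_zero.2 h0
      rw [eq_inv_mul_iff_mul_eq₀ h1] at hrec
      linear_combination hrec

/-- **Linearization theorem.** A holomorphic germ `Λ + F`, all of whose monomials have weighted
order larger than that of the component in which they occur, is linearizable under the reduced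
Brjuno condition if no such monomial is resonant. -/
theorem exists_linearization {F : (Fin n → ℂ) → (Fin n → ℂ)} (hF : HasFPowerSeriesAt F Q 0)
    (hlam : ∀ i, lam i ≠ 0) (hnr : HasNonresonantSquare lam)
    (hres : ∀ k j, 2 ≤ multiDegree k → d j + 1 ≤ weightedDegree d k →
      eigMonomial lam k ≠ lam j) (hB : ReducedBrjuno lam)
    (hQ0 : Q 0 = 0) (hQ1 : Q 1 = 0) (hQd : HasWeightedOrder d Q) :
    ∃ ψ : (Fin n → ℂ) → (Fin n → ℂ), AnalyticAt ℂ ψ 0 ∧ ψ 0 = 0 ∧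
      HasFDerivAt ψ (ContinuousLinearMap.id ℂ (Fin n → ℂ)) 0 ∧
      ∀ᶠ z in 𝓝 0, ψ (diagMap lam z) = diagMap lam (ψ z) + F (ψ z) := by
  have hQr := hF.radius_pos
  have hr := radius_linearizingSeries_pos hlam hnr hres hB hQ1 hQr hQd
  set p := linearizingSeries lam Q with hp
  have hψ : HasFPowerSeriesAt p.sum p 0 := (p.hasFPowerSeriesOnBall hr).hasFPowerSeriesAt
  have hψ0 : p.sum 0 = 0 := by
    rw [← hψ.coeff_zero fun _ => 0, hp, linearizingSeries, fixedSeries_zero]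
    rfl
  refine ⟨p.sum, hψ.analyticAt, hψ0, ?_, ?_⟩
  · have := hψ.hasFDerivAt
    rw [show p 1 = (continuousMultilinearCurryFin1 ℂ (Fin n → ℂ) (Fin n → ℂ)).symm
      (ContinuousLinearMap.id ℂ _) from fixedSeries_one _ _, LinearIsometryEquiv.apply_symm_apply]
      at this
    exact this
  · have h1 : HasFPowerSeriesAt (p.sum ∘ diagMap lam) (p.compContinuousLinearMap (diagMap lam)) 0 :=
      HasFPowerSeriesAt.compContinuousLinearMap (by rwa [map_zero])
    have h2 : HasFPowerSeriesAt (diagMap lam ∘ p.sum)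
        ((diagMap lam).compFormalMultilinearSeries p) 0 :=
      ⟨_, (diagMap lam).comp_hasFPowerSeriesOnBall (p.hasFPowerSeriesOnBall hr)⟩
    have h3 : HasFPowerSeriesAt (F ∘ p.sum) (Q.comp p) 0 :=
      HasFPowerSeriesAt.comp (by rwa [hψ0]) hψ
    have h4 := h1.sub (h2.add h3)
    rw [linearizingSeries_conjugates hres hQ0 hQ1 hQr hQd, sub_self] at h4
    filter_upwards [h4.eventually_eq_zero] with z hz
    exact sub_eq_zero.1 hz

end ConvergentLinearization

/-! ### From vanishing along the tail subspace to weights of monomials. -/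

section WeightedSeries

variable {n : ℕ}

/-- Power series with the same values on the diagonals define the same function. -/
theorem HasFPowerSeriesAt.congr_diagonal {𝕜 E G : Type*} [NontriviallyNormedField 𝕜]
    [NormedAddCommGroup E] [NormedSpace 𝕜 E] [NormedAddCommGroup G] [NormedSpace 𝕜 G]
    {f : E → G} {p q : FormalMultilinearSeries 𝕜 E G} {x : E} (h : HasFPowerSeriesAt f p x)
    (hq : 0 < q.radius) (hpq : ∀ ν z, q ν (fun _ => z) = p ν fun _ => z) :
    HasFPowerSeriesAt f q x := by
  obtain ⟨r, hr⟩ := h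
  refine ⟨min r q.radius, min_le_right _ _, lt_min hr.r_pos hq, fun {y} hy => ?_⟩
  refine (hr.hasSum (Metric.eball_subset_eball (min_le_left _ _) hy)).congr_fun ?_
  intro ν
  exact hpq ν y

/-- Projection to the coordinates of weight zero. -/
noncomputable def tailProj (d : Fin n → ℕ) : (Fin n → ℂ) →L[ℂ] (Fin n → ℂ) :=
  diagMap fun i => if d i = 0 then 1 else 0

theorem tailProj_apply (d : Fin n → ℕ) (z : Fin n → ℂ) (i : Fin n) :
    tailProj d z i = if d i = 0 then z i else 0 := by
  simp [tailProj]

/-- The tail part of `z` has only letters of weight zero and the complement only letters of nonzero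
weight. Hence the slots `s` single out the words whose letters of weight zero sit exactly in `s`. -/
theorem multilinear_piecewise_eq_sum_words {N : ℕ}
    (m : ContinuousMultilinearMap ℂ (fun _ : Fin N => (Fin n → ℂ)) (Fin n → ℂ)) (d : Fin n → ℕ)
    (s : Finset (Fin N)) (z : Fin n → ℂ) :
    m (s.piecewise (fun _ => tailProj d z) fun _ => z - tailProj d z) =
      ∑ w : Fin N → Fin n, if s = Finset.univ.filter (fun a => d (w a) = 0) then
        (∏ a, z (w a)) • wordCoeff m w else 0 := by
  rw [multilinear_apply_eq_sum_words]
  refine Finset.sum_congr rfl fun w _ => ?_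
  split_ifs with h
  · congr 1
    refine Finset.prod_congr rfl fun a _ => ?_
    by_cases ha : d (w a) = 0
    · have : a ∈ s := by rw [h]; simp [ha]
      simp [this, tailProj_apply, ha]
    · have : a ∉ s := by rw [h]; simp [ha]
      simp [this, tailProj_apply, ha]
  · have : ∃ a, ¬ (a ∈ s ↔ d (w a) = 0) := by
      by_contra hcon
      push Not at hcon
      exact h (by ext a; simp [hcon a])
    obtain ⟨a, ha⟩ := this
    rw [Finset.prod_eq_zero (Finset.mem_univ a), zero_smul]
    by_cases has : a ∈ s
    · have : d (w a) ≠ 0 := fun h0 => ha ⟨fun _ => h0, fun _ => has⟩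
      simp [has, tailProj_apply, this]
    · have : d (w a) = 0 := by
        by_contra h0
        exact ha ⟨fun h => absurd h has, fun h => absurd h h0⟩
      simp [has, tailProj_apply, this]

theorem card_filter_weight_zero {N : ℕ} {d : Fin n → ℕ} (hd : ∀ i, d i ≤ 1) (w : Fin N → Fin n) :
    (Finset.univ.filter (fun a => d (w a) = 0)).card + ∑ a, d (w a) = N := by
  rw [Finset.card_filter, ← Finset.sum_add_distrib]
  have : ∀ a, (if d (w a) = 0 then 1 else 0) + d (w a) = 1 := fun a => by
    have := hd (w a)
    split_ifs <;> omega
  simp [this]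

/-- The derivative replaces one of the `1 + l` arguments by the direction `y`; the set `s` records
the `l` slots that keep `x`. This isolates the words with exactly one letter of weight one. -/
theorem derivSeries_apply_eq_sum (p : FormalMultilinearSeries ℂ (Fin n → ℂ) (Fin n → ℂ)) (l : ℕ)
    (x y : Fin n → ℂ) : p.derivSeries l (fun _ => x) y =
      ∑ s : {s : Finset (Fin (1 + l)) // s.card = l},
        p (1 + l) (s.1.piecewise (fun _ => x) fun _ => y) := by
  have h : p.derivSeries l (fun _ => x) y =
      p.changeOriginSeries 1 l (fun _ => x) (fun _ => y) := by
    simp only [FormalMultilinearSeries.derivSeries,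
      ContinuousLinearMap.compFormalMultilinearSeries_apply,
      ContinuousLinearMap.compContinuousMultilinearMap_coe, Function.comp_apply]
    refine (continuousMultilinearCurryFin1_apply _ _).trans ?_
    congr 1
  rw [h, FormalMultilinearSeries.changeOriginSeries, sum_apply, sum_apply]
  exact Finset.sum_congr rfl fun s _ => p.changeOriginSeriesTerm_apply 1 l s.1 s.2 x y

/-- A germ vanishing on the tail subspace, whose components of weight one vanish to second order
there, has a power series without monomials of low weighted order. -/
theorem exists_hasWeightedOrder_series {d : Fin n → ℕ} (hd : ∀ i, d i ≤ 1)
    {F : (Fin n → ℂ) → (Fin n → ℂ)} (hF : AnalyticAt ℂ F 0) (hF0 : fderiv ℂ F 0 = 0)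
    (h1 : ∀ᶠ z in 𝓝 0, F (tailProj d z) = 0)
    (h2 : ∀ᶠ z in 𝓝 0, ∀ i, d i = 1 → ∀ v, fderiv ℂ F (tailProj d z) v i = 0) :
    ∃ Q : FormalMultilinearSeries ℂ (Fin n → ℂ) (Fin n → ℂ), HasFPowerSeriesAt F Q 0 ∧
      Q 0 = 0 ∧ Q 1 = 0 ∧ HasWeightedOrder d Q := by
  obtain ⟨p, hp⟩ := hF
  have hT1 : ∀ ν z, p ν (fun _ => tailProj d z) = 0 := by
    intro ν z
    have h : HasFPowerSeriesAt (F ∘ tailProj d) (p.compContinuousLinearMap (tailProj d)) 0 :=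
      HasFPowerSeriesAt.compContinuousLinearMap (by rwa [map_zero])
    exact (h.congr (g := 0) h1).apply_eq_zero ν z
  have hT2 : ∀ i, d i = 1 → ∀ ν z v, p.derivSeries ν (fun _ => tailProj d z) v i = 0 := by
    intro i hi ν z v
    obtain ⟨r, hr⟩ := hp
    have h : HasFPowerSeriesAt (fderiv ℂ F ∘ tailProj d)
        (p.derivSeries.compContinuousLinearMap (tailProj d)) 0 :=
      HasFPowerSeriesAt.compContinuousLinearMap (by rw [map_zero]; exact ⟨r, hr.fderiv⟩)
    obtain ⟨r', hr'⟩ := h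
    have h' := ((ContinuousLinearMap.proj (R := ℂ) (φ := fun _ : Fin n => ℂ) i).comp
      (ContinuousLinearMap.apply ℂ (Fin n → ℂ) v)).comp_hasFPowerSeriesOnBall hr'
    refine (h'.hasFPowerSeriesAt.congr (g := 0) ?_).apply_eq_zero ν z
    filter_upwards [h2] with z hz
    exact hz i hi v
  -- The words of too low weight cancel in total on every diagonal. Their individual coefficients
  -- need not vanish, because `p` is not assumed symmetric.
  have hwords : ∀ (ν : ℕ) (z : Fin n → ℂ) (i : Fin n), ∑ w : Fin ν → Fin n,
      (if d i + 1 ≤ ∑ a, d (w a) then 0 else (∏ a, z (w a)) * wordCoeff (p ν) w i) = 0 := by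
    intro ν z i
    have hall : ∑ w : Fin ν → Fin n, (if ∑ a, d (w a) = 0 then
        (∏ a, z (w a)) * wordCoeff (p ν) w i else 0) = 0 := by
      have := congrFun (multilinear_piecewise_eq_sum_words (p ν) d Finset.univ z) i
      rw [Finset.piecewise_univ, hT1, Finset.sum_apply] at this
      refine Eq.trans (Finset.sum_congr rfl fun w _ => ?_) this.symm
      have hc := card_filter_weight_zero hd w
      by_cases h0 : ∑ a, d (w a) = 0
      · have : Finset.univ = Finset.univ.filter (fun a => d (w a) = 0) := by
          symm
          rw [Finset.filter_eq_self]
          intro a _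
          exact (Finset.sum_eq_zero_iff.1 h0) a (Finset.mem_univ a)
        rw [if_pos h0, if_pos this]
        rfl
      · have : ¬ Finset.univ = Finset.univ.filter (fun a => d (w a) = 0) := by
          intro h
          rw [← h, Finset.card_univ, Fintype.card_fin] at hc
          omega
        rw [if_neg h0, if_neg this]
        rfl
    rcases Nat.lt_or_ge (d i) 1 with hi | hi
    · refine Eq.trans (Finset.sum_congr rfl fun w _ => ?_) hall
      split_ifs <;> first | rfl | omega
    have hi' : d i = 1 := le_antisymm (hd i) hi
    have hone : ∑ w : Fin ν → Fin n, (if ∑ a, d (w a) = 1 then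
        (∏ a, z (w a)) * wordCoeff (p ν) w i else 0) = 0 := by
      rcases ν with _ | l
      · simp
      rw [add_comm l 1]
      -- The derivative at the tail part of `z`, in the direction of the remaining part, selects the
      -- words of weight one.
      have := hT2 i hi' l z (z - tailProj d z)
      rw [derivSeries_apply_eq_sum, Finset.sum_apply] at this
      refine Eq.trans ?_ this
      simp_rw [multilinear_piecewise_eq_sum_words, Finset.sum_apply]
      rw [Finset.sum_comm]
      refine Finset.sum_congr rfl fun w _ => ?_
      have hc := card_filter_weight_zero hd w
      by_cases h0 : ∑ a, d (w a) = 1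
      · have hcard : (Finset.univ.filter (fun a => d (w a) = 0)).card = l := by omega
        rw [if_pos h0, Finset.sum_eq_single ⟨_, hcard⟩]
        · rw [if_pos rfl]; rfl
        · intro s _ hs
          rw [if_neg fun h => hs (Subtype.ext h)]
          rfl
        · simp
      · rw [if_neg h0]
        symm
        apply Finset.sum_eq_zero
        intro s _
        have hs : ¬ s.1 = Finset.univ.filter (fun a => d (w a) = 0) := fun h => by
          have := s.2
          rw [h] at this
          omega
        rw [if_neg hs]
        rfl
    have := congrArg₂ (· + ·) hall hone
    simp only [← Finset.sum_add_distrib, add_zero] at this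
    refine Eq.trans (Finset.sum_congr rfl fun w _ => ?_) this
    rw [hi']
    split_ifs <;> first | omega | simp
  -- The low-weight words are deleted from `p`. By the cancellation above the diagonal values do not
  -- change, so `Q` is still a power series of `F`.
  set Q : FormalMultilinearSeries ℂ (Fin n → ℂ) (Fin n → ℂ) := fun ν =>
    wordMultiplier (fun w i => if d i + 1 ≤ ∑ a, d (w a) then 1 else 0) (p ν) with hQ
  have hcoeff : ∀ ν w i, wordCoeff (Q ν) w i =
      (if d i + 1 ≤ ∑ a, d (w a) then 1 else 0) * wordCoeff (p ν) w i := fun ν w i =>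
    wordCoeff_wordMultiplier _ _ _ _
  have hp0 : p 0 = 0 := by
    ext1 v
    rw [hp.coeff_zero]
    have := h1.self_of_nhds
    rw [map_zero] at this
    exact this
  have hp1 : p 1 = 0 := by
    have := hp.fderiv_eq
    rw [hF0] at this
    exact (LinearIsometryEquiv.map_eq_zero_iff _).1 this.symm
  have hzero : ∀ ν, p ν = 0 → Q ν = 0 := fun ν h => by
    refine eq_of_wordCoeff_eq fun w => ?_
    funext i
    rw [hcoeff, h]
    simp [wordCoeff]
  refine ⟨Q, hp.congr_diagonal ?_ ?_, hzero 0 hp0, hzero 1 hp1, ?_⟩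
  · obtain ⟨A, B, hA, hB, hAB⟩ := p.le_mul_pow_of_radius_pos hp.radius_pos
    refine radius_pos_of_norm_le_geometric (A := A) (B := (n + 1) * B) (by positivity) fun ν => ?_
    have hb : ‖Q ν‖ ≤ (n : ℝ) ^ ν * (A * B ^ ν) := by
      refine norm_le_of_wordCoeff_le _ (by positivity) fun w i => ?_
      have hw : ‖wordCoeff (p ν) w i‖ ≤ A * B ^ ν := by
        refine (norm_le_pi_norm (wordCoeff (p ν) w) i).trans (((p ν).le_opNorm _).trans ?_)
        have : ∏ a : Fin ν, ‖(Pi.single (w a) (1 : ℂ) : Fin n → ℂ)‖ = 1 :=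
          Finset.prod_eq_one fun a _ => by rw [Pi.norm_single]; simp
        rw [this, mul_one]
        exact hAB ν
      rw [hcoeff]
      split_ifs
      · rwa [one_mul]
      · rw [zero_mul, norm_zero]; positivity
    calc _ ≤ (n : ℝ) ^ ν * (A * B ^ ν) := hb
      _ ≤ ((n : ℝ) + 1) ^ ν * (A * B ^ ν) := by gcongr; linarith
      _ = _ := by rw [mul_pow (_ + _)]; ring
  · intro ν z
    funext i
    rw [multilinear_apply_eq_sum_words (Q ν), multilinear_apply_eq_sum_words (p ν),
      Finset.sum_apply, Finset.sum_apply, ← sub_eq_zero, ← Finset.sum_sub_distrib, ← neg_eq_zero,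
      ← Finset.sum_neg_distrib]
    refine Eq.trans (Finset.sum_congr rfl fun w _ => ?_) (hwords ν z i)
    have := hcoeff ν w i
    simp only [Pi.smul_apply, smul_eq_mul]
    change -((∏ a, z (w a)) * wordCoeff (Q ν) w i - (∏ a, z (w a)) * wordCoeff (p ν) w i) = _
    rw [this]
    split_ifs <;> ring
  · intro ν j i hne
    rw [hcoeff] at hne
    by_contra h
    exact hne (by rw [if_neg h, zero_mul])

end WeightedSeries

/-! ### Level `s` resonances and germs adapted to the tail subspace. -/

section AdaptedGerms

variable {n : ℕ}

/-- The weight distinguishing the first `s` coordinates. -/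
def levelWeight (s : ℕ) (i : Fin n) : ℕ := if i.val < s then 1 else 0

theorem weightedDegree_levelWeight (s : ℕ) (k : Fin n → ℕ) :
    weightedDegree (levelWeight s) k = ∑ i with i.val < s, k i := by
  simp [weightedDegree, levelWeight, Finset.sum_filter]

/-- A resonance for one of the first `s` components has weight exactly one, and a resonance for one
of the others has weight zero. Excess weight therefore excludes resonance. -/
theorem OnlyLevelResonances.nonresonant {s : ℕ} {lam : Fin n → ℂ} (h : OnlyLevelResonances s lam)
    (k : Fin n → ℕ) (j : Fin n) (hk : 2 ≤ multiDegree k)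
    (hj : levelWeight s j + 1 ≤ weightedDegree (levelWeight s) k) :
    eigMonomial lam k ≠ lam j := by
  intro hres
  obtain ⟨h1, h2⟩ := h k hk
  rw [weightedDegree_levelWeight] at hj
  by_cases hjs : j.val < s
  · obtain ⟨-, h3, -⟩ := h1.1 ⟨j, hjs, hres⟩
    rw [h3, levelWeight, if_pos hjs] at hj
    omega
  · obtain ⟨-, h3, -⟩ := h2.1 ⟨j, not_lt.1 hjs, hres⟩
    rw [Finset.sum_eq_zero fun i hi => h3 i (Finset.mem_filter.1 hi).2] at hj
    omega

/-- The square of the first coordinate has weight two in a component of weight one; such a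
coordinate exists because `1 ≤ s`. -/
theorem OnlyLevelResonances.hasNonresonantSquare {s : ℕ} {lam : Fin n → ℂ}
    (h : OnlyLevelResonances s lam) (hs : 1 ≤ s) (hsn : s ≤ n) : HasNonresonantSquare lam := by
  set i : Fin n := ⟨0, by omega⟩
  have hi : levelWeight s i = 1 := if_pos (show 0 < s by omega)
  have h2 : multiDegree (Pi.single i 2) = 2 := by simp [multiDegree]
  refine ⟨Pi.single i 2, i, h2, h.nonresonant _ _ h2.ge ?_⟩
  have : weightedDegree (levelWeight s) (Pi.single i 2) = levelWeight s i * 2 := by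
    simp [weightedDegree, Pi.single_apply]
  omega

/-- Linearization of germs which are linear along the tail subspace and whose normal derivative
is constant there. -/
theorem exists_linearization_of_adapted {s : ℕ} {lam : Fin n → ℂ} (hs : 1 ≤ s) (hsn : s ≤ n)
    (hlam : ∀ i, lam i ≠ 0) (hL : OnlyLevelResonances s lam) (hB : ReducedBrjuno lam)
    {h : (Fin n → ℂ) → (Fin n → ℂ)} (hh : AnalyticAt ℂ h 0) (hfd : fderiv ℂ h 0 = diagMap lam)
    (h1 : ∀ᶠ z in 𝓝 0, h (tailProj (levelWeight s) z) = diagMap lam (tailProj (levelWeight s) z))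
    (h2 : ∀ᶠ z in 𝓝 0, ∀ i : Fin n, i.val < s → ∀ v,
      fderiv ℂ h (tailProj (levelWeight s) z) v i = lam i * v i) :
    ∃ ψ : (Fin n → ℂ) → (Fin n → ℂ), AnalyticAt ℂ ψ 0 ∧ ψ 0 = 0 ∧
      HasFDerivAt ψ (ContinuousLinearMap.id ℂ (Fin n → ℂ)) 0 ∧
      ∀ᶠ z in 𝓝 0, ψ (diagMap lam z) = h (ψ z) := by
  set F : (Fin n → ℂ) → (Fin n → ℂ) := fun z => h z - diagMap lam z with hFdef
  have hF : AnalyticAt ℂ F 0 := hh.sub ((diagMap lam).analyticAt 0)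
  have hFd : ∀ᶠ z in 𝓝 0, fderiv ℂ F z = fderiv ℂ h z - diagMap lam := by
    filter_upwards [hh.eventually_analyticAt] with z hz
    rw [hFdef, fderiv_fun_sub hz.differentiableAt (diagMap lam).differentiableAt,
      ContinuousLinearMap.fderiv]
  have hT : Tendsto (tailProj (n := n) (levelWeight s)) (𝓝 0) (𝓝 0) := by
    have := (tailProj (n := n) (levelWeight s)).continuous.tendsto 0
    rwa [map_zero] at this
  obtain ⟨Q, hQ, hQ0, hQ1, hQd⟩ := exists_hasWeightedOrder_series (d := levelWeight s)
    (fun i => by rw [levelWeight]; split_ifs <;> omega) hF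
    (by rw [hFd.self_of_nhds, hfd, sub_self])
    (by filter_upwards [h1] with z hz; rw [hFdef]; simp only; rw [hz, sub_self])
    (by
      filter_upwards [h2, hT.eventually hFd] with z hz hz' i hi v
      have his : i.val < s := by
        by_contra hcon
        rw [levelWeight, if_neg hcon] at hi
        omega
      rw [hz', sub_apply, Pi.sub_apply, hz i his, diagMap_apply, sub_self])
  obtain ⟨ψ, hψ, hψ0, hψd, hψc⟩ := exists_linearization hQ hlam (hL.hasNonresonantSquare hs hsn)
    hL.nonresonant hB hQ0 hQ1 hQd
  refine ⟨ψ, hψ, hψ0, hψd, ?_⟩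
  filter_upwards [hψc] with z hz
  rw [hz, hFdef]
  simp only
  abel

end AdaptedGerms

section Analytic

variable {E F G : Type*} [NormedAddCommGroup E] [NormedSpace ℂ E] [NormedAddCommGroup F]
  [NormedSpace ℂ F] [NormedAddCommGroup G] [NormedSpace ℂ G]

theorem analyticAt_clm_apply [CompleteSpace G] {c : E → F →L[ℂ] G} {u : E → F} {x : E}
    (hc : AnalyticAt ℂ c x) (hu : AnalyticAt ℂ u x) : AnalyticAt ℂ (fun y => c y (u y)) x :=
  ((ContinuousLinearMap.id ℂ (F →L[ℂ] G)).analyticAt_bilinear (c x, u x)).comp₂ hc hu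

end Analytic

/-! ### Differential equations along the Euler field. -/

section RadialEquation

variable {Y W V : Type*} [NormedAddCommGroup Y] [NormedSpace ℂ Y] [NormedAddCommGroup W]
  [NormedSpace ℂ W] [NormedAddCommGroup V] [NormedSpace ℂ V]

/-- Uniqueness for radial differential equations. -/
theorem eventually_eq_zero_of_radial_bound [CompleteSpace V] {b : Y → V} (hb : AnalyticAt ℂ b 0)
    (hb0 : b 0 = 0) {C : ℝ}
    (h : ∀ᶠ y in 𝓝 0, ‖fderiv ℂ b y y‖ ≤ C * ‖y‖ * ‖b y‖) : ∀ᶠ y in 𝓝 0, b y = 0 := by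
  obtain ⟨ρ, hρ, hball⟩ := Metric.eventually_nhds_iff_ball.1 (h.and hb.eventually_analyticAt)
  refine Metric.eventually_nhds_iff_ball.2 ⟨ρ, hρ, fun y hy => ?_⟩
  have hmem : ∀ t ∈ Set.Icc (0 : ℝ) 1, (t : ℂ) • y ∈ Metric.ball (0 : Y) ρ := by
    intro t ht
    rw [mem_ball_zero_iff] at hy ⊢
    rw [norm_smul, Complex.norm_real, Real.norm_of_nonneg ht.1]
    exact lt_of_le_of_lt (mul_le_of_le_one_left (norm_nonneg _) ht.2) hy
  have hline : ∀ t : ℝ, HasDerivAt (fun t : ℝ => (t : ℂ) • y) y t := fun t => by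
    simpa using (Complex.ofRealCLM.hasDerivAt (x := t)).smul_const y
  have hderiv : ∀ t ∈ Set.Icc (0 : ℝ) 1, HasDerivAt (fun t : ℝ => b ((t : ℂ) • y))
      (fderiv ℂ b ((t : ℂ) • y) y) t := by
    intro t ht
    have h1 := (((hball _ (hmem t ht)).2.differentiableAt.hasFDerivAt).restrictScalars ℝ)
    exact h1.comp_hasDerivAt t (hline t)
  have hbound : ∀ t ∈ Set.Ioc (0 : ℝ) 1, ‖fderiv ℂ b ((t : ℂ) • y) y‖ ≤
      C * ‖y‖ * ‖b ((t : ℂ) • y)‖ := by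
    intro t ht
    have h1 := (hball _ (hmem t ⟨ht.1.le, ht.2⟩)).1
    rw [map_smul, norm_smul, norm_smul, Complex.norm_real, Real.norm_of_nonneg ht.1.le] at h1
    have : t * ‖fderiv ℂ b ((t : ℂ) • y) y‖ ≤ t * (C * ‖y‖ * ‖b ((t : ℂ) • y)‖) := by
      calc _ ≤ _ := h1
        _ = _ := by ring
    exact le_of_mul_le_mul_left this ht.1
  -- The bound on the ray was obtained by dividing by `t`. At `t = 0`, where Grönwall's inequality
  -- needs it too, it follows by continuity.
  have hbound0 : ‖fderiv ℂ b 0 y‖ ≤ C * ‖y‖ * ‖b 0‖ := by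
    have hlim : Tendsto (fun t : ℝ => (t : ℂ) • y) (𝓝[>] 0) (𝓝 0) := by
      have := ((hline 0).continuousAt.tendsto).mono_left (nhdsWithin_le_nhds (s := Set.Ioi 0))
      simpa using this
    have c1 : Tendsto (fun t : ℝ => ‖fderiv ℂ b ((t : ℂ) • y) y‖) (𝓝[>] 0)
        (𝓝 ‖fderiv ℂ b 0 y‖) :=
      ((((ContinuousLinearMap.apply ℂ V y).continuous.tendsto _).comp
        (hb.fderiv.continuousAt.tendsto.comp hlim))).norm
    have c2 : Tendsto (fun t : ℝ => C * ‖y‖ * ‖b ((t : ℂ) • y)‖) (𝓝[>] 0)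
        (𝓝 (C * ‖y‖ * ‖b 0‖)) :=
      ((hb.continuousAt.tendsto.comp hlim).norm).const_mul _
    refine le_of_tendsto_of_tendsto c1 c2 ?_
    filter_upwards [Ioc_mem_nhdsGT (zero_lt_one' ℝ)] with t ht using hbound t ht
  have := norm_le_gronwallBound_of_norm_deriv_right_le (f := fun t : ℝ => b ((t : ℂ) • y))
    (f' := fun t : ℝ => fderiv ℂ b ((t : ℂ) • y) y) (δ := 0) (K := C * ‖y‖) (ε := 0) (a := 0)
    (b := 1) (fun t ht => (hderiv t ht).continuousAt.continuousWithinAt)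
    (fun t ht => (hderiv t ⟨ht.1, ht.2.le⟩).hasDerivWithinAt)
    (by simp [hb0]) (fun t ht => by
      rw [add_zero]
      rcases ht.1.eq_or_lt with h0 | h0
      · subst h0; simpa using hbound0
      · exact hbound t ⟨h0, ht.2.le⟩) 1 ⟨zero_le_one, le_rfl⟩
  rw [gronwallBound_ε0_δ0] at this
  simpa using this

/-- The multiplier `1 / (d - 1)` inverting the Euler operator minus the identity. -/
noncomputable def eulerMultiplier (E : Type*) [NormedAddCommGroup E] [NormedSpace ℂ E] (d : ℕ)
    (m : ContinuousMultilinearMap ℂ (fun _ : Fin d => E) E) :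
    ContinuousMultilinearMap ℂ (fun _ : Fin d => E) E := ((d : ℂ) - 1)⁻¹ • m

/-- Here the divisors are `d - 1 ≥ 1`, so there are no small divisors and the majorant with unit
divisors suffices. -/
theorem radius_fixedSeries_euler_pos {E : Type*} [NormedAddCommGroup E] [NormedSpace ℂ E]
    {Q : FormalMultilinearSeries ℂ E E} (hQ : Q 1 = 0) (hr : 0 < Q.radius) :
    0 < (fixedSeries (eulerMultiplier E) Q).radius := by
  obtain ⟨C, r, hC, hr, hQb⟩ := Q.le_mul_pow_of_radius_pos hr
  obtain ⟨σ, hσ, hσ1, hσN, A, B, hA, hB, hσAB⟩ := exists_composition_majorant C r hC.le hr.le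
  refine radius_pos_of_norm_le_geometric (A := A) hB fun N => le_trans ?_ (hσAB N)
  induction N using Nat.strong_induction_on with
  | _ N ih =>
    match N, ih with
    | 0, _ => rw [fixedSeries_zero, norm_zero]; exact hσ 0
    | 1, _ =>
      rw [fixedSeries_one, LinearIsometryEquiv.norm_map, hσ1]
      exact ContinuousLinearMap.norm_id_le
    | N + 2, ih =>
      rw [fixedSeries_of_two_le _ hQ (by omega), eulerMultiplier, norm_smul]
      have h1 : ‖(((N + 2 : ℕ) : ℂ) - 1)⁻¹‖ ≤ 1 := by
        have : (((N + 2 : ℕ) : ℂ) - 1) = ((N + 1 : ℕ) : ℂ) := by push_cast; ring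
        rw [this, norm_inv, Complex.norm_natCast]
        refine inv_le_one_of_one_le₀ ?_
        push_cast
        linarith [(Nat.cast_nonneg N : (0 : ℝ) ≤ N)]
      have h2 : ‖Q.comp (fixedSeries (eulerMultiplier E) Q) (N + 2)‖ ≤ σ (N + 2) := by
        refine ContinuousMultilinearMap.opNorm_le_bound (hσ _) fun v => ?_
        rw [comp_apply_of_coeff_one_eq_zero (by omega) hQ, hσN _ (by omega), Finset.sum_mul]
        refine (norm_sum_le _ _).trans (Finset.sum_le_sum fun c hc => ?_)
        have hc' : 1 < c.length := by simpa using hc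
        rw [← FormalMultilinearSeries.compAlongComposition_apply]
        refine (ContinuousMultilinearMap.le_opNorm _ v).trans ?_
        gcongr
        refine (Q.compAlongComposition_norm _ c).trans ?_
        gcongr with a
        · exact hQb _
        · exact ih _ (blocksFun_lt_of_one_lt_length hc' a)
      calc _ ≤ 1 * σ (N + 2) := mul_le_mul h1 h2 (norm_nonneg _) zero_le_one
        _ = _ := one_mul _

/-- Solvability of the Euler type equation `dU(z) z - U(z) = (0, q(U(z)))`. -/
theorem exists_euler_solution [CompleteSpace Y] [CompleteSpace W] {q : Y × W → W}
    (hq : AnalyticAt ℂ q 0) (hq0 : q 0 = 0) (hqd : fderiv ℂ q 0 = 0) :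
    ∃ u : Y × W → W, AnalyticAt ℂ u 0 ∧ u 0 = 0 ∧ fderiv ℂ u 0 = ContinuousLinearMap.snd ℂ Y W ∧
      ∀ᶠ z in 𝓝 0, fderiv ℂ u z z - u z = q (z.1, u z) := by
  obtain ⟨Q', hQ'⟩ := hq
  -- The equation is lifted to a self-map `U` of `Y × W`, with right-hand side `(0, q(U))`. The
  -- operator `dU(z) z - U(z)` multiplies the part of degree `d` by `d - 1`, which is the recursion
  -- solved by `fixedSeries`.
  set Q := (ContinuousLinearMap.inr ℂ Y W).compFormalMultilinearSeries Q' with hQdef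
  have hQ : HasFPowerSeriesAt (ContinuousLinearMap.inr ℂ Y W ∘ q) Q 0 := by
    obtain ⟨r, hr⟩ := hQ'
    exact ⟨r, (ContinuousLinearMap.inr ℂ Y W).comp_hasFPowerSeriesOnBall hr⟩
  have hQ1 : Q 1 = 0 := by
    have h1 : Q' 1 = 0 := by
      have := hQ'.fderiv_eq
      rw [hqd] at this
      exact (LinearIsometryEquiv.map_eq_zero_iff _).1 this.symm
    refine ContinuousMultilinearMap.ext fun v => ?_
    simp [hQdef, h1]
  have hQ0 : Q 0 = 0 := by
    refine ContinuousMultilinearMap.ext fun v => ?_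
    rw [hQ.coeff_zero]
    simp [hq0]
  set p := fixedSeries (eulerMultiplier (Y × W)) Q with hp
  have hr : 0 < p.radius := radius_fixedSeries_euler_pos hQ1 hQ.radius_pos
  have hpU := p.hasFPowerSeriesOnBall hr
  have hU : HasFPowerSeriesAt p.sum p 0 := hpU.hasFPowerSeriesAt
  have hU0 : p.sum 0 = 0 := by
    rw [← hU.coeff_zero fun _ => 0, hp, fixedSeries_zero]
    rfl
  have hUd : fderiv ℂ p.sum 0 = ContinuousLinearMap.id ℂ (Y × W) := by
    rw [hU.fderiv_eq, hp, fixedSeries_one, LinearIsometryEquiv.apply_symm_apply]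
  have hcomp : HasFPowerSeriesAt ((ContinuousLinearMap.inr ℂ Y W ∘ q) ∘ p.sum) (Q.comp p) 0 :=
    HasFPowerSeriesAt.comp (by rwa [hU0]) hU
  have hrec : ∀ (d : ℕ) (z : Y × W), 2 ≤ d → (d : ℂ) • p d (fun _ => z) - p d (fun _ => z) =
      Q.comp p d fun _ => z := by
    intro d z hd
    have hne : (d : ℂ) - 1 ≠ 0 := by
      rw [sub_ne_zero]
      exact_mod_cast (by omega : d ≠ 1)
    conv_lhs => rw [hp, fixedSeries_of_two_le _ hQ1 hd, eulerMultiplier]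
    rw [smul_apply, ← hp]
    conv_lhs =>
      rhs
      rw [← one_smul ℂ (((d : ℂ) - 1)⁻¹ • Q.comp p d fun _ => z)]
    rw [← sub_smul, smul_inv_smul₀ hne]
  -- All terms of order at least two lie in the factor `W`, so the first component of `U` remains
  -- the coordinate itself.
  have hfst : ∀ᶠ z in 𝓝 (0 : Y × W), (p.sum z).1 = z.1 := by
    filter_upwards [hU.eventually_hasSum] with z hz
    rw [zero_add] at hz
    have h1 := (ContinuousLinearMap.fst ℂ Y W).hasSum hz
    refine h1.unique ?_
    have h2 := hasSum_single (f := fun d => ContinuousLinearMap.fst ℂ Y W (p d fun _ => z)) 1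
      (fun d hd => ?_)
    · convert h2 using 1
      rw [hp, fixedSeries_one]
      rfl
    · match d, hd with
      | 0, _ => rw [hp, fixedSeries_zero]; simp
      | d + 2, _ =>
        rw [hp, fixedSeries_of_two_le _ hQ1 (by omega), eulerMultiplier, smul_apply,
          comp_apply_of_coeff_one_eq_zero (by omega) hQ1, map_smul, map_sum,
          Finset.sum_eq_zero, smul_zero]
        intro c _
        simp [hQdef]
  have heuler : ∀ᶠ z in 𝓝 (0 : Y × W), fderiv ℂ p.sum z z - p.sum z =
      ContinuousLinearMap.inr ℂ Y W (q (p.sum z)) := by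
    have hd : HasFPowerSeriesAt (fderiv ℂ p.sum) p.derivSeries 0 := ⟨_, hpU.fderiv⟩
    filter_upwards [hd.eventually_hasSum, hU.eventually_hasSum, hcomp.eventually_hasSum]
      with z h1 h2 h3
    rw [zero_add] at h1 h2 h3
    have h4 := (ContinuousLinearMap.apply ℂ (Y × W) z).hasSum h1
    have h5 : HasSum (fun d : ℕ => (d : ℂ) • p d fun _ => z) (fderiv ℂ p.sum z z) := by
      rw [← hasSum_nat_add_iff' 1]
      simp only [Finset.range_one, Finset.sum_singleton, Nat.cast_zero, zero_smul, sub_zero]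
      refine h4.congr_fun fun d => ?_
      simp only [ContinuousLinearMap.apply_apply]
      rw [p.derivSeries_apply_diag, ← Nat.cast_smul_eq_nsmul ℂ]
    refine (h5.sub h2).unique (h3.congr_fun fun d => ?_)
    match d with
    | 0 =>
      have e1 : p 0 = 0 := by rw [hp, fixedSeries_zero]
      have e2 : (Q.comp p 0 fun _ => z) = 0 := by
        rw [FormalMultilinearSeries.comp_coeff_zero _ _ _ (fun _ => 0), hQ0]
        rfl
      rw [e1, e2]; simp
    | 1 =>
      have e2 : (Q.comp p 1 fun _ => z) = 0 := by
        rw [FormalMultilinearSeries.comp_coeff_one, hQ1]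
        rfl
      rw [e2]; simp
    | d + 2 => exact hrec _ z (by omega)
  refine ⟨fun z => (p.sum z).2, ?_, ?_, ?_, ?_⟩
  · exact (ContinuousLinearMap.snd ℂ Y W).analyticAt _ |>.comp hU.analyticAt
  · simp [hU0]
  · have := ((ContinuousLinearMap.snd ℂ Y W).hasFDerivAt (x := p.sum 0)).comp 0
      hU.differentiableAt.hasFDerivAt
    rw [hUd] at this
    exact this.fderiv
  · filter_upwards [hfst, heuler, hU.analyticAt.eventually_analyticAt] with z h1 h2 h3
    have h4 := ((ContinuousLinearMap.snd ℂ Y W).hasFDerivAt (x := p.sum z)).comp z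
      h3.differentiableAt.hasFDerivAt
    have h5 : fderiv ℂ (fun z => (p.sum z).2) z z = (fderiv ℂ p.sum z z).2 := by
      rw [HasFDerivAt.fderiv (f := fun z => (p.sum z).2) h4]
      rfl
    have h6 := congrArg Prod.snd h2
    rw [h5, ← h1]
    simpa using h6

/-- Existence for linear radial differential equations: the parallel frame of a connection with
matrix `Γ` along the Euler field. -/
theorem exists_radial_frame [CompleteSpace Y] [CompleteSpace W] {Γ : Y → W →L[ℂ] W}
    (hΓ : AnalyticAt ℂ Γ 0) (hΓ0 : Γ 0 = 0) :
    ∃ a : Y → W →L[ℂ] W, AnalyticAt ℂ a 0 ∧ a 0 = ContinuousLinearMap.id ℂ W ∧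
      ∀ᶠ y in 𝓝 0, fderiv ℂ a y y = -(Γ y ∘L a y) := by
  -- The frame will be `a(y) = ∂u/∂w (y, 0)`, where `u` solves `du(z) z - u(z) = -Γ(y) u(z)`. The
  -- assumption `Γ 0 = 0` makes `q` vanish to second order.
  set q : Y × W → W := fun z => -(Γ z.1 z.2) with hqdef
  have hΓ1 : AnalyticAt ℂ (fun z : Y × W => Γ z.1) 0 :=
    AnalyticAt.comp (g := Γ) (f := fun z : Y × W => z.1) hΓ analyticAt_fst
  have hq : AnalyticAt ℂ q 0 := (analyticAt_clm_apply hΓ1 analyticAt_snd).neg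
  have hqd : fderiv ℂ q 0 = 0 := by
    have h := (hΓ1.differentiableAt.hasFDerivAt).clm_apply
      ((ContinuousLinearMap.snd ℂ Y W).hasFDerivAt (x := 0))
    rw [HasFDerivAt.fderiv (f := q) h.neg]
    ext v <;> simp [hΓ0]
  obtain ⟨u, hu, hu0, hud, hue⟩ := exists_euler_solution hq (by simp [hqdef]) hqd
  set B := fderiv ℂ u with hB
  have hBan : AnalyticAt ℂ B 0 := hu.fderiv
  set ι : Y → Y × W := fun y => (y, 0) with hι
  have hιan : AnalyticAt ℂ ι 0 := (ContinuousLinearMap.inl ℂ Y W).analyticAt 0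
  have hB' : AnalyticAt ℂ (fun y => B (ι y)) 0 := AnalyticAt.comp (g := B) hBan hιan
  have hιt : Tendsto ι (𝓝 0) (𝓝 0) := hιan.continuousAt.tendsto
  refine ⟨fun y => (B (ι y)).comp (ContinuousLinearMap.inr ℂ Y W), ?_, ?_, ?_⟩
  · exact ((ContinuousLinearMap.compL ℂ W (Y × W) W).flip
      (ContinuousLinearMap.inr ℂ Y W)).analyticAt _ |>.comp hB'
  · ext w
    change fderiv ℂ u (0, 0) (0, w) = w
    change B 0 (0, w) = w
    rw [hud]
    rfl
  · have hne := hιt.eventually ((hue.eventually_nhds.and hu.eventually_analyticAt).and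
      (hBan.eventually_analyticAt.and hΓ1.eventually_analyticAt))
    filter_upwards [hne] with y ⟨⟨h1, h2⟩, h3, h4⟩
    have hd : fderiv ℂ (fun y => (B (ι y)).comp (ContinuousLinearMap.inr ℂ Y W)) y y =
        (fderiv ℂ B (ι y) (ι y)).comp (ContinuousLinearMap.inr ℂ Y W) := by
      have e1 : HasFDerivAt ι (ContinuousLinearMap.inl ℂ Y W) y :=
        (ContinuousLinearMap.inl ℂ Y W).hasFDerivAt
      have e2 := (h3.differentiableAt.hasFDerivAt).comp y e1
      have e3 := ((ContinuousLinearMap.compL ℂ W (Y × W) W).flip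
        (ContinuousLinearMap.inr ℂ Y W)).hasFDerivAt.comp y e2
      rw [HasFDerivAt.fderiv
        (f := fun y => (B (ι y)).comp (ContinuousLinearMap.inr ℂ Y W)) e3]
      rfl
    rw [hd]
    ext w
    set z := ι y with hz
    set v : Y × W := (0, w) with hv
    -- Differentiate the equation for `u` in the direction `(0, w)`. The derivative of `z` in `du(z)
    -- z` cancels against that of `-u`, and the symmetry of the second derivative turns the rest
    -- into the radial equation for `B`.
    have hsymm : fderiv ℂ B z z v = fderiv ℂ B z v z :=
      (h2.contDiffAt (n := ⊤)).isSymmSndFDerivAt (by simp) z v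
    have l1 : HasFDerivAt (fun z => B z z - u z)
        ((B z).comp (ContinuousLinearMap.id ℂ (Y × W)) + (fderiv ℂ B z).flip z - B z) z :=
      ((h3.differentiableAt.hasFDerivAt).clm_apply (hasFDerivAt_id z)).sub
        h2.differentiableAt.hasFDerivAt
    have l2 := ((h4.differentiableAt.hasFDerivAt).clm_apply
      (h2.differentiableAt.hasFDerivAt)).neg
    have hΓd : fderiv ℂ (fun z : Y × W => Γ z.1) z v = 0 := by
      have hΓy : DifferentiableAt ℂ Γ y := by
        have e1 : DifferentiableAt ℂ ι y := (ContinuousLinearMap.inl ℂ Y W).differentiableAt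
        exact DifferentiableAt.comp (g := fun z : Y × W => Γ z.1) (f := ι) y
          h4.differentiableAt e1
      have := (HasFDerivAt.comp (g := Γ) (f := fun z : Y × W => z.1) z hΓy.hasFDerivAt
        hasFDerivAt_fst)
      rw [HasFDerivAt.fderiv (f := fun z : Y × W => Γ z.1) this]
      simp [hv]
    have l3 := l1.congr_of_eventuallyEq (f₁ := fun z => -(Γ z.1 (u z)))
      (h1.mono fun z hz => hz.symm)
    have l4 := DFunLike.congr_fun (l3.unique l2) v
    simp only [add_apply, sub_apply, neg_apply, ContinuousLinearMap.comp_apply,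
      ContinuousLinearMap.flip_apply, ContinuousLinearMap.id_apply, hΓd, zero_apply,
      add_zero] at l4
    change fderiv ℂ B z z v = -(Γ y (B z v))
    rw [hsymm]
    simpa [hz, hι] using l4

end RadialEquation

/-! ### Gauge change making the normal derivative constant. -/

section Straightening

variable {E F X Y : Type*} [NormedAddCommGroup E] [NormedSpace ℂ E] [NormedAddCommGroup F]
  [NormedSpace ℂ F] [NormedAddCommGroup X] [NormedSpace ℂ X] [NormedAddCommGroup Y]
  [NormedSpace ℂ Y]

theorem analyticAt_clm_comp {G : Type*} [NormedAddCommGroup G] [NormedSpace ℂ G]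
    {H : Type*} [NormedAddCommGroup H] [NormedSpace ℂ H]
    {c : E → F →L[ℂ] G} {u : E → H →L[ℂ] F} {x : E}
    (hc : AnalyticAt ℂ c x) (hu : AnalyticAt ℂ u x) : AnalyticAt ℂ (fun y => c y ∘L u y) x :=
  ((ContinuousLinearMap.compL ℂ H F G).analyticAt_bilinear (c x, u x)).comp₂ hc hu

/-- Inverse function theorem for analytic germs. -/
theorem exists_analytic_inverse [CompleteSpace E] [CompleteSpace F] {Φ : E → F} {e : E ≃L[ℂ] F}
    (hΦ : AnalyticAt ℂ Φ 0) (h0 : Φ 0 = 0) (he : HasFDerivAt Φ (e : E →L[ℂ] F) 0) :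
    ∃ G : F → E, AnalyticAt ℂ G 0 ∧ G 0 = 0 ∧ (∀ᶠ z in 𝓝 0, G (Φ z) = z) ∧
      ∀ᶠ z in 𝓝 0, Φ (G z) = z := by
  have hs : HasStrictFDerivAt Φ (e : E →L[ℂ] F) 0 := by
    have := hΦ.hasStrictFDerivAt
    rwa [he.fderiv] at this
  have hmem := hs.mem_toOpenPartialHomeomorph_source
  have hG := (hs.toOpenPartialHomeomorph Φ).analyticAt_symm' hmem hΦ he.fderiv
  rw [hs.toOpenPartialHomeomorph_coe, h0] at hG
  refine ⟨(hs.toOpenPartialHomeomorph Φ).symm, hG, ?_, ?_, ?_⟩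
  · have := (hs.toOpenPartialHomeomorph Φ).left_inv hmem
    rwa [hs.toOpenPartialHomeomorph_coe, h0] at this
  · have := (hs.toOpenPartialHomeomorph Φ).eventually_left_inverse hmem
    rwa [hs.toOpenPartialHomeomorph_coe] at this
  · have h1 : (0 : F) ∈ (hs.toOpenPartialHomeomorph Φ).target := by
      have := (hs.toOpenPartialHomeomorph Φ).map_source hmem
      rwa [hs.toOpenPartialHomeomorph_coe, h0] at this
    have := (hs.toOpenPartialHomeomorph Φ).eventually_right_inverse h1
    rwa [hs.toOpenPartialHomeomorph_coe] at this

/-- The action of the differential on the normal directions along `{0} × Y`. -/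
noncomputable def normalPart (h : X × Y → X × Y) (y : Y) : X →L[ℂ] X :=
  ContinuousLinearMap.fst ℂ X Y ∘L fderiv ℂ h (0, y) ∘L ContinuousLinearMap.inl ℂ X Y

theorem tendsto_zero_prod : Tendsto (fun y : Y => ((0 : X), y)) (𝓝 0) (𝓝 0) :=
  ((ContinuousLinearMap.inr ℂ X Y).continuous.tendsto' 0 0 (map_zero _))

theorem AnalyticAt.comp_zero_prod {c : X × Y → F} (hc : AnalyticAt ℂ c 0) :
    AnalyticAt ℂ (fun y : Y => c (0, y)) 0 :=
  AnalyticAt.comp (g := c) (f := fun y : Y => ((0 : X), y)) hc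
    ((ContinuousLinearMap.inr ℂ X Y).analyticAt 0)

theorem analyticAt_normalPart [CompleteSpace X] [CompleteSpace Y] {h : X × Y → X × Y}
    (hh : AnalyticAt ℂ h 0) : AnalyticAt ℂ (normalPart h) 0 :=
  analyticAt_clm_comp analyticAt_const (analyticAt_clm_comp hh.fderiv.comp_zero_prod
    analyticAt_const)

/-- If `{0} × Y` is invariant, the normal component of the differential along it only depends on
the normal component of the vector. -/
theorem fst_fderiv_eq_normalPart [CompleteSpace X] [CompleteSpace Y] {h : X × Y → X × Y} (hh : AnalyticAt ℂ h 0) {μ : Y →L[ℂ] Y}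
    (hinv : ∀ᶠ y in 𝓝 (0 : Y), h (0, y) = (0, μ y)) :
    ∀ᶠ y in 𝓝 (0 : Y), ∀ v, (fderiv ℂ h (0, y) v).1 = normalPart h y v.1 := by
  filter_upwards [hinv.eventually_nhds, tendsto_zero_prod.eventually hh.eventually_analyticAt]
    with y hy hd v
  have h1 : HasFDerivAt (fun y : Y => h (0, y))
      (fderiv ℂ h (0, y) ∘L ContinuousLinearMap.inr ℂ X Y) y :=
    HasFDerivAt.comp y (g := h) (f := fun y : Y => ((0 : X), y)) hd.differentiableAt.hasFDerivAt
      (ContinuousLinearMap.inr ℂ X Y).hasFDerivAt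
  have h2 : HasFDerivAt (fun y : Y => h (0, y)) (ContinuousLinearMap.inr ℂ X Y ∘L μ) y :=
    ((ContinuousLinearMap.inr ℂ X Y ∘L μ).hasFDerivAt).congr_of_eventuallyEq hy
  have h3 := DFunLike.congr_fun (h1.unique h2) v.2
  have hv : v = ContinuousLinearMap.inl ℂ X Y v.1 + ContinuousLinearMap.inr ℂ X Y v.2 := by
    ext <;> simp
  conv_lhs => rw [hv, map_add]
  simp only [ContinuousLinearMap.comp_apply] at h3
  rw [h3]
  simp [normalPart]

/-- A gauge transformation making the normal derivative constant along the invariant subspace, in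
the presence of a connection along the Euler field which commutes with the germ. -/
theorem exists_straightening [CompleteSpace X] [CompleteSpace Y] {h : X × Y → X × Y}
    (hh : AnalyticAt ℂ h 0) {μ : Y →L[ℂ] Y} {Λ : X →L[ℂ] X}
    (hinv : ∀ᶠ y in 𝓝 (0 : Y), h (0, y) = (0, μ y)) (hd0 : fderiv ℂ h 0 = Λ.prodMap μ)
    {Γ : Y → X →L[ℂ] X} (hΓ : AnalyticAt ℂ Γ 0) (hΓ0 : Γ 0 = 0)
    (hcomm : ∀ᶠ y in 𝓝 0, fderiv ℂ (normalPart h) y y =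
      normalPart h y ∘L Γ y - Γ (μ y) ∘L normalPart h y) :
    ∃ S S' : X × Y → X × Y, AnalyticAt ℂ S 0 ∧ S 0 = 0 ∧
      HasFDerivAt S (ContinuousLinearMap.id ℂ (X × Y)) 0 ∧ AnalyticAt ℂ S' 0 ∧ S' 0 = 0 ∧
      (∀ᶠ z in 𝓝 0, S' (S z) = z) ∧ (∀ᶠ z in 𝓝 0, S (S' z) = z) ∧
      (∀ᶠ y in 𝓝 (0 : Y), S' (h (S (0, y))) = (0, μ y)) ∧
      (∀ᶠ y in 𝓝 (0 : Y), ∀ v, (fderiv ℂ (fun z => S' (h (S z))) (0, y) v).1 = Λ v.1) ∧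
      fderiv ℂ (fun z => S' (h (S z))) 0 = Λ.prodMap μ := by
  have h00 : h 0 = 0 := by
    have := hinv.self_of_nhds
    rwa [map_zero] at this
  set A := normalPart h with hA
  have hAan : AnalyticAt ℂ A 0 := analyticAt_normalPart hh
  have hA0 : A 0 = Λ := by
    ext x
    change (fderiv ℂ h 0 (x, 0)).1 = Λ x
    rw [hd0]
    rfl
  have hμt : Tendsto μ (𝓝 0) (𝓝 0) := μ.continuous.tendsto' 0 0 (map_zero _)
  obtain ⟨a, ha, ha0, hae⟩ := exists_radial_frame hΓ hΓ0
  have haμ : AnalyticAt ℂ (fun y => a (μ y)) 0 :=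
    AnalyticAt.comp (g := a) (by rwa [map_zero]) (μ.analyticAt 0)
  have hΓμ : AnalyticAt ℂ (fun y => Γ (μ y)) 0 :=
    AnalyticAt.comp (g := Γ) (by rwa [map_zero]) (μ.analyticAt 0)
  -- the frame transported by the germ is again parallel
  have hgauge : ∀ᶠ y in 𝓝 0, A y ∘L a y = a (μ y) ∘L Λ := by
    set b : Y → X →L[ℂ] X := fun y => A y ∘L a y - a (μ y) ∘L Λ with hb
    have hban : AnalyticAt ℂ b 0 :=
      (analyticAt_clm_comp hAan ha).sub (analyticAt_clm_comp haμ analyticAt_const)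
    have hb0 : b 0 = 0 := by
      simp only [hb, map_zero, ha0, hA0]
      ext x
      simp
    obtain ⟨C, hC⟩ := (hΓμ.differentiableAt.isBigO_sub).bound
    -- The two terms `A Γ a` cancel in the derivative of `A a`. For `a ∘ μ` the linearity of `μ` is
    -- used: the derivative of `a` at `μ y` is taken in the direction `μ y`, where the frame
    -- equation applies.
    have hbd : ∀ᶠ y in 𝓝 0, fderiv ℂ b y y = -(Γ (μ y) ∘L b y) := by
      filter_upwards [hae, hμt.eventually hae, hcomm, hAan.eventually_analyticAt,
        ha.eventually_analyticAt, hμt.eventually ha.eventually_analyticAt]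
        with y e1 e2 e3 d1 d2 d3
      have k1 := d1.differentiableAt.hasFDerivAt.clm_comp d2.differentiableAt.hasFDerivAt
      have k2 := (HasFDerivAt.comp y (g := a) d3.differentiableAt.hasFDerivAt
        μ.hasFDerivAt).clm_comp (hasFDerivAt_const Λ y)
      have k3 := k1.sub k2
      rw [HasFDerivAt.fderiv (f := b) k3]
      ext x
      have e1' := DFunLike.congr_fun e1 x
      have e2' := DFunLike.congr_fun e2 (Λ x)
      have e3' := DFunLike.congr_fun e3 (a y x)
      simp only [sub_apply, neg_apply, ContinuousLinearMap.comp_apply] at e1' e2' e3'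
      simp [hb, e1', e2', e3']
      abel
    have := eventually_eq_zero_of_radial_bound hban hb0 (C := C) (by
      filter_upwards [hbd, hC] with y e1 e2
      rw [e1, norm_neg]
      rw [map_zero, hΓ0, sub_zero, sub_zero] at e2
      exact (ContinuousLinearMap.opNorm_comp_le _ _).trans
        (mul_le_mul_of_nonneg_right e2 (norm_nonneg _)))
    filter_upwards [this] with y hy
    exact sub_eq_zero.1 hy
  -- `S` is the identity on `{0} × Y`, so the restriction of `h` stays linear, while the normal
  -- derivative becomes `a(μ y)⁻¹ A(y) a(y) = Λ`.
  set S : X × Y → X × Y := fun z => (a z.2 z.1, z.2) with hS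
  have ha2 : AnalyticAt ℂ (fun z : X × Y => a z.2) 0 :=
    AnalyticAt.comp (g := a) (f := fun z : X × Y => z.2) ha analyticAt_snd
  have hSan : AnalyticAt ℂ S 0 := (analyticAt_clm_apply ha2 analyticAt_fst).prod analyticAt_snd
  have hSz : ∀ y, S (0, y) = (0, y) := fun y => by simp [hS]
  have hS0 : S 0 = 0 := hSz 0
  have hSd : ∀ᶠ y in 𝓝 (0 : Y), ∀ v, fderiv ℂ S (0, y) v = (a y v.1, v.2) := by
    filter_upwards [tendsto_zero_prod.eventually ha2.eventually_analyticAt] with y hy v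
    have k := (hy.differentiableAt.hasFDerivAt.clm_apply hasFDerivAt_fst).prodMk
      (hasFDerivAt_snd (𝕜 := ℂ) (p := ((0 : X), y)))
    rw [HasFDerivAt.fderiv (f := S) k]
    simp
  have hSd0 : HasFDerivAt S (ContinuousLinearMap.id ℂ (X × Y)) 0 := by
    have h2 : fderiv ℂ S 0 = ContinuousLinearMap.id ℂ (X × Y) := by
      refine ContinuousLinearMap.ext fun v => ?_
      have h1 := hSd.self_of_nhds v
      rw [show ((0 : X), (0 : Y)) = 0 from rfl, ha0] at h1
      rw [h1]
      rfl
    rw [← h2]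
    exact hSan.differentiableAt.hasFDerivAt
  obtain ⟨S', hS'an, hS'0, hS'S, hSS'⟩ :=
    exists_analytic_inverse (e := ContinuousLinearEquiv.refl ℂ (X × Y)) hSan hS0 hSd0
  have hS'z : ∀ᶠ y in 𝓝 (0 : Y), S' (0, y) = (0, y) := by
    filter_upwards [tendsto_zero_prod.eventually hS'S] with y hy
    rwa [hSz] at hy
  set k : X × Y → X × Y := fun z => S' (h (S z)) with hk
  have hhS : AnalyticAt ℂ (fun z => h (S z)) 0 := AnalyticAt.comp (g := h) (by rwa [hS0]) hSan
  have hkan : AnalyticAt ℂ k 0 :=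
    AnalyticAt.comp (g := S') (f := fun z => h (S z)) (by rwa [hS0, h00]) hhS
  have hkz : ∀ᶠ y in 𝓝 (0 : Y), k (0, y) = (0, μ y) := by
    filter_upwards [hinv, hμt.eventually hS'z] with y h1 h2
    simp only [hk]
    rw [hSz, h1, h2]
  have hhSt : Tendsto (fun z => h (S z)) (𝓝 0) (𝓝 0) := by
    have := hhS.continuousAt.tendsto
    rwa [hS0, h00] at this
  have hconj : ∀ᶠ z in 𝓝 0, S (k z) = h (S z) := hhSt.eventually hSS'
  have hfd : ∀ᶠ y in 𝓝 (0 : Y), ∀ v, fderiv ℂ S (0, μ y) (fderiv ℂ k (0, y) v) =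
      fderiv ℂ h (0, y) (fderiv ℂ S (0, y) v) := by
    filter_upwards [tendsto_zero_prod.eventually hconj.eventually_nhds, hkz,
      tendsto_zero_prod.eventually hkan.eventually_analyticAt,
      tendsto_zero_prod.eventually hSan.eventually_analyticAt,
      hμt.eventually (tendsto_zero_prod.eventually hSan.eventually_analyticAt),
      tendsto_zero_prod.eventually hh.eventually_analyticAt] with y e1 e2 d1 d2 d3 d4 v
    have l1 := HasFDerivAt.comp (g := S) (f := k) ((0 : X), y)
      (by rw [e2]; exact d3.differentiableAt.hasFDerivAt) d1.differentiableAt.hasFDerivAt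
    have l2 := HasFDerivAt.comp (g := h) (f := S) ((0 : X), y)
      (by rw [hSz]; exact d4.differentiableAt.hasFDerivAt) d2.differentiableAt.hasFDerivAt
    have l3 := l1.congr_of_eventuallyEq (f₁ := h ∘ S) (e1.mono fun z hz => hz.symm)
    exact (DFunLike.congr_fun (l3.unique l2) v)
  -- Near the origin `a (μ y)` is close to the identity, hence invertible; injectivity is enough to
  -- cancel it.
  have hinj : ∀ᶠ y in 𝓝 (0 : Y), Function.Injective (a (μ y)) := by
    have h1 := (ContinuousLinearEquiv.refl ℂ X).nhds
    have h2 : Tendsto (fun y => a (μ y)) (𝓝 0) (𝓝 ((ContinuousLinearEquiv.refl ℂ X : X ≃L[ℂ] X) :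
        X →L[ℂ] X)) := by
      have := haμ.continuousAt.tendsto
      rw [map_zero, ha0] at this
      exact this
    filter_upwards [h2.eventually h1] with y hy
    obtain ⟨e, he⟩ := hy
    rw [← he]
    exact e.injective
  have hnormal : ∀ᶠ y in 𝓝 (0 : Y), ∀ v, (fderiv ℂ k (0, y) v).1 = Λ v.1 := by
    filter_upwards [hfd, hinj, hSd, hμt.eventually hSd, hgauge, fst_fderiv_eq_normalPart hh hinv]
      with y e1 e2 e3 e4 e5 e6 v
    have l1 := congrArg Prod.fst (e1 v)
    rw [e4, e3, e6] at l1
    exact e2 (l1.trans (DFunLike.congr_fun e5 v.1))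
  refine ⟨S, S', hSan, hS0, hSd0, hS'an, hS'0, hS'S, hSS', hkz, hnormal, ?_⟩
  refine ContinuousLinearMap.ext fun v => ?_
  have l1 := hfd.self_of_nhds v
  rw [map_zero, show ((0 : X), (0 : Y)) = 0 from rfl, hSd0.fderiv, hd0] at l1
  exact l1

end Straightening

/-! ### Normal frames and connection forms. -/

namespace SubmanifoldGerm

variable {n r s : ℕ}

/-- A holomorphic frame of the normal bundle of `M`: a family `N y` of surjections with kernel the
tangent space, with a holomorphic section `C`. -/
structure IsNormalFrame (M : SubmanifoldGerm n r)
    (N : (Fin r → ℂ) → (Fin n → ℂ) →L[ℂ] (Fin s → ℂ))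
    (C : (Fin r → ℂ) → (Fin s → ℂ) →L[ℂ] (Fin n → ℂ)) : Prop where
  analyticAt_proj : AnalyticAt ℂ N 0
  analyticAt_section : AnalyticAt ℂ C 0
  proj_section : ∀ᶠ y in 𝓝 0, ∀ x, N y (C y x) = x
  mem_iff : ∀ᶠ y in 𝓝 0, ∀ v, v ∈ M.tangentSpace y ↔ N y v = 0

/-- A tubular chart of the ambient space along `M` induces a normal frame. -/
theorem isNormalFrame_of_chart (M : SubmanifoldGerm n r)
    {Φ : (Fin s → ℂ) × (Fin r → ℂ) → Fin n → ℂ} {G : (Fin n → ℂ) → (Fin s → ℂ) × (Fin r → ℂ)}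
    (hΦ : AnalyticAt ℂ Φ 0) (hΦ0 : Φ 0 = 0) (hG : AnalyticAt ℂ G 0)
    (hGΦ : ∀ᶠ z in 𝓝 0, G (Φ z) = z) (hΦG : ∀ᶠ z in 𝓝 0, Φ (G z) = z)
    (hM : ∀ y, M.param y = Φ (0, y)) :
    M.IsNormalFrame
      (fun y => ContinuousLinearMap.fst ℂ (Fin s → ℂ) (Fin r → ℂ) ∘L fderiv ℂ G (M.param y))
      (fun y => fderiv ℂ Φ (0, y) ∘L ContinuousLinearMap.inl ℂ (Fin s → ℂ) (Fin r → ℂ)) := by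
  have hΦt : Tendsto Φ (𝓝 0) (𝓝 0) := by
    have := hΦ.continuousAt.tendsto
    rwa [hΦ0] at this
  have hG0 : G 0 = 0 := by
    have := hGΦ.self_of_nhds
    rwa [hΦ0] at this
  have hcomp : ∀ᶠ z in 𝓝 0, ∀ v, fderiv ℂ G (Φ z) (fderiv ℂ Φ z v) = v := by
    filter_upwards [hΦ.eventually_analyticAt, hΦt.eventually hG.eventually_analyticAt,
      hGΦ.eventually_nhds] with z d1 d2 e v
    have k := HasFDerivAt.comp z d2.differentiableAt.hasFDerivAt d1.differentiableAt.hasFDerivAt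
    have k2 := (hasFDerivAt_id (𝕜 := ℂ) z).congr_of_eventuallyEq (f₁ := G ∘ Φ) e
    exact DFunLike.congr_fun (k.unique k2) v
  have hcomp' : ∀ᶠ z in 𝓝 0, ∀ v, fderiv ℂ Φ z (fderiv ℂ G (Φ z) v) = v := by
    filter_upwards [hΦ.eventually_analyticAt, hΦt.eventually hG.eventually_analyticAt,
      hΦt.eventually hΦG.eventually_nhds, hGΦ] with z d1 d2 e e2 v
    have k := HasFDerivAt.comp (Φ z) (g := Φ) (f := G) (by
      rw [e2]; exact d1.differentiableAt.hasFDerivAt) d2.differentiableAt.hasFDerivAt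
    have k2 := (hasFDerivAt_id (𝕜 := ℂ) (Φ z)).congr_of_eventuallyEq (f₁ := Φ ∘ G) e
    exact DFunLike.congr_fun (k.unique k2) v
  refine ⟨?_, ?_, ?_, ?_⟩
  · refine analyticAt_clm_comp analyticAt_const ?_
    refine AnalyticAt.comp (g := fderiv ℂ G) ?_ M.analyticAt_param
    rw [M.param_zero]
    exact hG.fderiv
  · exact analyticAt_clm_comp hΦ.fderiv.comp_zero_prod analyticAt_const
  · filter_upwards [tendsto_zero_prod.eventually hcomp] with y e x
    have := congrArg Prod.fst (e (x, 0))
    simpa [hM] using this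
  · filter_upwards [tendsto_zero_prod.eventually hcomp, tendsto_zero_prod.eventually hcomp',
      tendsto_zero_prod.eventually hΦ.eventually_analyticAt] with y e e' d v
    have hp : HasFDerivAt M.param
        (fderiv ℂ Φ (0, y) ∘L ContinuousLinearMap.inr ℂ (Fin s → ℂ) (Fin r → ℂ)) y := by
      have := HasFDerivAt.comp y (g := Φ) (f := fun y : Fin r → ℂ => ((0 : Fin s → ℂ), y))
        d.differentiableAt.hasFDerivAt
        (ContinuousLinearMap.inr ℂ (Fin s → ℂ) (Fin r → ℂ)).hasFDerivAt
      rwa [show M.param = Φ ∘ fun y : Fin r → ℂ => ((0 : Fin s → ℂ), y) from funext hM]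
    simp only [tangentSpace, hp.fderiv, hM, LinearMap.mem_range, ContinuousLinearMap.coe_coe,
      ContinuousLinearMap.comp_apply]
    constructor
    · rintro ⟨u, rfl⟩
      rw [e]
      rfl
    · intro h
      refine ⟨(fderiv ℂ G (Φ (0, y)) v).2, ?_⟩
      have : ContinuousLinearMap.inr ℂ (Fin s → ℂ) (Fin r → ℂ) (fderiv ℂ G (Φ (0, y)) v).2 =
          fderiv ℂ G (Φ (0, y)) v := Prod.ext h.symm rfl
      rw [this, e']

namespace IsNormalFrame

variable {M : SubmanifoldGerm n r} {N : (Fin r → ℂ) → (Fin n → ℂ) →L[ℂ] (Fin s → ℂ)}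
  {C : (Fin r → ℂ) → (Fin s → ℂ) →L[ℂ] (Fin n → ℂ)}

theorem normalEq_iff (F : M.IsNormalFrame N C) {V W : (Fin r → ℂ) → (Fin n → ℂ)} :
    M.NormalEq V W ↔ ∀ᶠ y in 𝓝 0, N y (V y) = N y (W y) := by
  refine eventually_congr ?_
  filter_upwards [F.mem_iff] with y hy
  rw [hy, map_sub, sub_eq_zero]

/-- The action of `df` on the normal bundle, in a normal frame. -/
noncomputable def normalMap (M : SubmanifoldGerm n r)
    (N : (Fin r → ℂ) → (Fin n → ℂ) →L[ℂ] (Fin s → ℂ))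
    (C : (Fin r → ℂ) → (Fin s → ℂ) →L[ℂ] (Fin n → ℂ)) (f : (Fin n → ℂ) → (Fin n → ℂ))
    (y : Fin r → ℂ) : (Fin s → ℂ) →L[ℂ] (Fin s → ℂ) :=
  N (M.restrict f y) ∘L fderiv ℂ f (M.param y) ∘L C y

variable {f : (Fin n → ℂ) → (Fin n → ℂ)}

/-- By invariance `df` maps tangent vectors of `M` to tangent vectors, which `N` kills. Since `v - C
y (N y v)` is tangent, only `N y v` matters. -/
theorem proj_fderiv (F : M.IsNormalFrame N C) (hf : AnalyticAt ℂ f 0)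
    (hg : AnalyticAt ℂ (M.restrict f) 0) (hg0 : M.restrict f 0 = 0)
    (hfp : ∀ᶠ y in 𝓝 0, f (M.param y) = M.param (M.restrict f y)) :
    ∀ᶠ y in 𝓝 0, ∀ v, N (M.restrict f y) (fderiv ℂ f (M.param y) v) =
      normalMap M N C f y (N y v) := by
  have hgt : Tendsto (M.restrict f) (𝓝 0) (𝓝 0) := by
    have := hg.continuousAt.tendsto
    rwa [hg0] at this
  have hpt : Tendsto M.param (𝓝 0) (𝓝 0) := by
    have := M.analyticAt_param.continuousAt.tendsto
    rwa [M.param_zero] at this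
  filter_upwards [hfp.eventually_nhds, F.mem_iff, hgt.eventually F.mem_iff, F.proj_section,
    M.analyticAt_param.eventually_analyticAt, hg.eventually_analyticAt,
    hgt.eventually M.analyticAt_param.eventually_analyticAt,
    hpt.eventually hf.eventually_analyticAt] with y e m1 m2 hC d1 d2 d3 d4 v
  have k1 := HasFDerivAt.comp y (g := f) (f := M.param) d4.differentiableAt.hasFDerivAt
    d1.differentiableAt.hasFDerivAt
  have k2 := (HasFDerivAt.comp y (g := M.param) (f := M.restrict f)
    d3.differentiableAt.hasFDerivAt d2.differentiableAt.hasFDerivAt).congr_of_eventuallyEq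
    (f₁ := f ∘ M.param) e
  have hT : v - C y (N y v) ∈ M.tangentSpace y := by
    rw [m1, map_sub, hC, sub_self]
  obtain ⟨u, hu⟩ := hT
  have h1 : fderiv ℂ f (M.param y) (v - C y (N y v)) ∈ M.tangentSpace (M.restrict f y) := by
    refine ⟨fderiv ℂ (M.restrict f) y u, ?_⟩
    rw [← hu]
    exact (DFunLike.congr_fun (k1.unique k2) u).symm
  rw [m2, map_sub, map_sub, sub_eq_zero] at h1
  exact h1

theorem sectionPushforward_iff (F : M.IsNormalFrame N C) (hf : AnalyticAt ℂ f 0)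
    (hg : AnalyticAt ℂ (M.restrict f) 0) (hg0 : M.restrict f 0 = 0)
    (hfp : ∀ᶠ y in 𝓝 0, f (M.param y) = M.param (M.restrict f y))
    {V W : (Fin r → ℂ) → (Fin n → ℂ)} :
    M.SectionPushforward f V W ↔ ∀ᶠ y in 𝓝 0, N (M.restrict f y) (W (M.restrict f y)) =
      normalMap M N C f y (N y (V y)) := by
  have hgt : Tendsto (M.restrict f) (𝓝 0) (𝓝 0) := by
    have := hg.continuousAt.tendsto
    rwa [hg0] at this
  refine eventually_congr ?_
  filter_upwards [hgt.eventually F.mem_iff, F.proj_fderiv hf hg hg0 hfp] with y hy e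
  rw [hy, map_sub, sub_eq_zero, e]

variable (D : M.NormalConnection)

theorem proj_cov_zero (F : M.IsNormalFrame N C) {X : (Fin r → ℂ) → (Fin r → ℂ)}
    (hX : AnalyticAt ℂ X 0) : ∀ᶠ y in 𝓝 0, N y (D.cov X (fun _ => 0) y) = 0 := by
  have h := D.add_section X (fun _ => 0) (fun _ => 0) hX analyticAt_const analyticAt_const
  rw [F.normalEq_iff] at h
  filter_upwards [h] with y hy
  simpa using hy

theorem proj_cov_zero_field (F : M.IsNormalFrame N C) {V : (Fin r → ℂ) → (Fin n → ℂ)}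
    (hV : AnalyticAt ℂ V 0) : ∀ᶠ y in 𝓝 0, N y (D.cov (fun _ => 0) V y) = 0 := by
  have h := D.add_field (fun _ => 0) (fun _ => 0) V analyticAt_const analyticAt_const hV
  rw [F.normalEq_iff] at h
  filter_upwards [h] with y hy
  simpa using hy

theorem proj_cov_sum (F : M.IsNormalFrame N C) {X : (Fin r → ℂ) → (Fin r → ℂ)}
    (hX : AnalyticAt ℂ X 0) {ι : Type*} (t : Finset ι) {v : ι → (Fin r → ℂ) → ℂ}
    {c : ι → (Fin r → ℂ) → (Fin n → ℂ)} (hv : ∀ i, AnalyticAt ℂ (v i) 0)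
    (hc : ∀ i, AnalyticAt ℂ (c i) 0) :
    ∀ᶠ y in 𝓝 0, N y (D.cov X (fun y => ∑ i ∈ t, v i y • c i y) y) =
      ∑ i ∈ t, (fderiv ℂ (v i) y (X y) • N y (c i y) + v i y • N y (D.cov X (c i) y)) := by
  classical
  induction t using Finset.induction_on with
  | empty => simpa using F.proj_cov_zero D hX
  | insert i t hi ih =>
    have h1 := D.add_section X (fun y => v i y • c i y) (fun y => ∑ i ∈ t, v i y • c i y) hX
      ((hv i).smul (hc i)) (Finset.analyticAt_fun_sum t fun j _ => (hv j).smul (hc j))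
    have h2 := D.leibniz (v i) X (c i) (hv i) hX (hc i)
    rw [F.normalEq_iff] at h1 h2
    filter_upwards [h1, h2, ih] with y e1 e2 e3
    simp only [Finset.sum_insert hi]
    rw [e1, map_add, e2, e3, map_add, map_smul, map_smul]

theorem proj_cov_sum_field (F : M.IsNormalFrame N C) {V : (Fin r → ℂ) → (Fin n → ℂ)}
    (hV : AnalyticAt ℂ V 0) {ι : Type*} (t : Finset ι) {v : ι → (Fin r → ℂ) → ℂ}
    {c : ι → (Fin r → ℂ) → (Fin r → ℂ)} (hv : ∀ i, AnalyticAt ℂ (v i) 0)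
    (hc : ∀ i, AnalyticAt ℂ (c i) 0) :
    ∀ᶠ y in 𝓝 0, N y (D.cov (fun y => ∑ i ∈ t, v i y • c i y) V y) =
      ∑ i ∈ t, v i y • N y (D.cov (c i) V y) := by
  classical
  induction t using Finset.induction_on with
  | empty => simpa using F.proj_cov_zero_field D hV
  | insert i t hi ih =>
    have h1 := D.add_field (fun y => v i y • c i y) (fun y => ∑ i ∈ t, v i y • c i y) V
      ((hv i).smul (hc i)) (Finset.analyticAt_fun_sum t fun j _ => (hv j).smul (hc j)) hV
    have h2 := D.smul_field (v i) (c i) V (hv i) (hc i) hV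
    rw [F.normalEq_iff] at h1 h2
    filter_upwards [h1, h2, ih] with y e1 e2 e3
    simp only [Finset.sum_insert hi]
    rw [e1, map_add, e2, e3, map_smul]

theorem analyticAt_apply_const {c : (Fin r → ℂ) → (Fin s → ℂ) →L[ℂ] (Fin n → ℂ)}
    (hc : AnalyticAt ℂ c 0) (x : Fin s → ℂ) : AnalyticAt ℂ (fun y => c y x) 0 :=
  analyticAt_clm_apply hc analyticAt_const

/-- The connection form, in a normal frame, of a connection along a field vanishing at the
origin. -/
theorem exists_connection_form (F : M.IsNormalFrame N C) {X : (Fin r → ℂ) → (Fin r → ℂ)}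
    (hX : AnalyticAt ℂ X 0) (hX0 : X 0 = 0) :
    ∃ Γ : (Fin r → ℂ) → (Fin s → ℂ) →L[ℂ] (Fin s → ℂ), AnalyticAt ℂ Γ 0 ∧ Γ 0 = 0 ∧
      ∀ v : (Fin r → ℂ) → (Fin s → ℂ), AnalyticAt ℂ v 0 →
        ∀ᶠ y in 𝓝 0, N y (D.cov X (fun y => C y (v y)) y) =
          fderiv ℂ v y (X y) + Γ y (v y) := by
  set c : Fin s → (Fin r → ℂ) → (Fin n → ℂ) := fun i y => C y (Pi.single i 1) with hc
  have hcan : ∀ i, AnalyticAt ℂ (c i) 0 := fun i =>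
    analyticAt_apply_const F.analyticAt_section _
  set q : Fin s → (Fin r → ℂ) → (Fin s → ℂ) := fun i y => N y (D.cov X (c i) y) with hq
  have hqan : ∀ i, AnalyticAt ℂ (q i) 0 := fun i =>
    analyticAt_clm_apply F.analyticAt_proj (D.analyticAt_cov X (c i) hX (hcan i))
  -- A connection is linear over functions in the field, and the components of `X` in the coordinate
  -- fields vanish at the origin. Hence so does the connection form along `X`.
  have hq0 : ∀ i, q i 0 = 0 := fun i => by
    have h := (F.proj_cov_sum_field D (hcan i) Finset.univ (v := fun a y => X y a)
      (c := fun a _ => Pi.single a 1) (fun a => (analyticAt_pi_iff.1 hX a))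
      (fun a => analyticAt_const)).self_of_nhds
    have hXs : (fun y => ∑ a, X y a • (Pi.single a 1 : Fin r → ℂ)) = X := by
      funext y
      exact (pi_eq_sum_univ' (X y)).symm
    rw [hXs] at h
    simp only [hq, h, hX0]
    simp
  refine ⟨fun y => ∑ i, (ContinuousLinearMap.smulRightL ℂ (Fin s → ℂ) (Fin s → ℂ)
    (ContinuousLinearMap.proj i)) (q i y), ?_, ?_, ?_⟩
  · refine Finset.analyticAt_fun_sum _ fun i _ => ?_
    exact AnalyticAt.comp (g := ContinuousLinearMap.smulRightL ℂ (Fin s → ℂ) (Fin s → ℂ)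
      (ContinuousLinearMap.proj i)) (ContinuousLinearMap.analyticAt _ _) (hqan i)
  · simp only [hq0, map_zero, Finset.sum_const_zero]
  · intro v hv
    have hvi : ∀ i, AnalyticAt ℂ (fun y => v y i) 0 := fun i => analyticAt_pi_iff.1 hv i
    have h := F.proj_cov_sum D hX Finset.univ (v := fun i y => v y i) (c := c) hvi hcan
    have hVs : (fun y => ∑ i, v y i • c i y) = fun y => C y (v y) := by
      funext y
      conv_rhs => rw [pi_eq_sum_univ' (v y)]
      simp [hc]
    rw [hVs] at h
    filter_upwards [h, F.proj_section, hv.eventually_analyticAt] with y e1 e2 d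
    rw [e1, Finset.sum_add_distrib]
    congr 1
    · simp only [hc, e2]
      rw [← pi_eq_sum_univ' (fun i => fderiv ℂ (fun y => v y i) y (X y))]
      funext i
      rw [fderiv_apply d.differentiableAt]
      rfl
    · simp [hq]

/-- The connection form of a connection which commutes with the germ. -/
theorem exists_commuting_form (F : M.IsNormalFrame N C) (hD : D.CommutesWith f)
    (hf : AnalyticAt ℂ f 0)
    (hg : AnalyticAt ℂ (M.restrict f) 0) (hg0 : M.restrict f 0 = 0)
    (hfp : ∀ᶠ y in 𝓝 0, f (M.param y) = M.param (M.restrict f y))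
    {g' : (Fin r → ℂ) → (Fin r → ℂ)} (hg' : AnalyticAt ℂ g' 0)
    (hg'g : ∀ᶠ y in 𝓝 0, g' (M.restrict f y) = y)
    {X : (Fin r → ℂ) → (Fin r → ℂ)} (hX : AnalyticAt ℂ X 0) (hX0 : X 0 = 0)
    (hXf : M.FieldPushforward f X X) :
    ∃ Γ : (Fin r → ℂ) → (Fin s → ℂ) →L[ℂ] (Fin s → ℂ), AnalyticAt ℂ Γ 0 ∧ Γ 0 = 0 ∧
      AnalyticAt ℂ (normalMap M N C f) 0 ∧
      ∀ᶠ y in 𝓝 0, fderiv ℂ (normalMap M N C f) y (X y) =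
        normalMap M N C f y ∘L Γ y - Γ (M.restrict f y) ∘L normalMap M N C f y := by
  obtain ⟨Γ, hΓ, hΓ0, hΓc⟩ := F.exists_connection_form D hX hX0
  set g := M.restrict f with hgdef
  set A := normalMap M N C f with hA
  have hgt : Tendsto g (𝓝 0) (𝓝 0) := by
    have := hg.continuousAt.tendsto
    rwa [hg0] at this
  have hg'0 : g' 0 = 0 := by
    have := hg'g.self_of_nhds
    rwa [hg0] at this
  have hAan : AnalyticAt ℂ A 0 := by
    refine analyticAt_clm_comp ?_ (analyticAt_clm_comp ?_ F.analyticAt_section)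
    · exact AnalyticAt.comp (g := N) (f := g) (by rw [hg0]; exact F.analyticAt_proj) hg
    · exact AnalyticAt.comp (g := fderiv ℂ f) (by rw [M.param_zero]; exact hf.fderiv)
        M.analyticAt_param
  refine ⟨Γ, hΓ, hΓ0, hAan, ?_⟩
  have key : ∀ i : Fin s, ∀ᶠ y in 𝓝 0, fderiv ℂ A y (X y) (Pi.single i 1) =
      A y (Γ y (Pi.single i 1)) - Γ (g y) (A y (Pi.single i 1)) := by
    intro i
    set x : Fin s → ℂ := Pi.single i 1
    -- These are the frame components of the pushforward of the constant section `x`; the local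
    -- inverse `g'` returns from the image point to its source.
    set w : (Fin r → ℂ) → (Fin s → ℂ) := fun y => A (g' y) x with hw
    have hAx : AnalyticAt ℂ (fun y => A y x) 0 := analyticAt_clm_apply hAan analyticAt_const
    have hwan : AnalyticAt ℂ w 0 :=
      AnalyticAt.comp (g := fun y => A y x) (by rw [hg'0]; exact hAx) hg'
    have hV : AnalyticAt ℂ (fun y => C y x) 0 :=
      analyticAt_clm_apply F.analyticAt_section analyticAt_const
    have hW : AnalyticAt ℂ (fun y => C y (w y)) 0 :=
      analyticAt_clm_apply F.analyticAt_section hwan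
    have hVW : M.SectionPushforward f (fun y => C y x) (fun y => C y (w y)) := by
      rw [F.sectionPushforward_iff hf hg hg0 hfp]
      filter_upwards [hgt.eventually F.proj_section, F.proj_section, hg'g] with y e1 e2 e3
      rw [e1, e2]
      simp only [hw]
      rw [← hgdef, e3]
    -- The field `X` is its own pushforward, so commutation reads `dw(X) + Γ w = A Γ x` with the
    -- left side at `g y`. The chain rule for `w ∘ g = A x` converts the first term into `dA(X) x`
    -- at `y`.
    have h := hD X X _ _ hX hX hV hW hXf hVW
    rw [F.sectionPushforward_iff hf hg hg0 hfp] at h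
    filter_upwards [h, hΓc _ (analyticAt_const (v := x)), hgt.eventually (hΓc w hwan), hXf,
      hg'g.eventually_nhds, hgt.eventually hwan.eventually_analyticAt, hg.eventually_analyticAt,
      hAan.eventually_analyticAt] with y e e1 e2 e3 e4 d1 d2 d3
    rw [e1, e2, e3] at e
    have k1 := HasFDerivAt.comp y (g := w) (f := g) d1.differentiableAt.hasFDerivAt
      d2.differentiableAt.hasFDerivAt
    have k2 := (d3.differentiableAt.hasFDerivAt.clm_apply (hasFDerivAt_const x y))
    have k3 := k1.congr_of_eventuallyEq (f₁ := fun y => A y x) (e4.mono fun z hz => by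
      simp only [hw, Function.comp_apply]
      rw [hz])
    have k4 := DFunLike.congr_fun (k2.unique k3) (X y)
    have e5 : w (g y) = A y x := by
      simp only [hw]
      rw [e4.self_of_nhds]
    simp at k4 e
    rw [e5] at e
    rw [k4, eq_sub_iff_add_eq]
    exact e
  filter_upwards [eventually_all.2 key] with y hy
  refine ContinuousLinearMap.coe_injective ((Pi.basisFun ℂ (Fin s)).ext fun i => ?_)
  simpa using hy i

end IsNormalFrame

end SubmanifoldGerm

/-! ### Eigenbases adapted to an invariant subspace. -/

section EigenbasisAdapted

open Polynomial

variable {K V W : Type*} [Field K] [AddCommGroup V] [Module K V] [AddCommGroup W] [Module K W]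

theorem charpoly_eq_prod_of_eigenbasis {ι : Type*} [Fintype ι] [DecidableEq ι]
    [FiniteDimensional K W]
    (t : Module.Basis ι K W) {m : W →ₗ[K] W} {μ : ι → K} (h : ∀ i, m (t i) = μ i • t i) :
    m.charpoly = ∏ i, (X - C (μ i)) := by
  have h1 : LinearMap.toMatrix t t m = Matrix.diagonal μ := by
    ext i j
    rw [LinearMap.toMatrix_apply, h]
    by_cases hij : i = j
    · subst hij
      simp
    · simp [Matrix.diagonal_apply_ne _ hij, Ne.symm hij]
  rw [← LinearMap.charpoly_toMatrix m t, h1, Matrix.charpoly_diagonal]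

/-- The products have the same roots with multiplicity, so the fibres of `μ` and `ν` over each value
are equinumerous; the permutation is glued from bijections of fibres. -/
theorem exists_perm_of_prod_X_sub_C_eq {ι : Type*} [Fintype ι] {μ ν : ι → K}
    (h : ∏ i, (X - C (μ i)) = ∏ i, (X - C (ν i))) : ∃ σ : Equiv.Perm ι, ∀ i, μ i = ν (σ i) := by
  classical
  have h2 : Finset.univ.val.map μ = Finset.univ.val.map ν := by
    have h2 := congrArg Polynomial.roots h
    have h3 : ∀ κ : ι → K, (∏ i, (X - C (κ i))).roots = Finset.univ.val.map κ := fun κ => by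
      rw [← Polynomial.roots_multiset_prod_X_sub_C (Finset.univ.val.map κ), Multiset.map_map]
      rfl
    rwa [h3, h3] at h2
  have h4 : ∀ a, Nonempty ({i // μ i = a} ≃ {i // ν i = a}) := fun a => by
    have h5 := congrArg (Multiset.count a) h2
    rw [Multiset.count_map, Multiset.count_map] at h5
    refine Fintype.card_eq.1 ?_
    rw [Fintype.card_subtype, Fintype.card_subtype]
    simp only [eq_comm (b := a)] at h5 ⊢
    convert h5 using 1 <;> simp [Finset.card, Finset.filter_val]
  have e := fun a => Classical.choice (h4 a)
  refine ⟨(Equiv.sigmaFiberEquiv μ).symm.trans ((Equiv.sigmaCongrRight fun a => e a).trans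
    (Equiv.sigmaFiberEquiv ν)), fun i => ?_⟩
  exact ((e (μ i)) ⟨i, rfl⟩).2.symm

/-- An invariant subspace of a diagonalizable endomorphism, with prescribed characteristic
polynomial, has an eigenbasis which is completed by eigenvectors into an eigenbasis. -/
theorem exists_adapted_eigenbasis {s r : ℕ} {lam : Fin (s + r) → K}
    (b : Module.Basis (Fin (s + r)) K V) {L : V →ₗ[K] V} (hb : ∀ i, L (b i) = lam i • b i)
    (hW : Module.finrank K W = r) [FiniteDimensional K W] {j : W →ₗ[K] V}
    (hj : Function.Injective j) {m : W →ₗ[K] W} (hjm : ∀ w, L (j w) = j (m w))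
    (hm : m.charpoly = ∏ i with s ≤ i.val, (X - C (lam i))) :
    ∃ (c : Fin s → V) (t : Module.Basis (Fin r) K W),
      (∀ i, L (c i) = lam (Fin.castAdd r i) • c i) ∧
      (∀ i, m (t i) = lam (Fin.natAdd s i) • t i) ∧
      ∀ (x : Fin s → K) (w : W), j w + ∑ i, x i • c i = 0 → x = 0 ∧ w = 0 := by
  classical
  have hV : Module.finrank K V = s + r := by simp [Module.finrank_eq_card_basis b]
  have : FiniteDimensional K V := Module.Basis.finiteDimensional_of_finite b
  set T := LinearMap.range j
  -- The eigenvectors `b i`, `i ∈ I`, are chosen so that their classes form a basis of the quotient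
  -- by the range `T` of `j`. They span an invariant complement of `T`.
  obtain ⟨I, -, -, hspan, hind⟩ := exists_linearIndepOn_extension (v := fun i => T.mkQ (b i))
    (linearIndepOn_empty K _) (Set.empty_subset Set.univ)
  have htop : ⊤ ≤ Submodule.span K (Set.range fun i : I => T.mkQ (b i)) := by
    rw [Set.image_univ] at hspan
    have h1 := Submodule.span_le.2 hspan
    rw [Set.range_comp' , Submodule.span_image, b.span_eq, Submodule.map_top,
      Submodule.range_mkQ] at h1
    rwa [Set.image_eq_range] at h1
  let Q : Module.Basis I K (V ⧸ T) := Module.Basis.mk hind htop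
  have hQ : ∀ i : I, Q i = T.mkQ (b i) := fun i => by simp [Q]
  have hcardI : Fintype.card I = s := by
    have h1 := Module.finrank_eq_card_basis Q
    have h2 := Submodule.finrank_quotient_add_finrank T
    have h3 : Module.finrank K T = r := by
      rw [← hW]
      exact LinearMap.finrank_range_of_inj hj
    omega
  have hcardI' : Fintype.card (Iᶜ : Set (Fin (s + r))) = r := by
    rw [Fintype.card_compl_set, hcardI, Fintype.card_fin]
    omega
  let eI : Fin s ≃ I := (Fintype.equivFinOfCardEq hcardI).symm
  let eJ : Fin r ≃ (Iᶜ : Set (Fin (s + r))) := (Fintype.equivFinOfCardEq hcardI').symm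
  -- the projection onto `W` along the selected eigenvectors
  let p : V →ₗ[K] V := LinearMap.id - (Q.constr K fun i : I => b i) ∘ₗ T.mkQ
  have hpT : ∀ v, p v ∈ T := by
    have h1 : T.mkQ ∘ₗ (Q.constr K fun i : I => b i) = LinearMap.id :=
      Q.ext fun i => by
        rw [LinearMap.comp_apply, Module.Basis.constr_basis, hQ, LinearMap.id_apply]
    intro v
    rw [← Submodule.Quotient.mk_eq_zero, ← Submodule.mkQ_apply]
    have h2 := LinearMap.congr_fun h1 (T.mkQ v)
    simp only [LinearMap.comp_apply, LinearMap.id_apply] at h2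
    simp only [p, LinearMap.sub_apply, LinearMap.id_apply, LinearMap.comp_apply, map_sub]
    rw [h2, sub_self]
  let q : V →ₗ[K] W := (LinearEquiv.ofInjective j hj).symm.toLinearMap ∘ₗ p.codRestrict T hpT
  have hjq : ∀ v, j (q v) = p v := fun v => by
    exact congrArg Subtype.val ((LinearEquiv.ofInjective j hj).apply_symm_apply
      (p.codRestrict T hpT v))
  have hqb : ∀ i : I, q (b i) = 0 := fun i => by
    apply hj
    rw [hjq, map_zero]
    simp only [p, LinearMap.sub_apply, LinearMap.id_apply, LinearMap.comp_apply]
    rw [← hQ, Module.Basis.constr_basis, sub_self]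
  have hqj : ∀ w, q (j w) = w := fun w => by
    apply hj
    rw [hjq]
    have : T.mkQ (j w) = 0 := by
      rw [Submodule.mkQ_apply, Submodule.Quotient.mk_eq_zero]
      exact ⟨w, rfl⟩
    simp only [p, LinearMap.sub_apply, LinearMap.id_apply, LinearMap.comp_apply, this, map_zero,
      sub_zero]
  have hdecomp : ∀ v, ∃ w, v = j w + Q.constr K (fun i : I => b i) (T.mkQ v) := fun v =>
    ⟨q v, by rw [hjq]; simp [p]⟩
  have hqσ : ∀ u, q (Q.constr K (fun i : I => b i) u) = 0 := fun u => by
    have : q ∘ₗ Q.constr K (fun i : I => b i) = 0 := Q.ext fun i => by simp [hqb]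
    exact LinearMap.congr_fun this u
  have hqLσ : ∀ u, q (L (Q.constr K (fun i : I => b i) u)) = 0 := fun u => by
    have : q ∘ₗ L ∘ₗ Q.constr K (fun i : I => b i) = 0 := Q.ext fun i => by simp [hb, hqb]
    exact LinearMap.congr_fun this u
  -- Since `T` and the chosen complement are both invariant, the projection `q` intertwines `L` with
  -- `m`. It therefore sends the remaining eigenvectors to eigenvectors of `m`, which span `W`.
  have hqL : ∀ v, q (L v) = m (q v) := fun v => by
    obtain ⟨w, hw⟩ := hdecomp v
    rw [hw, map_add, map_add, map_add, hqσ, hqLσ, hjm, hqj, hqj, add_zero, add_zero]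
  have hspanW : ⊤ ≤ Submodule.span K (Set.range fun i => q (b (eJ i))) := by
    intro w _
    have h1 : j w ∈ Submodule.span K (Set.range b) := by rw [b.span_eq]; trivial
    have h2 := Submodule.mem_map_of_mem (f := q) h1
    rw [hqj, Submodule.map_span] at h2
    refine Submodule.span_le.2 ?_ h2
    rintro _ ⟨_, ⟨i, rfl⟩, rfl⟩
    by_cases hi : i ∈ I
    · rw [hqb ⟨i, hi⟩]
      exact zero_mem _
    · exact Submodule.subset_span ⟨eJ.symm ⟨i, hi⟩, by simp⟩
  let t : Module.Basis (Fin r) K W := basisOfTopLeSpanOfCardEqFinrank (fun i => q (b (eJ i)))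
    hspanW (by simp [hW])
  have ht : ∀ i, t i = q (b (eJ i)) := fun i => by simp [t]
  have hmt : ∀ i, m (t i) = lam (eJ i) • t i := fun i => by
    rw [ht, ← hqL, hb, map_smul]
  have hprodJ : ∏ i : Fin r, (X - C (lam (Fin.natAdd s i))) = ∏ i, (X - C (lam (eJ i))) := by
    rw [← charpoly_eq_prod_of_eigenbasis t hmt, hm, Finset.prod_filter, Fin.prod_univ_add]
    simp [fun x : Fin s => x.2.not_ge]
  -- The prescribed characteristic polynomial settles the eigenvalues on `W`. Those on the
  -- complement follow by cancelling in the product over all indices.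
  have hprodI : ∏ i : Fin s, (X - C (lam (Fin.castAdd r i))) = ∏ i, (X - C (lam (eI i))) := by
    have h1 : (∏ i : Fin s, (X - C (lam (Fin.castAdd r i)))) *
        ∏ i : Fin r, (X - C (lam (Fin.natAdd s i))) =
        (∏ i, (X - C (lam (eI i)))) * ∏ i, (X - C (lam (eJ i))) := by
      rw [← Fin.prod_univ_add (fun i => X - C (lam i)),
        ← (Equiv.Set.sumCompl I).prod_comp, Fintype.prod_sum_type, ← eI.prod_comp,
        ← eJ.prod_comp]
      simp
    rw [← hprodJ] at h1
    exact mul_right_cancel₀ (Finset.prod_ne_zero_iff.2 fun i _ => X_sub_C_ne_zero _) h1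
  obtain ⟨σ, hσ⟩ := exists_perm_of_prod_X_sub_C_eq hprodI
  obtain ⟨τ, hτ⟩ := exists_perm_of_prod_X_sub_C_eq hprodJ
  refine ⟨fun i => b (eI (σ i)), t.reindex τ.symm, fun i => ?_, fun i => ?_, fun x w h => ?_⟩
  · rw [hσ, hb]
  · rw [hτ, Module.Basis.reindex_apply, hmt]
    rfl
  · have h1 := congrArg T.mkQ h
    have hw : T.mkQ (j w) = 0 := by
      rw [Submodule.mkQ_apply, Submodule.Quotient.mk_eq_zero]
      exact ⟨w, rfl⟩
    simp only [map_add, hw, zero_add, map_sum, map_smul, map_zero, ← hQ] at h1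
    have hlin : LinearIndependent K fun i : Fin s => Q (eI (σ i)) :=
      Q.linearIndependent.comp (fun i => eI (σ i)) (eI.injective.comp σ.injective)
    have hx : x = 0 := funext (Fintype.linearIndependent_iff.1 hlin x h1)
    refine ⟨hx, hj ?_⟩
    subst hx
    simpa using h

end EigenbasisAdapted

/-! ### Invertible analytic germs and conjugation. -/

section GermIso

variable {E F H : Type*} [NormedAddCommGroup E] [NormedSpace ℂ E] [NormedAddCommGroup F]
  [NormedSpace ℂ F] [NormedAddCommGroup H] [NormedSpace ℂ H]

/-- `Φ` and `G` are mutually inverse analytic germs at the origin. -/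
structure IsGermIso (Φ : E → F) (G : F → E) : Prop where
  analyticAt : AnalyticAt ℂ Φ 0
  analyticAt_inv : AnalyticAt ℂ G 0
  map_zero : Φ 0 = 0
  inv_zero : G 0 = 0
  left_inv : ∀ᶠ z in 𝓝 0, G (Φ z) = z
  right_inv : ∀ᶠ z in 𝓝 0, Φ (G z) = z

theorem AnalyticAt.tendsto_zero {Φ : E → F} (h : AnalyticAt ℂ Φ 0) (h0 : Φ 0 = 0) :
    Tendsto Φ (𝓝 0) (𝓝 0) := by
  have := h.continuousAt.tendsto
  rwa [h0] at this

theorem AnalyticAt.comp_zero {Ψ : F → H} {Φ : E → F} (hΨ : AnalyticAt ℂ Ψ 0)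
    (h : AnalyticAt ℂ Φ 0) (h0 : Φ 0 = 0) : AnalyticAt ℂ (fun z => Ψ (Φ z)) 0 :=
  AnalyticAt.comp (g := Ψ) (f := Φ) (by rwa [h0]) h

theorem AnalyticAt.fderiv_comp_zero {Ψ : F → H} {Φ : E → F} (hΨ : AnalyticAt ℂ Ψ 0)
    (h : AnalyticAt ℂ Φ 0) (h0 : Φ 0 = 0) :
    fderiv ℂ (fun z => Ψ (Φ z)) 0 = fderiv ℂ Ψ 0 ∘L fderiv ℂ Φ 0 := by
  have := HasFDerivAt.comp (0 : E) (g := Ψ) (f := Φ) (g' := fderiv ℂ Ψ 0)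
    (by rw [h0]; exact hΨ.differentiableAt.hasFDerivAt) h.differentiableAt.hasFDerivAt
  exact this.fderiv

namespace IsGermIso

variable {Φ : E → F} {G : F → E}

theorem symm (h : IsGermIso Φ G) : IsGermIso G Φ :=
  ⟨h.analyticAt_inv, h.analyticAt, h.inv_zero, h.map_zero, h.right_inv, h.left_inv⟩

theorem tendsto (h : IsGermIso Φ G) : Tendsto Φ (𝓝 0) (𝓝 0) := h.analyticAt.tendsto_zero h.map_zero

theorem comp {Ψ : F → H} {K : H → F} (h' : IsGermIso Ψ K) (h : IsGermIso Φ G) :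
    IsGermIso (fun z => Ψ (Φ z)) (fun z => G (K z)) where
  analyticAt := h'.analyticAt.comp_zero h.analyticAt h.map_zero
  analyticAt_inv := h.analyticAt_inv.comp_zero h'.analyticAt_inv h'.inv_zero
  map_zero := by rw [h.map_zero, h'.map_zero]
  inv_zero := by rw [h'.inv_zero, h.inv_zero]
  left_inv := by
    filter_upwards [h.left_inv, h.tendsto.eventually h'.left_inv] with z h1 h2
    rw [h2, h1]
  right_inv := by
    filter_upwards [h'.right_inv, h'.symm.tendsto.eventually h.right_inv] with z h1 h2
    rw [h2, h1]

theorem _root_.ContinuousLinearEquiv.isGermIso (e : E ≃L[ℂ] F) : IsGermIso e e.symm where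
  analyticAt := (e : E →L[ℂ] F).analyticAt 0
  analyticAt_inv := (e.symm : F →L[ℂ] E).analyticAt 0
  map_zero := e.map_zero
  inv_zero := e.symm.map_zero
  left_inv := Eventually.of_forall e.symm_apply_apply
  right_inv := Eventually.of_forall e.apply_symm_apply

theorem prodMap_id (h : IsGermIso Φ G) :
    IsGermIso (fun z : H × E => (z.1, Φ z.2)) (fun z : H × F => (z.1, G z.2)) where
  analyticAt := analyticAt_fst.prod (h.analyticAt.comp_zero analyticAt_snd rfl)
  analyticAt_inv := analyticAt_fst.prod (h.analyticAt_inv.comp_zero analyticAt_snd rfl)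
  map_zero := Prod.ext rfl h.map_zero
  inv_zero := Prod.ext rfl h.inv_zero
  left_inv := by
    filter_upwards [(continuous_snd.tendsto' (0 : H × E) 0 rfl).eventually h.left_inv] with z hz
    exact Prod.ext rfl hz
  right_inv := by
    filter_upwards [(continuous_snd.tendsto' (0 : H × F) 0 rfl).eventually h.right_inv] with z hz
    exact Prod.ext rfl hz

theorem fderiv_leftInverse (h : IsGermIso Φ G) (v : E) : fderiv ℂ G 0 (fderiv ℂ Φ 0 v) = v := by
  have h1 := h.analyticAt_inv.fderiv_comp_zero h.analyticAt h.map_zero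
  have h2 : fderiv ℂ (fun z => G (Φ z)) 0 = ContinuousLinearMap.id ℂ E :=
    ((hasFDerivAt_id (0 : E)).congr_of_eventuallyEq h.left_inv).fderiv
  rw [h2] at h1
  exact (DFunLike.congr_fun h1 v).symm

theorem exists_fderiv_equiv (h : IsGermIso Φ G) :
    ∃ e : E ≃L[ℂ] F, (e : E →L[ℂ] F) = fderiv ℂ Φ 0 :=
  ⟨ContinuousLinearEquiv.equivOfInverse (fderiv ℂ Φ 0) (fderiv ℂ G 0) h.fderiv_leftInverse
    h.symm.fderiv_leftInverse, rfl⟩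

end IsGermIso

theorem isGermIso_of_hasFDerivAt [CompleteSpace E] [CompleteSpace F] {Φ : E → F} {e : E ≃L[ℂ] F}
    (hΦ : AnalyticAt ℂ Φ 0) (h0 : Φ 0 = 0) (he : HasFDerivAt Φ (e : E →L[ℂ] F) 0) :
    ∃ G, IsGermIso Φ G := by
  obtain ⟨G, h1, h2, h3, h4⟩ := exists_analytic_inverse hΦ h0 he
  exact ⟨G, hΦ, h1, h0, h2, h3, h4⟩

theorem isHolDiffeoGerm_iff {m : ℕ} {f : (Fin m → ℂ) → (Fin m → ℂ)} :
    IsHolDiffeoGerm f ↔ ∃ g, IsGermIso f g :=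
  ⟨fun ⟨h1, h2, g, h3, h4, h5, h6⟩ => ⟨g, h1, h3, h2, h4, h5, h6⟩,
    fun ⟨g, h⟩ => ⟨h.1, h.3, g, h.2, h.4, h.5, h.6⟩⟩

/-- A germ conjugate to a linear map is linearizable. -/
theorem isHolLinearizable_of_conj {m : ℕ} {f : (Fin m → ℂ) → (Fin m → ℂ)} (hf : AnalyticAt ℂ f 0)
    {Ψ : E → (Fin m → ℂ)} {G : (Fin m → ℂ) → E} (hΨ : IsGermIso Ψ G)
    {A : E →L[ℂ] E} (hA : ∀ᶠ z in 𝓝 0, f (Ψ z) = Ψ (A z)) : IsHolLinearizable f := by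
  obtain ⟨Q, hQ⟩ := hΨ.exists_fderiv_equiv
  have h1 : ∀ z, fderiv ℂ f 0 (Q z) = Q (A z) := by
    have k1 := hf.fderiv_comp_zero hΨ.analyticAt hΨ.map_zero
    have k2 := hΨ.analyticAt.fderiv_comp_zero (A.analyticAt 0) (map_zero A)
    rw [Filter.EventuallyEq.fderiv_eq hA, k2, ← hQ, A.fderiv] at k1
    exact fun z => (DFunLike.congr_fun k1 z).symm
  -- The linear part `Q` of `Ψ` conjugates `A` to the differential of `f`. Removing it from `Ψ`
  -- replaces `A` by that differential.
  refine ⟨fun w => Ψ (Q.symm w), isHolDiffeoGerm_iff.2 ⟨_, hΨ.comp Q.symm.isGermIso⟩, ?_⟩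
  filter_upwards [Q.symm.isGermIso.tendsto.eventually hA] with w hw
  rw [hw]
  congr 1
  apply Q.injective
  rw [← h1, Q.apply_symm_apply, Q.apply_symm_apply]

end GermIso

/-! ### Linearization in split coordinates. -/

/-- Splitting off the first `s` coordinates. -/
noncomputable def splitCoords (s r : ℕ) : (Fin (s + r) → ℂ) ≃L[ℂ] (Fin s → ℂ) × (Fin r → ℂ) :=
  ((LinearEquiv.funCongrLeft ℂ ℂ finSumFinEquiv).trans
    (LinearEquiv.sumArrowLequivProdArrow (Fin s) (Fin r) ℂ ℂ)).toContinuousLinearEquiv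

@[simp]
theorem splitCoords_fst {s r : ℕ} (z : Fin (s + r) → ℂ) (i : Fin s) :
    (splitCoords s r z).1 i = z (Fin.castAdd r i) := rfl

@[simp]
theorem splitCoords_snd {s r : ℕ} (z : Fin (s + r) → ℂ) (j : Fin r) :
    (splitCoords s r z).2 j = z (Fin.natAdd s j) := rfl

theorem splitCoords_diagMap {s r : ℕ} (lam : Fin (s + r) → ℂ) (z : Fin (s + r) → ℂ) :
    splitCoords s r (diagMap lam z) =
      ((diagMap fun i => lam (Fin.castAdd r i)).prodMap (diagMap fun j => lam (Fin.natAdd s j)))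
        (splitCoords s r z) := by
  ext <;> simp

theorem splitCoords_tailProj {s r : ℕ} (z : Fin (s + r) → ℂ) :
    splitCoords s r (tailProj (levelWeight s) z) = (0, (splitCoords s r z).2) := by
  ext <;> simp [tailProj_apply, levelWeight]

/-- The linearization theorem for adapted germs, in split coordinates. -/
theorem exists_linearization_prod {s r : ℕ} (hs : 1 ≤ s) {lam : Fin (s + r) → ℂ}
    (hlam : ∀ i, lam i ≠ 0) (hL : OnlyLevelResonances s lam) (hB : ReducedBrjuno lam)
    {k : (Fin s → ℂ) × (Fin r → ℂ) → (Fin s → ℂ) × (Fin r → ℂ)} (hk : AnalyticAt ℂ k 0)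
    {Λ : (Fin s → ℂ) →L[ℂ] (Fin s → ℂ)} {μ : (Fin r → ℂ) →L[ℂ] (Fin r → ℂ)}
    (hΛ : Λ = diagMap fun i => lam (Fin.castAdd r i))
    (hμ : μ = diagMap fun j => lam (Fin.natAdd s j))
    (hd : fderiv ℂ k 0 = Λ.prodMap μ)
    (h1 : ∀ᶠ y in 𝓝 0, k (0, y) = (0, μ y))
    (h2 : ∀ᶠ y in 𝓝 0, ∀ v, (fderiv ℂ k (0, y) v).1 = Λ v.1) :
    ∃ Ψ G, IsGermIso Ψ G ∧ ∀ᶠ z in 𝓝 0, k (Ψ z) = Ψ (diagMap lam z) := by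
  subst hΛ hμ
  set κ := splitCoords s r with hκ
  have hk0 : k 0 = 0 := by
    have := h1.self_of_nhds
    rwa [map_zero] at this
  set h : (Fin (s + r) → ℂ) → (Fin (s + r) → ℂ) := fun z => κ.symm (k (κ z)) with hh
  have hkκ : AnalyticAt ℂ (fun z => k (κ z)) 0 :=
    hk.comp_zero κ.isGermIso.analyticAt κ.map_zero
  have hhan : AnalyticAt ℂ h 0 :=
    κ.symm.isGermIso.analyticAt.comp_zero hkκ (by rw [κ.map_zero, hk0])
  have hfd : ∀ z, fderiv ℂ h z = (κ.symm : _ →L[ℂ] (Fin (s + r) → ℂ)) ∘L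
      fderiv ℂ k (κ z) ∘L (κ : (Fin (s + r) → ℂ) →L[ℂ] _) := by
    intro z
    have e1 := κ.symm.comp_fderiv (f := fun z => k (κ z)) (x := z)
    have e2 := κ.comp_right_fderiv (f := k) (x := z)
    rw [← e2]
    exact e1
  have hsnd : Tendsto (fun z => (κ z).2) (𝓝 0) (𝓝 0) :=
    (continuous_snd.comp κ.continuous).tendsto' 0 0 (by simp)
  have hκt : ∀ z, κ (tailProj (levelWeight s) z) = (0, (κ z).2) := splitCoords_tailProj
  obtain ⟨ψ, hψ, hψ0, hψd, hψc⟩ := exists_linearization_of_adapted hs (by omega) hlam hL hB hhan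
    (by
      rw [hfd, map_zero, hd]
      ext z : 1
      apply κ.injective
      simp only [ContinuousLinearMap.comp_apply, ContinuousLinearEquiv.coe_coe,
        ContinuousLinearEquiv.apply_symm_apply]
      exact (splitCoords_diagMap lam z).symm)
    (by
      filter_upwards [hsnd.eventually h1] with z hz
      apply κ.injective
      simp only [hh, ContinuousLinearEquiv.apply_symm_apply]
      rw [hκt, hz, hκ, splitCoords_diagMap, ← hκ, hκt]
      simp)
    (by
      filter_upwards [hsnd.eventually h2] with z hz i hi v
      have e := congrFun (hz (κ v)) ⟨i, hi⟩
      rw [hfd, hκt]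
      set w := fderiv ℂ k (0, (κ z).2) (κ v) with hw
      have e' : κ.symm w i = w.1 ⟨i, hi⟩ := by
        conv_rhs => rw [← κ.apply_symm_apply w]
        rfl
      change κ.symm w i = _
      rw [e', e]
      rfl)
  obtain ⟨ψ', hψ'⟩ := isGermIso_of_hasFDerivAt
    (e := ContinuousLinearEquiv.refl ℂ (Fin (s + r) → ℂ)) hψ hψ0 hψd
  refine ⟨_, _, κ.isGermIso.comp hψ', ?_⟩
  filter_upwards [hψc] with z hz
  rw [hz]
  simp [hh]

theorem eigenvalue_ne_zero_of_isGermIso {m : ℕ} {f f' : (Fin m → ℂ) → (Fin m → ℂ)}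
    (hf : IsGermIso f f') {b : Fin m → ℂ} (hb : b ≠ 0) {c : ℂ} (h : fderiv ℂ f 0 b = c • b) :
    c ≠ 0 := by
  rintro rfl
  rw [zero_smul] at h
  have := hf.fderiv_leftInverse b
  rw [h, map_zero] at this
  exact hb this.symm

/-! ### Charts adapted to an osculating manifold. -/

namespace SubmanifoldGerm

variable {n r s : ℕ} (M : SubmanifoldGerm n r) {f : (Fin n → ℂ) → (Fin n → ℂ)}

theorem chart_zero : M.chart 0 = 0 := by
  have := M.chart_param.self_of_nhds
  rwa [M.param_zero] at this

theorem restrict_zero (hf0 : f 0 = 0) : M.restrict f 0 = 0 := by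
  simp only [restrict, M.param_zero, hf0, M.chart_zero]

theorem analyticAt_restrict (hf : AnalyticAt ℂ f 0) (hf0 : f 0 = 0) :
    AnalyticAt ℂ (M.restrict f) 0 :=
  M.analyticAt_chart.comp_zero (hf.comp_zero M.analyticAt_param M.param_zero)
    (by rw [M.param_zero, hf0])

variable {M}

theorem IsInvariant.param_restrict (hM : M.IsInvariant f) (hf : AnalyticAt ℂ f 0) (hf0 : f 0 = 0) :
    ∀ᶠ y in 𝓝 0, f (M.param y) = M.param (M.restrict f y) := by
  have hpt := M.analyticAt_param.tendsto_zero M.param_zero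
  have h1 : Tendsto M.param (𝓝 0) (𝓝[M.carrier] 0) :=
    tendsto_nhdsWithin_iff.2 ⟨hpt, M.param_mem⟩
  have h2 : Tendsto (fun y => f (M.param y)) (𝓝 0) (𝓝[M.carrier] 0) :=
    tendsto_nhdsWithin_iff.2 ⟨(hf.tendsto_zero hf0).comp hpt, h1.eventually hM⟩
  filter_upwards [h2.eventually M.param_chart] with y hy
  exact hy.symm

theorem fderiv_param_injective (M : SubmanifoldGerm n r) :
    Function.Injective (fderiv ℂ M.param 0) := by
  have h1 := M.analyticAt_chart.fderiv_comp_zero M.analyticAt_param M.param_zero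
  have h2 : fderiv ℂ (fun z => M.chart (M.param z)) 0 = ContinuousLinearMap.id ℂ (Fin r → ℂ) :=
    ((hasFDerivAt_id (0 : Fin r → ℂ)).congr_of_eventuallyEq M.chart_param).fderiv
  rw [h2] at h1
  exact Function.LeftInverse.injective (g := fderiv ℂ M.chart 0)
    fun v => (DFunLike.congr_fun h1 v).symm

/-- The Euler field of a linearizing coordinate is invariant. -/
theorem exists_euler_field (M : SubmanifoldGerm n r) {ψ ψ' : (Fin r → ℂ) → (Fin r → ℂ)}
    (hψ : IsGermIso ψ ψ') {μ : (Fin r → ℂ) →L[ℂ] (Fin r → ℂ)} (hg : AnalyticAt ℂ (M.restrict f) 0)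
    (hψc : ∀ᶠ y in 𝓝 0, M.restrict f (ψ y) = ψ (μ y)) :
    ∃ X : (Fin r → ℂ) → (Fin r → ℂ), AnalyticAt ℂ X 0 ∧ X 0 = 0 ∧ M.FieldPushforward f X X ∧
      ∀ᶠ y in 𝓝 0, X (ψ y) = fderiv ℂ ψ y y := by
  have hμt : Tendsto μ (𝓝 0) (𝓝 0) := μ.continuous.tendsto' 0 0 (map_zero _)
  refine ⟨fun y => fderiv ℂ ψ (ψ' y) (ψ' y), ?_, ?_, ?_, ?_⟩
  · exact analyticAt_clm_apply (hψ.analyticAt.fderiv.comp_zero hψ.analyticAt_inv hψ.inv_zero)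
      hψ.analyticAt_inv
  · simp only [hψ.inv_zero, map_zero]
  -- In the linearizing coordinate this says that a linear map carries the Euler field at `u` to the
  -- Euler field at `μ u`.
  · have h1 : ∀ᶠ u in 𝓝 0, fderiv ℂ ψ (ψ' (M.restrict f (ψ u))) (ψ' (M.restrict f (ψ u))) =
        fderiv ℂ (M.restrict f) (ψ u) (fderiv ℂ ψ u u) := by
      filter_upwards [hψc.eventually_nhds, hμt.eventually hψ.left_inv,
        hψ.analyticAt.eventually_analyticAt,
        hμt.eventually hψ.analyticAt.eventually_analyticAt,
        hψ.tendsto.eventually hg.eventually_analyticAt] with u e1 e2 d1 d2 d3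
      have k1 := HasFDerivAt.comp u (g := M.restrict f) (f := ψ) d3.differentiableAt.hasFDerivAt
        d1.differentiableAt.hasFDerivAt
      have k2 := (HasFDerivAt.comp u (g := ψ) (f := μ) d2.differentiableAt.hasFDerivAt
        μ.hasFDerivAt).congr_of_eventuallyEq (f₁ := M.restrict f ∘ ψ) e1
      rw [e1.self_of_nhds, e2]
      exact (DFunLike.congr_fun (k1.unique k2) u).symm
    filter_upwards [hψ.symm.tendsto.eventually h1, hψ.right_inv] with y e1 e2
    rw [e2] at e1
    exact e1
  · filter_upwards [hψ.left_inv] with y hy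
    rw [hy]

/-- A chart adapted to an osculating manifold on which the germ is linearized: the manifold becomes
a linear subspace, the restriction becomes linear, and the normal derivative commutes with a
connection along the Euler field. -/
theorem exists_adapted_chart {f' : (Fin n → ℂ) → (Fin n → ℂ)} (hf : IsGermIso f f')
    (hM : M.IsInvariant f) {D : M.NormalConnection} (hD : D.CommutesWith f)
    {c : Fin s → (Fin n → ℂ)} {ν : Fin s → ℂ} (hc : ∀ i, fderiv ℂ f 0 (c i) = ν i • c i)
    (hcM : ∀ (x : Fin s → ℂ) (w : Fin r → ℂ), fderiv ℂ M.param 0 w + ∑ i, x i • c i = 0 →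
      x = 0 ∧ w = 0) (hn : n = s + r)
    {ψ ψ' : (Fin r → ℂ) → (Fin r → ℂ)}
    (hψ : IsGermIso ψ ψ') {μ : (Fin r → ℂ) →L[ℂ] (Fin r → ℂ)}
    (hψc : ∀ᶠ y in 𝓝 0, M.restrict f (ψ y) = ψ (μ y)) :
    ∃ (Φ : (Fin s → ℂ) × (Fin r → ℂ) → (Fin n → ℂ)) (G : (Fin n → ℂ) → (Fin s → ℂ) × (Fin r → ℂ))
      (h : (Fin s → ℂ) × (Fin r → ℂ) → (Fin s → ℂ) × (Fin r → ℂ))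
      (Γ : (Fin r → ℂ) → (Fin s → ℂ) →L[ℂ] (Fin s → ℂ)),
      IsGermIso Φ G ∧ AnalyticAt ℂ h 0 ∧ (∀ᶠ z in 𝓝 0, f (Φ z) = Φ (h z)) ∧
      (∀ᶠ y in 𝓝 0, h (0, y) = (0, μ y)) ∧ fderiv ℂ h 0 = (diagMap ν).prodMap μ ∧
      AnalyticAt ℂ Γ 0 ∧ Γ 0 = 0 ∧
      ∀ᶠ y in 𝓝 0, fderiv ℂ (normalPart h) y y =
        normalPart h y ∘L Γ y - Γ (μ y) ∘L normalPart h y := by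
  have hμt : Tendsto μ (𝓝 0) (𝓝 0) := μ.continuous.tendsto' 0 0 (map_zero _)
  set g := M.restrict f with hgdef
  have hg : AnalyticAt ℂ g 0 := M.analyticAt_restrict hf.analyticAt hf.map_zero
  have hg0 : g 0 = 0 := M.restrict_zero hf.map_zero
  have hfp : ∀ᶠ y in 𝓝 0, f (M.param y) = M.param (g y) :=
    hM.param_restrict hf.analyticAt hf.map_zero
  have hdg : ∀ w, fderiv ℂ f 0 (fderiv ℂ M.param 0 w) = fderiv ℂ M.param 0 (fderiv ℂ g 0 w) := by
    have k1 := hf.analyticAt.fderiv_comp_zero M.analyticAt_param M.param_zero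
    have k2 := M.analyticAt_param.fderiv_comp_zero hg hg0
    rw [Filter.EventuallyEq.fderiv_eq hfp, k2] at k1
    exact fun w => (DFunLike.congr_fun k1 w).symm
  -- The restriction inherits injectivity from `df` because the parametrization is an immersion. Its
  -- local inverse is needed to push sections forward.
  have hginj : Function.Injective (fderiv ℂ g 0) := by
    refine (injective_iff_map_eq_zero _).2 fun w hw => ?_
    have e1 := hdg w
    rw [hw, map_zero] at e1
    have e2 := hf.fderiv_leftInverse (fderiv ℂ M.param 0 w)
    rw [e1, map_zero] at e2
    apply M.fderiv_param_injective
    rw [← e2, map_zero]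
  obtain ⟨g', hg'⟩ := isGermIso_of_hasFDerivAt
    (e := (LinearEquiv.ofInjectiveEndo (fderiv ℂ g 0).toLinearMap
      hginj).toContinuousLinearEquiv) hg hg0 hg.differentiableAt.hasFDerivAt
  -- the tubular chart
  set C : (Fin s → ℂ) →L[ℂ] (Fin n → ℂ) :=
    ∑ i, (ContinuousLinearMap.proj i : (Fin s → ℂ) →L[ℂ] ℂ).smulRight (c i) with hC
  have hCapp : ∀ x, C x = ∑ i, x i • c i := fun x => by simp [hC]
  have hdfC : ∀ x, fderiv ℂ f 0 (C x) = C (diagMap ν x) := fun x => by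
    simp only [hCapp, map_sum, map_smul, hc, smul_smul, diagMap_apply, mul_comm]
  set Φ₀ : (Fin s → ℂ) × (Fin r → ℂ) → (Fin n → ℂ) := fun z => M.param z.2 + C z.1 with hΦ₀
  have hparam2 : AnalyticAt ℂ (fun z : (Fin s → ℂ) × (Fin r → ℂ) => M.param z.2) 0 :=
    M.analyticAt_param.comp_zero analyticAt_snd rfl
  have hΦ₀an : AnalyticAt ℂ Φ₀ 0 :=
    hparam2.add ((C ∘L ContinuousLinearMap.fst ℂ (Fin s → ℂ) (Fin r → ℂ)).analyticAt 0)
  have hΦ₀0 : Φ₀ 0 = 0 := by simp [hΦ₀, M.param_zero]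
  have hΦ₀z : ∀ y, Φ₀ (0, y) = M.param y := fun y => by simp [hΦ₀]
  have hΦ₀d : ∀ v, fderiv ℂ Φ₀ 0 v = fderiv ℂ M.param 0 v.2 + C v.1 := by
    have k1 : HasFDerivAt (fun z : (Fin s → ℂ) × (Fin r → ℂ) => M.param z.2)
        (fderiv ℂ M.param 0 ∘L ContinuousLinearMap.snd ℂ (Fin s → ℂ) (Fin r → ℂ)) 0 :=
      HasFDerivAt.comp (0 : (Fin s → ℂ) × (Fin r → ℂ)) (g := M.param)
        M.analyticAt_param.differentiableAt.hasFDerivAt hasFDerivAt_snd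
    have k2 := k1.add (C ∘L ContinuousLinearMap.fst ℂ (Fin s → ℂ) (Fin r → ℂ)).hasFDerivAt
    intro v
    rw [HasFDerivAt.fderiv (f := Φ₀) k2]
    rfl
  have hΦ₀inj : Function.Injective (fderiv ℂ Φ₀ 0) := by
    refine (injective_iff_map_eq_zero _).2 fun v hv => ?_
    rw [hΦ₀d, hCapp] at hv
    obtain ⟨e1, e2⟩ := hcM _ _ hv
    exact Prod.ext e1 e2
  obtain ⟨G₀, hG₀⟩ := isGermIso_of_hasFDerivAt
    (e := (LinearEquiv.ofInjectiveOfFinrankEq (fderiv ℂ Φ₀ 0).toLinearMap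
      hΦ₀inj (by simp [hn])).toContinuousLinearEquiv) hΦ₀an hΦ₀0 hΦ₀an.differentiableAt.hasFDerivAt
  have F := M.isNormalFrame_of_chart hΦ₀an hΦ₀0 hG₀.analyticAt_inv hG₀.left_inv hG₀.right_inv
    fun y => (hΦ₀z y).symm
  obtain ⟨X, hX, hX0, hXf, hXψ⟩ := M.exists_euler_field (f := f) hψ hg hψc
  obtain ⟨Γ, hΓ, hΓ0, hAan, hΓc⟩ := F.exists_commuting_form D hD hf.analyticAt hg hg0 hfp
    hg'.analyticAt_inv hg'.left_inv hX hX0 hXf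
  set A := IsNormalFrame.normalMap M
    (fun y => ContinuousLinearMap.fst ℂ (Fin s → ℂ) (Fin r → ℂ) ∘L fderiv ℂ G₀ (M.param y))
    (fun y => fderiv ℂ Φ₀ (0, y) ∘L ContinuousLinearMap.inl ℂ (Fin s → ℂ) (Fin r → ℂ)) f with hA
  -- the chart adapted to the linearizing coordinate
  have hP : IsGermIso (fun z : (Fin s → ℂ) × (Fin r → ℂ) => (z.1, ψ z.2))
      (fun z => (z.1, ψ' z.2)) := hψ.prodMap_id
  have hΦ := hG₀.comp hP
  set Φ : (Fin s → ℂ) × (Fin r → ℂ) → (Fin n → ℂ) := fun z => Φ₀ (z.1, ψ z.2) with hΦdef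
  set G : (Fin n → ℂ) → (Fin s → ℂ) × (Fin r → ℂ) := fun z => ((G₀ z).1, ψ' (G₀ z).2) with hGdef
  have hfΦ : AnalyticAt ℂ (fun z => f (Φ z)) 0 := hf.analyticAt.comp_zero hΦ.analyticAt hΦ.map_zero
  have hfΦ0 : f (Φ 0) = 0 := by rw [hΦ.map_zero, hf.map_zero]
  set h : (Fin s → ℂ) × (Fin r → ℂ) → (Fin s → ℂ) × (Fin r → ℂ) := fun z => G (f (Φ z)) with hh
  have hhan : AnalyticAt ℂ h 0 := hΦ.analyticAt_inv.comp_zero hfΦ hfΦ0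
  have hh0 : h 0 = 0 := by simp only [hh, hfΦ0, hΦ.inv_zero]
  have hconj : ∀ᶠ z in 𝓝 0, f (Φ z) = Φ (h z) := by
    filter_upwards [(hfΦ.tendsto_zero hfΦ0).eventually hΦ.right_inv] with z hz
    exact hz.symm
  have hΦz : ∀ y, Φ (0, y) = M.param (ψ y) := fun y => hΦ₀z _
  have hfΦz : ∀ᶠ y in 𝓝 0, f (Φ (0, y)) = M.param (g (ψ y)) := by
    filter_upwards [hψ.tendsto.eventually hfp] with y hy
    rw [hΦz, hy]
  have hinv : ∀ᶠ y in 𝓝 0, h (0, y) = (0, μ y) := by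
    filter_upwards [hfΦz, hψc, hμt.eventually (tendsto_zero_prod.eventually hΦ.left_inv)]
      with y e1 e2 e3
    simp only [hh]
    rw [e1, e2, ← hΦz, e3]
  -- The change `(x, y) ↦ (x, ψ y)` does not touch the normal coordinate, so the normal derivative
  -- of `h` is the matrix `A` of `df` on the normal bundle, read at `ψ y`.
  have hnormal : ∀ᶠ y in 𝓝 0, normalPart h y = A (ψ y) := by
    have hct : Tendsto (fun y => Φ (0, y)) (𝓝 (0 : Fin r → ℂ)) (𝓝 0) :=
      hΦ.tendsto.comp tendsto_zero_prod
    have hft : Tendsto (fun y => f (Φ (0, y))) (𝓝 (0 : Fin r → ℂ)) (𝓝 0) :=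
      hf.tendsto.comp hct
    filter_upwards [hfΦz, tendsto_zero_prod.eventually hΦ.analyticAt.eventually_analyticAt,
      hct.eventually hf.analyticAt.eventually_analyticAt,
      hft.eventually hG₀.analyticAt_inv.eventually_analyticAt,
      hψ.analyticAt.eventually_analyticAt,
      (tendsto_zero_prod.eventually hP.analyticAt.eventually_analyticAt),
      tendsto_zero_prod.eventually hhan.eventually_analyticAt,
      hψ.tendsto.eventually (tendsto_zero_prod.eventually hG₀.analyticAt.eventually_analyticAt)]
      with y e1 d1 d2 d3 d4 d5 d6 d7
    refine ContinuousLinearMap.ext fun x => ?_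
    have k1 : HasFDerivAt (fun z => f (Φ z)) (fderiv ℂ f (Φ (0, y)) ∘L fderiv ℂ Φ (0, y)) (0, y) :=
      HasFDerivAt.comp ((0 : Fin s → ℂ), y) (g := f) (f := Φ) d2.differentiableAt.hasFDerivAt
        d1.differentiableAt.hasFDerivAt
    have k2 := HasFDerivAt.comp ((0 : Fin s → ℂ), y) (g := G₀) (f := fun z => f (Φ z))
      d3.differentiableAt.hasFDerivAt k1
    have k3 : HasFDerivAt (fun z => (h z).1) (ContinuousLinearMap.fst ℂ _ _ ∘L _) (0, y) :=
      HasFDerivAt.comp ((0 : Fin s → ℂ), y) (g := Prod.fst) (f := fun z => G₀ (f (Φ z)))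
        hasFDerivAt_fst k2
    have k4 : HasFDerivAt (fun z => (h z).1) (ContinuousLinearMap.fst ℂ _ _ ∘L _) (0, y) :=
      hasFDerivAt_fst.comp ((0 : Fin s → ℂ), y) d6.differentiableAt.hasFDerivAt
    have k5 := DFunLike.congr_fun (k4.unique k3) (x, 0)
    have k6 : HasFDerivAt (fun z : (Fin s → ℂ) × (Fin r → ℂ) => (z.1, ψ z.2))
        ((ContinuousLinearMap.fst ℂ (Fin s → ℂ) (Fin r → ℂ)).prod
          (fderiv ℂ ψ y ∘L ContinuousLinearMap.snd ℂ (Fin s → ℂ) (Fin r → ℂ))) (0, y) :=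
      hasFDerivAt_fst.prodMk (HasFDerivAt.comp ((0 : Fin s → ℂ), y) (g := ψ)
        d4.differentiableAt.hasFDerivAt hasFDerivAt_snd)
    have k7 : HasFDerivAt Φ _ (0, y) := HasFDerivAt.comp ((0 : Fin s → ℂ), y) (g := Φ₀)
      d7.differentiableAt.hasFDerivAt k6
    have k8 : fderiv ℂ Φ (0, y) (x, 0) = fderiv ℂ Φ₀ (0, ψ y) (x, 0) := by
      rw [k7.fderiv]
      simp
    simp only [ContinuousLinearMap.comp_apply] at k5
    rw [k8, e1, hΦz] at k5
    exact k5
  refine ⟨Φ, G, h, fun y => Γ (ψ y), hΦ, hhan, hconj, hinv, ?_, hΓ.comp_zero hψ.analyticAt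
    hψ.map_zero, by simp only [hψ.map_zero, hΓ0], ?_⟩
  · have hdψ : ∀ y, fderiv ℂ g 0 (fderiv ℂ ψ 0 y) = fderiv ℂ ψ 0 (μ y) := by
      have k1 := hg.fderiv_comp_zero hψ.analyticAt hψ.map_zero
      have k2 := hψ.analyticAt.fderiv_comp_zero (μ.analyticAt 0) (map_zero μ)
      rw [Filter.EventuallyEq.fderiv_eq hψc, k2, μ.fderiv] at k1
      exact fun w => (DFunLike.congr_fun k1 w).symm
    have hdΦ : ∀ v, fderiv ℂ Φ 0 v = fderiv ℂ M.param 0 (fderiv ℂ ψ 0 v.2) + C v.1 := by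
      intro v
      have k1 : fderiv ℂ Φ 0 = _ := hΦ₀an.fderiv_comp_zero hP.analyticAt hP.map_zero
      have k6 : HasFDerivAt (fun z : (Fin s → ℂ) × (Fin r → ℂ) => (z.1, ψ z.2))
          ((ContinuousLinearMap.fst ℂ (Fin s → ℂ) (Fin r → ℂ)).prod
            (fderiv ℂ ψ 0 ∘L ContinuousLinearMap.snd ℂ (Fin s → ℂ) (Fin r → ℂ))) 0 :=
        hasFDerivAt_fst.prodMk (HasFDerivAt.comp (0 : (Fin s → ℂ) × (Fin r → ℂ)) (g := ψ)
          hψ.analyticAt.differentiableAt.hasFDerivAt hasFDerivAt_snd)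
      rw [k1, k6.fderiv, ContinuousLinearMap.comp_apply, hΦ₀d]
      rfl
    have k1 := hf.analyticAt.fderiv_comp_zero hΦ.analyticAt hΦ.map_zero
    have k2 := hΦ.analyticAt.fderiv_comp_zero hhan hh0
    rw [Filter.EventuallyEq.fderiv_eq hconj, k2] at k1
    refine ContinuousLinearMap.ext fun v => ?_
    have e := DFunLike.congr_fun k1 v
    -- The differential of `h` is block diagonal because the complement used in the tubular chart is
    -- spanned by eigenvectors `c i` of `df`.
    have e2 : fderiv ℂ Φ 0 ((diagMap ν).prodMap μ v) = fderiv ℂ f 0 (fderiv ℂ Φ 0 v) := by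
      rw [hdΦ, hdΦ, map_add, hdg, hdψ, hdfC]
      rfl
    rw [← hΦ.fderiv_leftInverse ((diagMap ν).prodMap μ v), e2,
      ← hΦ.fderiv_leftInverse (fderiv ℂ h 0 v)]
    exact congrArg _ e
  · filter_upwards [hnormal.eventually_nhds, hψ.tendsto.eventually hΓc, hXψ, hψc,
      hψ.analyticAt.eventually_analyticAt,
      hψ.tendsto.eventually hAan.eventually_analyticAt] with y e1 e2 e3 e4 d1 d2
    have k1 := HasFDerivAt.comp y (g := A) (f := ψ) d2.differentiableAt.hasFDerivAt
      d1.differentiableAt.hasFDerivAt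
    rw [(k1.congr_of_eventuallyEq (f₁ := normalPart h) e1).fderiv, e1.self_of_nhds,
      ContinuousLinearMap.comp_apply, ← e3, e2, ← hgdef, e4]

end SubmanifoldGerm

/-! ### An osculating manifold yields a linearization. -/

/-- A quasi-Brjuno germ with an osculating manifold on which it is linearizable is linearizable. -/
theorem isHolLinearizable_of_isOsculating {s r : ℕ} (hs : 1 ≤ s)
    {f : (Fin (s + r) → ℂ) → (Fin (s + r) → ℂ)} {lam : Fin (s + r) → ℂ}
    (hf : IsQuasiBrjuno s f lam) {M : SubmanifoldGerm (s + r) r} (hM : M.IsOsculating f)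
    (hspec : M.HasTangentSpectrum f s lam) (hlin : IsHolLinearizable (M.restrict f)) :
    IsHolLinearizable f := by
  obtain ⟨hfd, ⟨b, hb⟩, hL, hB⟩ := hf
  obtain ⟨f', hf'⟩ := isHolDiffeoGerm_iff.1 hfd
  obtain ⟨hinv, D, -, hD⟩ := hM
  have hlam : ∀ i, lam i ≠ 0 := fun i => eigenvalue_ne_zero_of_isGermIso hf' (b.ne_zero i) (hb i)
  have hg := M.analyticAt_restrict hf'.analyticAt hf'.map_zero
  have hg0 := M.restrict_zero hf'.map_zero
  obtain ⟨c, t, hc, ht, hcM⟩ := exists_adapted_eigenbasis (W := Fin r → ℂ) b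
    (L := (fderiv ℂ f 0).toLinearMap) hb
    (by simp) (j := (fderiv ℂ M.param 0).toLinearMap) M.fderiv_param_injective
    (m := (fderiv ℂ (M.restrict f) 0).toLinearMap) (by
      have k1 := hf'.analyticAt.fderiv_comp_zero M.analyticAt_param M.param_zero
      have k2 := M.analyticAt_param.fderiv_comp_zero hg hg0
      rw [Filter.EventuallyEq.fderiv_eq (hinv.param_restrict hf'.analyticAt hf'.map_zero), k2]
        at k1
      exact fun w => (DFunLike.congr_fun k1 w).symm) hspec
  obtain ⟨φ, hφ, hφc⟩ := hlin
  obtain ⟨φ', hφ'⟩ := isHolDiffeoGerm_iff.1 hφ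
  set T : (Fin r → ℂ) ≃L[ℂ] (Fin r → ℂ) := t.equivFun.symm.toContinuousLinearEquiv with hT
  have hTapp : ∀ y, T y = ∑ i, y i • t i := fun y => t.equivFun_symm_apply y
  set μ : (Fin r → ℂ) →L[ℂ] (Fin r → ℂ) := diagMap fun j => lam (Fin.natAdd s j) with hμ
  have hgT : ∀ y, fderiv ℂ (M.restrict f) 0 (T y) = T (μ y) := fun y => by
    rw [hTapp, hTapp, map_sum]
    refine Finset.sum_congr rfl fun i _ => ?_
    rw [map_smul]
    refine (congrArg _ (ht i)).trans ?_
    rw [smul_smul, hμ, diagMap_apply, mul_comm]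
  have hψc : ∀ᶠ y in 𝓝 0, M.restrict f (φ (T y)) = φ (T (μ y)) := by
    filter_upwards [T.isGermIso.tendsto.eventually hφc] with y hy
    rw [hy, hgT]
  obtain ⟨Φ, G, h, Γ, hΦ, hhan, hconj, hhinv, hd, hΓ, hΓ0, hcomm⟩ :=
    M.exists_adapted_chart hf' hinv hD hc hcM rfl (hφ'.comp T.isGermIso) hψc
  obtain ⟨S, S', hS, hS0, -, hS', hS'0, hS'S, hSS', hkz, hkn, hkd⟩ :=
    exists_straightening hhan hhinv hd hΓ hΓ0 hcomm
  have hSiso : IsGermIso S S' := ⟨hS, hS', hS0, hS'0, hS'S, hSS'⟩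
  have hh0 : h 0 = 0 := by
    have := hhinv.self_of_nhds
    rwa [map_zero] at this
  have hhS := hhan.comp_zero hS hS0
  have hhS0 : h (S 0) = 0 := by rw [hS0, hh0]
  obtain ⟨Ψ, K, hΨ, hΨc⟩ := exists_linearization_prod hs hlam hL hB
    (hS'.comp_zero hhS hhS0) rfl hμ hkd hkz hkn
  refine isHolLinearizable_of_conj hf'.analyticAt ((hΦ.comp hSiso).comp hΨ) (A := diagMap lam) ?_
  filter_upwards [hΨc, hΨ.tendsto.eventually (hSiso.tendsto.eventually hconj),
    hΨ.tendsto.eventually ((hhS.tendsto_zero hhS0).eventually hSS')] with z e1 e2 e3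
  rw [e2, ← e3, e1]

/-! ### The osculating manifold of a linear model. -/

namespace SubmanifoldGerm

variable {n r s : ℕ} {f : (Fin n → ℂ) → (Fin n → ℂ)}

theorem NormalEq.of_eventuallyEq {M : SubmanifoldGerm n r} {V W : (Fin r → ℂ) → (Fin n → ℂ)}
    (h : ∀ᶠ y in 𝓝 0, V y = W y) : M.NormalEq V W := by
  filter_upwards [h] with y hy
  rw [hy, sub_self]
  exact Submodule.zero_mem _

/-- The image of the second factor under an analytic chart. -/
def ofChart {Φ : (Fin s → ℂ) × (Fin r → ℂ) → (Fin n → ℂ)}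
    {G : (Fin n → ℂ) → (Fin s → ℂ) × (Fin r → ℂ)} (h : IsGermIso Φ G) : SubmanifoldGerm n r where
  -- The carrier is the fixed set of the retraction `param ∘ chart`, which makes `param_chart` hold
  -- by definition.
  carrier := {z | Φ (0, (G z).2) = z}
  param y := Φ (0, y)
  chart z := (G z).2
  analyticAt_param := h.analyticAt.comp_zero_prod
  analyticAt_chart := analyticAt_snd.comp h.analyticAt_inv
  zero_mem := by
    change Φ (0, (G 0).2) = 0
    rw [h.inv_zero]
    exact h.map_zero
  param_zero := h.map_zero
  param_mem := by
    filter_upwards [tendsto_zero_prod.eventually h.left_inv] with y hy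
    rw [hy]
  chart_param := by
    filter_upwards [tendsto_zero_prod.eventually h.left_inv] with y hy
    rw [hy]
  param_chart := by
    filter_upwards [self_mem_nhdsWithin] with z hz
    exact hz

variable {M : SubmanifoldGerm n r} {N : (Fin r → ℂ) → (Fin n → ℂ) →L[ℂ] (Fin s → ℂ)}
  {C : (Fin r → ℂ) → (Fin s → ℂ) →L[ℂ] (Fin n → ℂ)}

/-- The connection which makes a normal frame parallel. -/
noncomputable def IsNormalFrame.connection (F : M.IsNormalFrame N C) : M.NormalConnection where
  cov X V y := C y (fderiv ℂ (fun y => N y (V y)) y (X y))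
  analyticAt_cov X V hX hV := analyticAt_clm_apply F.analyticAt_section
    (analyticAt_clm_apply (analyticAt_clm_apply F.analyticAt_proj hV).fderiv hX)
  congr_field X X' V _ _ _ h := by
    refine NormalEq.of_eventuallyEq ?_
    filter_upwards [h] with y hy
    rw [hy]
  congr_section X V V' _ _ _ h := by
    refine NormalEq.of_eventuallyEq ?_
    rw [F.normalEq_iff] at h
    filter_upwards [h.eventually_nhds] with y hy
    rw [Filter.EventuallyEq.fderiv_eq hy]
  add_field X X' V _ _ _ := by
    refine NormalEq.of_eventuallyEq (Eventually.of_forall fun y => ?_)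
    rw [map_add, map_add]
  smul_field g X V _ _ _ := by
    refine NormalEq.of_eventuallyEq (Eventually.of_forall fun y => ?_)
    rw [map_smul, map_smul]
  add_section X V V' _ hV hV' := by
    refine NormalEq.of_eventuallyEq ?_
    filter_upwards [(analyticAt_clm_apply F.analyticAt_proj hV).eventually_analyticAt,
      (analyticAt_clm_apply F.analyticAt_proj hV').eventually_analyticAt] with y d1 d2
    simp only [map_add]
    rw [fderiv_fun_add d1.differentiableAt d2.differentiableAt, add_apply, map_add]
  leibniz g X V hg _ hV := by
    rw [F.normalEq_iff]
    filter_upwards [(analyticAt_clm_apply F.analyticAt_proj hV).eventually_analyticAt,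
      hg.eventually_analyticAt, F.proj_section] with y d1 d2 e
    simp only [map_smul, map_add, e]
    rw [fderiv_fun_smul d2.differentiableAt d1.differentiableAt]
    simp [add_comm]

namespace IsNormalFrame

theorem proj_connection (F : M.IsNormalFrame N C) (X : (Fin r → ℂ) → (Fin r → ℂ))
    (V : (Fin r → ℂ) → (Fin n → ℂ)) :
    ∀ᶠ y in 𝓝 0, N y (F.connection.cov X V y) = fderiv ℂ (fun y => N y (V y)) y (X y) := by
  filter_upwards [F.proj_section] with y e
  exact e _

/-- In the frame, covariant differentiation is differentiation of components. The second derivatives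
cancel by symmetry, and the derivatives of the two fields make up their bracket. -/
theorem connection_isFlat (F : M.IsNormalFrame N C) : F.connection.IsFlat := by
  intro X X' V hX hX' hV
  set u : (Fin r → ℂ) → (Fin s → ℂ) := fun y => N y (V y) with hu
  have huan : AnalyticAt ℂ u 0 := analyticAt_clm_apply F.analyticAt_proj hV
  have second : ∀ Y Y' : (Fin r → ℂ) → (Fin r → ℂ), AnalyticAt ℂ Y' 0 →
      ∀ᶠ y in 𝓝 0, N y (F.connection.cov Y (F.connection.cov Y' V) y) =
        fderiv ℂ (fderiv ℂ u) y (Y y) (Y' y) + fderiv ℂ u y (fderiv ℂ Y' y (Y y)) := by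
    intro Y Y' hY'
    filter_upwards [F.proj_connection Y (F.connection.cov Y' V),
      (F.proj_connection Y' V).eventually_nhds, huan.eventually_analyticAt,
      hY'.eventually_analyticAt] with y e1 e2 d1 d2
    rw [e1, Filter.EventuallyEq.fderiv_eq e2,
      (d1.fderiv.differentiableAt.hasFDerivAt.clm_apply d2.differentiableAt.hasFDerivAt).fderiv]
    simp [add_comm]
  rw [F.normalEq_iff]
  filter_upwards [second X X' hX', second X' X hX, F.proj_connection (VectorField.lieBracket ℂ X X')
    V, huan.eventually_analyticAt] with y e1 e2 e3 d
  have hsymm : IsSymmSndFDerivAt ℂ u y := d.contDiffAt.isSymmSndFDerivAt (n := ⊤) (by simp)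
  rw [map_sub, e1, e2, e3, VectorField.lieBracket, map_sub, hsymm.eq (X y) (X' y)]
  abel

/-- If the germ acts on the normal frame by a constant matrix, it commutes with the associated
connection. -/
theorem connection_commutesWith (F : M.IsNormalFrame N C) (hf : AnalyticAt ℂ f 0)
    (hf0 : f 0 = 0) (hM : M.IsInvariant f) {Λ : (Fin s → ℂ) →L[ℂ] (Fin s → ℂ)}
    (hΛ : ∀ᶠ y in 𝓝 0, normalMap M N C f y = Λ) : F.connection.CommutesWith f := by
  have hg := M.analyticAt_restrict hf hf0
  have hg0 := M.restrict_zero hf0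
  have hgt := hg.tendsto_zero hg0
  have hfp := hM.param_restrict hf hf0
  intro X X' V W _ _ hV hW hXX' hVW
  rw [F.sectionPushforward_iff hf hg hg0 hfp] at hVW ⊢
  filter_upwards [hVW.eventually_nhds, hΛ.eventually_nhds, hXX', F.proj_connection X V,
    hgt.eventually (F.proj_connection X' W), hg.eventually_analyticAt,
    (analyticAt_clm_apply F.analyticAt_proj hV).eventually_analyticAt,
    hgt.eventually (analyticAt_clm_apply F.analyticAt_proj hW).eventually_analyticAt]
    with y e1 e2 e3 e4 e5 d1 d2 d3
  rw [e4, e5, e3, e2.self_of_nhds]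
  have k1 := HasFDerivAt.comp y (g := fun y => N y (W y)) (f := M.restrict f)
    d3.differentiableAt.hasFDerivAt d1.differentiableAt.hasFDerivAt
  have k2 := HasFDerivAt.comp y (g := Λ) (f := fun y => N y (V y)) Λ.hasFDerivAt
    d2.differentiableAt.hasFDerivAt
  have k3 := k2.congr_of_eventuallyEq (f₁ := (fun y => N y (W y)) ∘ M.restrict f) (by
    filter_upwards [e1, e2] with z h1 h2
    rw [Function.comp_apply, h1, h2]
    rfl)
  exact DFunLike.congr_fun (k1.unique k3) (X y)

end IsNormalFrame

section LinearModel

variable {Φ : (Fin s → ℂ) × (Fin r → ℂ) → (Fin n → ℂ)}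
  {G : (Fin n → ℂ) → (Fin s → ℂ) × (Fin r → ℂ)} (hΦ : IsGermIso Φ G)
  {Λ : (Fin s → ℂ) →L[ℂ] (Fin s → ℂ)} {μ : (Fin r → ℂ) →L[ℂ] (Fin r → ℂ)}

theorem apply_ofChart_param (hc : ∀ᶠ z in 𝓝 0, f (Φ z) = Φ (Λ.prodMap μ z)) :
    ∀ᶠ y in 𝓝 (0 : Fin r → ℂ), f (Φ (0, y)) = Φ (0, μ y) := by
  filter_upwards [tendsto_zero_prod.eventually hc] with y hy
  rw [hy]
  simp

theorem restrict_ofChart (hc : ∀ᶠ z in 𝓝 0, f (Φ z) = Φ (Λ.prodMap μ z)) :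
    ∀ᶠ y in 𝓝 0, (ofChart hΦ).restrict f y = μ y := by
  have hμt : Tendsto μ (𝓝 0) (𝓝 0) := μ.continuous.tendsto' 0 0 (map_zero _)
  filter_upwards [apply_ofChart_param hc,
    hμt.eventually (tendsto_zero_prod.eventually hΦ.left_inv)] with y e1 e2
  change (G (f (Φ (0, y)))).2 = μ y
  rw [e1, e2]

theorem isInvariant_ofChart (hc : ∀ᶠ z in 𝓝 0, f (Φ z) = Φ (Λ.prodMap μ z)) :
    (ofChart hΦ).IsInvariant f := by
  have hμt : Tendsto μ (𝓝 0) (𝓝 0) := μ.continuous.tendsto' 0 0 (map_zero _)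
  have hGt : Tendsto (fun z => (G z).2) (𝓝 0) (𝓝 0) :=
    (ofChart hΦ).analyticAt_chart.tendsto_zero (ofChart hΦ).chart_zero
  have h1 : ∀ᶠ z in 𝓝 0, f (Φ (0, (G z).2)) = Φ (0, μ (G z).2) :=
    hGt.eventually (apply_ofChart_param hc)
  have h2 : ∀ᶠ z in 𝓝 0, G (Φ (0, μ (G z).2)) = (0, μ (G z).2) :=
    (hμt.comp hGt).eventually (tendsto_zero_prod.eventually hΦ.left_inv)
  filter_upwards [self_mem_nhdsWithin, nhdsWithin_le_nhds h1, nhdsWithin_le_nhds h2]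
    with z hz e1 e2
  change Φ (0, (G (f z)).2) = f z
  rw [show Φ (0, (G z).2) = z from hz] at e1
  rw [e1, e2]

/-- The second factor is an osculating manifold of a germ which is linear and splits in a chart. -/
theorem isOsculating_ofChart (hf : AnalyticAt ℂ f 0) (hf0 : f 0 = 0)
    (hc : ∀ᶠ z in 𝓝 0, f (Φ z) = Φ (Λ.prodMap μ z)) : (ofChart hΦ).IsOsculating f := by
  have hM := isInvariant_ofChart hΦ hc
  have F := (ofChart hΦ).isNormalFrame_of_chart hΦ.analyticAt hΦ.map_zero hΦ.analyticAt_inv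
    hΦ.left_inv hΦ.right_inv fun _ => rfl
  refine ⟨hM, F.connection, F.connection_isFlat, F.connection_commutesWith hf hf0 hM (Λ := Λ) ?_⟩
  have hpt := (ofChart hΦ).analyticAt_param.tendsto_zero (ofChart hΦ).param_zero
  have hA : Tendsto (Λ.prodMap μ) (𝓝 0) (𝓝 0) :=
    (Λ.prodMap μ).continuous.tendsto' 0 0 (map_zero _)
  -- The chart conjugates `f` to `Λ × μ` near the whole germ of `M`. Differentiating this at points
  -- of `M` and taking the first component gives the constant normal matrix `Λ`.
  have hGf : ∀ᶠ z in 𝓝 0, G (f z) = Λ.prodMap μ (G z) := by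
    filter_upwards [hΦ.symm.tendsto.eventually hc, hΦ.right_inv,
      hΦ.symm.tendsto.eventually (hA.eventually hΦ.left_inv)] with z e1 e2 e3
    rw [e2] at e1
    rw [e1, e3]
  filter_upwards [F.proj_section, hM.param_restrict hf hf0, hpt.eventually hGf.eventually_nhds,
    hpt.eventually hf.eventually_analyticAt,
    hpt.eventually hΦ.analyticAt_inv.eventually_analyticAt,
    hpt.eventually ((hf.tendsto_zero hf0).eventually hΦ.analyticAt_inv.eventually_analyticAt)]
    with y e1 e2 e3 d1 d2 d3
  refine ContinuousLinearMap.ext fun x => ?_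
  have k1 := HasFDerivAt.comp ((ofChart hΦ).param y) (g := G) (f := f)
    d3.differentiableAt.hasFDerivAt d1.differentiableAt.hasFDerivAt
  have k2 := (HasFDerivAt.comp ((ofChart hΦ).param y) (g := Λ.prodMap μ) (f := G)
    (Λ.prodMap μ).hasFDerivAt d2.differentiableAt.hasFDerivAt).congr_of_eventuallyEq
    (f₁ := G ∘ f) e3
  have k3 := congrArg Prod.fst (DFunLike.congr_fun (k1.unique k2)
    (fderiv ℂ Φ (0, y) (x, 0)))
  rw [e2] at k3
  refine k3.trans ?_
  exact congrArg Λ (e1 x)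

end LinearModel

end SubmanifoldGerm

/-- A linearizable germ with diagonalizable differential has an osculating manifold as in the
characterization of linearizability. -/
theorem exists_isOsculating_of_isHolLinearizable {s r : ℕ}
    {f : (Fin (s + r) → ℂ) → (Fin (s + r) → ℂ)} {lam : Fin (s + r) → ℂ} (hf : IsHolDiffeoGerm f)
    (b : Module.Basis (Fin (s + r)) ℂ (Fin (s + r) → ℂ))
    (hb : ∀ i, fderiv ℂ f 0 (b i) = lam i • b i) (hlin : IsHolLinearizable f) :
    ∃ M : SubmanifoldGerm (s + r) r,
      M.IsOsculating f ∧ M.HasTangentSpectrum f s lam ∧ IsHolLinearizable (M.restrict f) := by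
  obtain ⟨f', hf'⟩ := isHolDiffeoGerm_iff.1 hf
  obtain ⟨φ, hφ, hφc⟩ := hlin
  obtain ⟨φ', hφ'⟩ := isHolDiffeoGerm_iff.1 hφ
  set κ := splitCoords s r with hκ
  set T : (Fin (s + r) → ℂ) ≃L[ℂ] (Fin (s + r) → ℂ) := b.equivFun.symm.toContinuousLinearEquiv
  have hTapp : ∀ y, T y = ∑ i, y i • b i := fun y => b.equivFun_symm_apply y
  have hfT : ∀ y, fderiv ℂ f 0 (T y) = T (diagMap lam y) := fun y => by
    simp only [hTapp, map_sum, map_smul, hb, smul_smul, diagMap_apply, mul_comm]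
  set Λ : (Fin s → ℂ) →L[ℂ] (Fin s → ℂ) := diagMap fun i => lam (Fin.castAdd r i)
  set μ : (Fin r → ℂ) →L[ℂ] (Fin r → ℂ) := diagMap fun j => lam (Fin.natAdd s j) with hμ
  have hΦ := hφ'.comp (T.isGermIso.comp κ.symm.isGermIso)
  have hc : ∀ᶠ z in 𝓝 0, f (φ (T (κ.symm z))) = φ (T (κ.symm (Λ.prodMap μ z))) := by
    filter_upwards [(T.isGermIso.comp κ.symm.isGermIso).tendsto.eventually hφc] with z hz
    rw [hz, hfT]
    congr 2
    apply κ.injective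
    rw [hκ, splitCoords_diagMap, ← hκ, κ.apply_symm_apply, κ.apply_symm_apply]
  have hg := SubmanifoldGerm.restrict_ofChart hΦ hc
  have hdg : fderiv ℂ ((SubmanifoldGerm.ofChart hΦ).restrict f) 0 = μ := by
    rw [Filter.EventuallyEq.fderiv_eq hg, μ.fderiv]
  refine ⟨SubmanifoldGerm.ofChart hΦ,
    SubmanifoldGerm.isOsculating_ofChart hΦ hf'.analyticAt hf'.map_zero hc, ?_, ?_⟩
  · rw [SubmanifoldGerm.HasTangentSpectrum, hdg, charpoly_eq_prod_of_eigenbasis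
      (Pi.basisFun ℂ (Fin r)) (μ := fun j => lam (Fin.natAdd s j)), Finset.prod_filter,
      Fin.prod_univ_add]
    · simp [fun x : Fin s => x.2.not_ge]
    · intro i
      ext j
      by_cases hij : j = i
      · subst hij
        simp [hμ]
      · simp [hμ, hij]
  · refine isHolLinearizable_of_conj ((SubmanifoldGerm.ofChart hΦ).analyticAt_restrict
      hf'.analyticAt hf'.map_zero) (ContinuousLinearEquiv.refl ℂ (Fin r → ℂ)).isGermIso
      (A := μ) ?_
    filter_upwards [hg] with y hy
    exact hy

theorem theorem1p11 {n s : ℕ} (hs : 1 ≤ s) (hsn : s ≤ n)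
    (f : (Fin n → ℂ) → (Fin n → ℂ)) (lam : Fin n → ℂ) (hf : IsQuasiBrjuno s f lam) :
    IsHolLinearizable f ↔
      ∃ M : SubmanifoldGerm n (n - s),
        M.IsOsculating f ∧ M.HasTangentSpectrum f s lam ∧ IsHolLinearizable (M.restrict f) := by
  obtain ⟨r, rfl⟩ := Nat.exists_eq_add_of_le hsn
  rw [Nat.add_sub_cancel_left]
  constructor
  · obtain ⟨hfd, ⟨b, hb⟩, -, -⟩ := hf
    exact exists_isOsculating_of_isHolLinearizable hfd b hb
  · rintro ⟨M, hM, hspec, hlin⟩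
    exact isHolLinearizable_of_isOsculating hs hf hM hspec hlin
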